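/- Let $\mathfrak A_0,\mathfrak A_1$ be complex Hilbert spaces, let $A_0$ be a (possibly unbounded) self-adjoint operator in $\mathfrak A_0$ with spectral measure $\mathsf E_0$, let $A_1$ be a bounded self-adjoint operator on $\mathfrak A_1$, and let $B:\mathfrak A_1\to\mathfrak A_0$ be a bounded operator. In $\mathfrak A_0\oplus\mathfrak A_1$ consider $$L=\begin{pmatrix}A_0&B\\-B^*&A_1\end{pmatrix},\quad \mathrm{Dom}(L)=\mathrm{Dom}(A_0)\oplus\mathfrak A_1,\qquad J=\begin{pmatrix}I&0\\0&-I\end{pmatrix}.$$ Assume that the spectrum of $A_0$ is absolutely continuous and equals the closure of an open interval $\Delta_0=(\mu_0^{(1)},\mu_0^{(2)})$, $-\infty\le\mu_0^{(1)}<\mu_0^{(2)}\le\infty$, and that $\sigma_1:=\mathrm{spec}(A_1)\subset\Delta_0$. Assume that $K_B(\mu)=B^*\mathsf E_0((-\infty,\mu))B$ is differentiable in operator norm on $\Delta_0$ and that $K_B'$ admits an analytic continuation from $\Delta_0$ to a simply connected domain $D^-\subset\mathbb C^-$ whose boundary contains $\Delta_0$, and hence also to $D^+=\{\bar z: z\in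 D^-\}$. If an end point $\mu_0^{(k)}$ is finite, assume that $\|K_B'(\mu)\|\le C|\mu-\mu_0^{(k)}|^{\gamma}$ for the $\mu\in D^\pm$ near $\mu_0^{(k)}$, with some $C>0$, $\gamma\in(-1,0]$. If $\Delta_0$ is unbounded, assume that $\|K_B'(\mu)\|\le C|\mu|^N$ for all $\mu\in D^\pm$ with $|\mu|$ large, with some $C>0$, $N\in\mathbb N$. Let $l\in\{-1,+1\}$ (with $D^{\pm1}=D^{\pm}$) and let $\Gamma\subset D^l$ be a (locally) rectifiable Jordan curve obtained from $\Delta_0$ by a continuous deformation inside $\Delta_0\cup D^l$, with finite end points kept fixed and infinite ones kept at infinity, such that $$\mathcal V_0:=\int_\Gamma|d\mu|\,\|K_B'(\mu)\|<\infty,\qquad \mathcal V_0<\tfrac14 d^2,\qquad d:=\mathrm{dist}(\sigma_1,\Gamma).$$ Let $X$ be the bounded operator on $\mathfrak A_1$ that is the unique solution, in the balls $\|X\|\le r$ with $d/2-\sqrt{d^2/4-\mathcal V_0}\le r<d-\sqrt{\mathcal V_0}$, of $$X=-\int_\Gamma d\mu\,K_B'(\mu)(A_1+X-\mu)^{-1},$$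 put $Z^{(l)}=A_1+X$, and assume that $\mathrm{dist}(\mathrm{spec}(Z^{(l)}),D^l)>0$. Then the integral $$Y^{(l)}=\int_{\Delta_0}\mathsf E_0(d\mu)\,B\,(Z^{(l)}-\mu)^{-1}$$ exists in the strong sense (as a limit of Riemann-Stieltjes sums, improper at the end points of $\Delta_0$) and is a bounded operator $\mathfrak A_1\to\mathfrak A_0$, and its adjoint $\widetilde Y^{(l)}=(Y^{(l)})^*$ is a strong solution of the dual Riccati equation: $$\widetilde Y^{(l)}A_0x-A_1\widetilde Y^{(l)}x+\widetilde Y^{(l)}B\widetilde Y^{(l)}x=-B^*x\quad\text{for all }x\in\mathrm{Dom}(A_0).$$ The graphs $$\mathcal G(\widetilde Y^{(l)})=\{x_0\oplus\widetilde Y^{(l)}x_0: x_0\in\mathfrak A_0\},\qquad \mathcal G(Y^{(l)})=\{Y^{(l)}x_1\oplus x_1: x_1\in\mathfrak A_1\}$$ are closed subspaces that are mutually $J$-orthogonal, i.e. $\langle Jx,y\rangle=0$ for all $x\in\mathcal G(\widetilde Y^{(l)})$, $y\in\mathcal G(Y^{(l)})$, and invariant under $L$: $Lx\in\mathcal G(\widetilde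 Y^{(l)})$ for all $x\in\mathrm{Dom}(L)\cap\mathcal G(\widetilde Y^{(l)})$, and $Ly\in\mathcal G(Y^{(l)})$ for all $y\in\mathrm{Dom}(L)\cap\mathcal G(Y^{(l)})$. -/

import Mathlib

open Set Filter Topology MeasureTheory
open scoped ENNReal

noncomputable section

namespace BlockRiccati

/-! ## Spectral measures of (unbounded) self-adjoint operators -/

/-- A projection-valued measure on the Borel sets of the real line: the values are orthogonal
projections, multiplicative on intersections, normalised and strongly countably additive. -/
structure SpectralMeasure (H : Type*) [NormedAddCommGroup H] [InnerProductSpace ℂ H]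
    [CompleteSpace H] where
  proj : Set ℝ → H →L[ℂ] H
  isStarProjection : ∀ s, MeasurableSet s → IsStarProjection (proj s)
  empty : proj ∅ = 0
  univ : proj univ = 1
  inter : ∀ s t, MeasurableSet s → MeasurableSet t → proj (s ∩ t) = proj s * proj t
  iUnion : ∀ f : ℕ → Set ℝ, (∀ i, MeasurableSet (f i)) →
    Pairwise (Function.onFun Disjoint f) → ∀ x, HasSum (fun i => proj (f i) x) (proj (⋃ i, f i) x)

section Spectral

variable {H : Type*} [NormedAddCommGroup H] [InnerProductSpace ℂ H] [CompleteSpace H]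

theorem SpectralMeasure.re_inner_nonneg (E : SpectralMeasure H) (x : H) {s : Set ℝ}
    (hs : MeasurableSet s) : 0 ≤ (inner ℂ x (E.proj s x)).re := by
  obtain ⟨h1, h2⟩ := E.isStarProjection s hs
  have h3 : E.proj s x = E.proj s (E.proj s x) := by
    conv_lhs => rw [← h1.eq]
    rfl
  have h4 := (ContinuousLinearMap.isSelfAdjoint_iff_isSymmetric.mp h2) x (E.proj s x)
  have h5 : inner ℂ (E.proj s x) (E.proj s x) = inner ℂ x (E.proj s (E.proj s x)) := h4
  rw [h3, ← h5]
  exact inner_self_nonneg (𝕜 := ℂ)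

/-- The scalar measure `s ↦ ⟪x, E(s) x⟫` of a vector `x`. -/
def SpectralMeasure.scalar (E : SpectralMeasure H) (x : H) : Measure ℝ :=
  Measure.ofMeasurable (fun s _ => ENNReal.ofReal (inner ℂ x (E.proj s x)).re)
    (by simp [E.empty])
    (by
      intro f hf hd
      have h := (E.iUnion f hf hd x).mapL (innerSL ℂ x)
      have h' := h.mapL Complex.reCLM
      have h2 : HasSum (fun i => (inner ℂ x (E.proj (f i) x)).re)
          (inner ℂ x (E.proj (⋃ i, f i) x)).re := h'
      rw [← h2.tsum_eq]
      exact ENNReal.ofReal_tsum_of_nonneg (fun i => E.re_inner_nonneg x (hf i)) h2.summable)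

/-- `E` is the spectral measure of the operator `A`, that is `A = ∫ t dE(t)`: the domain of `A`
consists of the vectors with finite second moment, and the quadratic form of `A` is the first
moment (by polarization this determines `A` from `E`). -/
structure IsSpectralMeasureOf (E : SpectralMeasure H) (A : H →ₗ.[ℂ] H) : Prop where
  mem_domain_iff : ∀ x : H, x ∈ A.domain ↔ ∫⁻ t, ENNReal.ofReal (t ^ 2) ∂(E.scalar x) < ⊤
  inner_eq : ∀ x : A.domain,
    inner ℂ (x : H) (A x) = ((∫ t, t ∂(E.scalar (x : H)) : ℝ) : ℂ)

/-- The spectrum of an unbounded operator: the complement of the set of the points `z` for which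
`A - z : Dom A → H` has a bounded two-sided inverse defined on the whole space. -/
def unboundedSpectrum (A : H →ₗ.[ℂ] H) : Set ℂ :=
  {z | ¬ ∃ R : H →L[ℂ] H,
    (∀ y : H, ∃ h : R y ∈ A.domain, A ⟨R y, h⟩ - z • R y = y) ∧
    ∀ x : A.domain, R (A x - z • (x : H)) = x}

end Spectral

section Main

variable {H₀ H₁ : Type*}
  [NormedAddCommGroup H₀] [InnerProductSpace ℂ H₀] [CompleteSpace H₀]
  [NormedAddCommGroup H₁] [InnerProductSpace ℂ H₁] [CompleteSpace H₁]

/-! ## The block operator matrix, the involution `J`, graph subspaces, the Riccati equation -/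

/-- The block operator matrix `L = [[A₀, B], [-B*, A₁]]` with domain `Dom A₀ ⊕ H₁` in the
orthogonal sum `H₀ ⊕ H₁`. -/
def blockOperator (A₀ : H₀ →ₗ.[ℂ] H₀) (A₁ : H₁ →L[ℂ] H₁) (B : H₁ →L[ℂ] H₀) :
    WithLp 2 (H₀ × H₁) →ₗ.[ℂ] WithLp 2 (H₀ × H₁) where
  domain := A₀.domain.comap (WithLp.fstₗ 2 ℂ H₀ H₁)
  toFun :=
    { toFun := fun x => WithLp.toLp 2
        (A₀ ⟨x.1.fst, x.2⟩ + B x.1.snd, -(ContinuousLinearMap.adjoint B x.1.fst) + A₁ x.1.snd)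
      map_add' := by
        intro x y
        have h : A₀ ⟨(x + y).1.fst, (x + y).2⟩ = A₀ ⟨x.1.fst, x.2⟩ + A₀ ⟨y.1.fst, y.2⟩ := by
          rw [← A₀.map_add]; rfl
        rw [h, ← WithLp.toLp_add]
        congr 1
        ext
        · simp; abel
        · simp; abel
      map_smul' := by
        intro c x
        have h : A₀ ⟨(c • x).1.fst, (c • x).2⟩ = c • A₀ ⟨x.1.fst, x.2⟩ := by
          rw [← A₀.map_smul]; rfl
        rw [h, RingHom.id_apply, ← WithLp.toLp_smul]
        congr 1
        ext <;> simp }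

/-- The involution `J = diag(I, -I)` on `H₀ ⊕ H₁`. -/
def involutionJ (x : WithLp 2 (H₀ × H₁)) : WithLp 2 (H₀ × H₁) :=
  WithLp.toLp 2 (x.fst, -x.snd)

/-- The graph `{x₀ ⊕ T x₀}` of an operator `T : H₀ → H₁`. -/
def graphOverFst (T : H₀ →L[ℂ] H₁) : Submodule ℂ (WithLp 2 (H₀ × H₁)) where
  carrier := {x | x.snd = T x.fst}
  add_mem' := by
    intro a b ha hb
    simp only [mem_ofPred_eq] at ha hb ⊢
    simp [ha, hb]
  zero_mem' := by simp
  smul_mem' := by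
    intro c x hx
    simp only [mem_ofPred_eq] at hx ⊢
    simp [hx]

/-- The graph `{Y x₁ ⊕ x₁}` of an operator `Y : H₁ → H₀`. -/
def graphOverSnd (Y : H₁ →L[ℂ] H₀) : Submodule ℂ (WithLp 2 (H₀ × H₁)) where
  carrier := {x | x.fst = Y x.snd}
  add_mem' := by
    intro a b ha hb
    simp only [mem_ofPred_eq] at ha hb ⊢
    simp [ha, hb]
  zero_mem' := by simp
  smul_mem' := by
    intro c x hx
    simp only [mem_ofPred_eq] at hx ⊢
    simp [hx]

/-- The submodule `S` is a closed invariant subspace of the (unbounded) operator `T`. -/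
def IsInvariantSubspace {H : Type*} [NormedAddCommGroup H] [InnerProductSpace ℂ H]
    (T : H →ₗ.[ℂ] H) (S : Submodule ℂ H) : Prop :=
  IsClosed (S : Set H) ∧ ∀ x : T.domain, (x : H) ∈ S → T x ∈ S

/-- `T` is a strong solution of the dual Riccati equation `T A₀ - A₁ T + T B T = -B*`. As `A₁` is
bounded with domain `H₁`, the requirement that `T` map `Dom A₀` into `Dom A₁` is void. -/
def IsStrongSolutionDualRiccati (A₀ : H₀ →ₗ.[ℂ] H₀) (A₁ : H₁ →L[ℂ] H₁) (B : H₁ →L[ℂ] H₀)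
    (T : H₀ →L[ℂ] H₁) : Prop :=
  ∀ x : A₀.domain,
    T (A₀ x) - A₁ (T (x : H₀)) + T (B (T (x : H₀))) = -(ContinuousLinearMap.adjoint B (x : H₀))

/-! ## The derivative of `K_B` and its analytic continuation -/

/-- The open interval with the (possibly infinite) end points `μ₁`, `μ₂`. -/
def openInterval (μ₁ μ₂ : EReal) : Set ℝ := {t : ℝ | μ₁ < (t : EReal) ∧ (t : EReal) < μ₂}

/-- `K_B(μ) = B* E((-∞, μ)) B`. -/
def spectralK (E : SpectralMeasure H₀) (B : H₁ →L[ℂ] H₀) (μ : ℝ) : H₁ →L[ℂ] H₁ :=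
  (ContinuousLinearMap.adjoint B) ∘L (E.proj (Iio μ)) ∘L B

/-- `D^l` for `l = ±1`, given `D^-`: the domain `D^+` is the complex conjugate of `D^-`. -/
def sheetDomain (D : Set ℂ) (l : ℤˣ) : Set ℂ :=
  if l = -1 then D else {z | (starRingEnd ℂ) z ∈ D}

/-- `K'` is the norm derivative of `K_B` on the interval `Δ₀` together with its analytic
continuation to the simply connected domain `D = D^-` of the lower half-plane and to the conjugate
domain `D^+`. It is subject to an integrable power bound near the finite end points of `Δ₀`, and to
a polynomial bound at infinity if `Δ₀` is unbounded. -/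
structure IsContinuedDerivative (E : SpectralMeasure H₀) (B : H₁ →L[ℂ] H₀) (μ₁ μ₂ : EReal)
    (D : Set ℂ) (K' : ℂ → H₁ →L[ℂ] H₁) : Prop where
  isOpen : IsOpen D
  isSimplyConnected : IsSimplyConnected D
  lower : ∀ z ∈ D, z.im < 0
  subset_frontier : ∀ t ∈ openInterval μ₁ μ₂, (t : ℂ) ∈ frontier D
  hasDerivAt : ∀ t ∈ openInterval μ₁ μ₂, HasDerivAt (spectralK E B) (K' (t : ℂ)) t
  analytic : AnalyticOnNhd ℂ K'
    (Complex.ofReal '' openInterval μ₁ μ₂ ∪ ⋃ l : ℤˣ, sheetDomain D l)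
  bound_endpoint : ∀ c : ℝ, ((c : EReal) = μ₁ ∨ (c : EReal) = μ₂) →
    ∃ C > (0 : ℝ), ∃ γ ∈ Ioc (-1 : ℝ) 0, ∃ δ > (0 : ℝ), ∀ l : ℤˣ, ∀ z ∈ sheetDomain D l,
      ‖z - c‖ < δ → ‖K' z‖ ≤ C * ‖z - c‖ ^ γ
  bound_infinity : (μ₁ = ⊥ ∨ μ₂ = ⊤) →
    ∃ C > (0 : ℝ), ∃ N : ℕ, ∃ R > (0 : ℝ), ∀ l : ℤˣ, ∀ z ∈ sheetDomain D l,
      R < ‖z‖ → ‖K' z‖ ≤ C * ‖z‖ ^ N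

/-! ## Admissible contours -/

/-- `Γ = g(Δ₀)` is a (locally) rectifiable Jordan curve in the domain `D`, arising from a continuous
deformation `h` of the interval `Δ₀` within `Δ₀ ∪ D`; finite end points remain fixed during the
deformation and infinite ones remain at infinity. A locally rectifiable Jordan arc can always be
parametrized in a locally Lipschitz way. -/
structure IsContour (μ₁ μ₂ : EReal) (D : Set ℂ) (g : ℝ → ℂ) : Prop where
  injOn : InjOn g (openInterval μ₁ μ₂)
  locallyLipschitzOn : LocallyLipschitzOn (openInterval μ₁ μ₂) g
  deformation : ∃ h : ℝ → ℝ → ℂ,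
    ContinuousOn (fun p : ℝ × ℝ => h p.1 p.2) (Icc 0 1 ×ˢ openInterval μ₁ μ₂) ∧
    (∀ t ∈ openInterval μ₁ μ₂, h 0 t = (t : ℂ)) ∧
    (∀ t ∈ openInterval μ₁ μ₂, h 1 t = g t) ∧
    (∀ s ∈ Ioc (0 : ℝ) 1, ∀ t ∈ openInterval μ₁ μ₂, h s t ∈ D) ∧
    (∀ c : ℝ, (c : EReal) = μ₁ →
      TendstoUniformlyOn (fun t s => h s t) (fun _ => (c : ℂ)) (𝓝[>] c) (Icc 0 1)) ∧
    (∀ c : ℝ, (c : EReal) = μ₂ →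
      TendstoUniformlyOn (fun t s => h s t) (fun _ => (c : ℂ)) (𝓝[<] c) (Icc 0 1)) ∧
    (μ₁ = ⊥ → ∀ R : ℝ, ∀ᶠ t in atBot, ∀ s ∈ Icc (0 : ℝ) 1, R ≤ ‖h s t‖) ∧
    (μ₂ = ⊤ → ∀ R : ℝ, ∀ᶠ t in atTop, ∀ s ∈ Icc (0 : ℝ) 1, R ≤ ‖h s t‖)

/-- The variation `V₀(B, Γ) = ∫_Γ |dμ| ‖K'(μ)‖` along the contour `Γ = g(Δ₀)`. -/
def contourVariation (μ₁ μ₂ : EReal) (K' : ℂ → H₁ →L[ℂ] H₁) (g : ℝ → ℂ) : ℝ≥0∞ :=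
  ∫⁻ t in openInterval μ₁ μ₂, ‖deriv g t‖ₑ * ‖K' (g t)‖ₑ

/-- The distance of two subsets of the complex plane (infinite if one of them is empty). -/
def setDist (S T : Set ℂ) : ℝ≥0∞ := ⨅ z ∈ S, Metric.infEDist z T

/-- `(Z - μ)⁻¹`, for `μ` outside the spectrum of `Z`. -/
def resolventAt (Z : H₁ →L[ℂ] H₁) (μ : ℂ) : H₁ →L[ℂ] H₁ :=
  Ring.inverse (Z - μ • (1 : H₁ →L[ℂ] H₁))

/-- The transformator `W₁(Z, Γ) = -∫_Γ dμ K'(μ) (Z - μ)⁻¹`, with `Γ = g(Δ₀)`. -/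
def transformator (μ₁ μ₂ : EReal) (K' : ℂ → H₁ →L[ℂ] H₁) (g : ℝ → ℂ)
    (Z : H₁ →L[ℂ] H₁) : H₁ →L[ℂ] H₁ :=
  -∫ t in openInterval μ₁ μ₂, deriv g t • (K' (g t) * resolventAt Z (g t))

/-- `X` solves the basic equation `X = W₁(A₁ + X, Γ)`, where the spectrum of `A₁ + X` does not meet
the contour `Γ = g(Δ₀)`. -/
def IsBasicSolution (μ₁ μ₂ : EReal) (K' : ℂ → H₁ →L[ℂ] H₁) (g : ℝ → ℂ) (A₁ : H₁ →L[ℂ] H₁)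
    (X : H₁ →L[ℂ] H₁) : Prop :=
  Disjoint (spectrum ℂ (A₁ + X)) (g '' openInterval μ₁ μ₂) ∧
    X = transformator μ₁ μ₂ K' g (A₁ + X)

/-! ## Strong operator Stieltjes integrals `∫ E(dμ) F(μ)` -/

/-- `v = ∫_[a,b) E(dμ) F(μ) x`, the limit of the Riemann-Stieltjes sums over tagged partitions of
`[a, b]` as the mesh tends to zero. -/
def HasStieltjesIntegral (E : SpectralMeasure H₀) (F : ℝ → H₁ →L[ℂ] H₀) (a b : ℝ) (x : H₁)
    (v : H₀) : Prop :=
  ∀ ε > (0 : ℝ), ∃ δ > (0 : ℝ), ∀ (n : ℕ) (t ξ : ℕ → ℝ), t 0 = a → t n = b →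
    (∀ k < n, t k ≤ ξ k ∧ ξ k ≤ t (k + 1) ∧ t (k + 1) - t k < δ) →
    ‖∑ k ∈ Finset.range n, E.proj (Ico (t k) (t (k + 1))) (F (ξ k) x) - v‖ < ε

/-- `Y = ∫_Δ E(dμ) F(μ)` in the strong sense, over an open interval `Δ`: for each `x`, the integrals
over `[a, b)` exist for `a ≤ b` in `Δ` and converge to `Y x` as `a` and `b` tend to the
end points of `Δ`. -/
def HasStrongIntegral (E : SpectralMeasure H₀) (F : ℝ → H₁ →L[ℂ] H₀) (Δ : Set ℝ)
    (Y : H₁ →L[ℂ] H₀) : Prop :=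
  ∀ x : H₁, ∃ I : ℝ → ℝ → H₀,
    (∀ a ∈ Δ, ∀ b ∈ Δ, a ≤ b → HasStieltjesIntegral E F a b x (I a b)) ∧
    ∀ ε > (0 : ℝ), ∃ a₀ ∈ Δ, ∃ b₀ ∈ Δ, a₀ ≤ b₀ ∧
      ∀ a ∈ Δ, a ≤ a₀ → ∀ b ∈ Δ, b₀ ≤ b → ‖I a b - Y x‖ < ε

end Main

end BlockRiccati

end

/-! Put Z = A₁ + X and R(μ) = (Z - μ)⁻¹. Two identities for Y = ∫ E₀(dμ) B R(μ) carry the theorem.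
Since E₀ turns A₀ into multiplication by μ and μ R(μ) = R(μ) Z - 1, one has A₀ Y = Y Z - B, in the
weak form ⟪A₀ x, Y y⟫ = ⟪x, Y Z y - B y⟫ for x in Dom A₀ (`exists_hasStrongIntegral`). Since B*
E₀(dμ) B = K_B'(μ) dμ on Δ₀, one has B* Y = ∫_{Δ₀} K_B'(μ) R(μ) dμ; by Cauchy's theorem this is the
integral over Γ, which is -X by the basic equation (`integral_inner_eq_contour`). Hence Z = A₁ - B*
Y and A₀ Y = Y A₁ - Y B* Y - B. The adjoint of this equation is the dual Riccati equation, the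
J-orthogonality is the definition of the adjoint, and the invariance of the graphs rephrases the two
Riccati equations.

Existence of Y. For a C¹ function v the integral ∫ E₀(dμ) v(μ) over [a, b) is defined by integration
by parts. The Riemann-Stieltjes sums converge to it because errors on disjoint intervals are
orthogonal. Differentiation in the upper limit gives ‖∫_[a,b) E₀(dt) B R(t) x‖² = ∫_a^b ⟪R(t)x,
K_B'(t) R(t)x⟫ dt with a nonnegative integrand (`norm_resolventIntegral_sq`), so the improper
integral exists once this energy is bounded over all [a, b] in Δ₀. The growth of K_B' is only
polynomial, but with a weight (1 + t²)^(-m) the bound is immediate. The relation t R(t) x = R(t) Z x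
- x and the a priori bound ∫ ⟪x, K_B'(t) x⟫ dt ≤ ‖B x‖² then lower m step by step to 0
(`weighted_energy_bound_step`).

Cauchy's theorem. The deformation is merely continuous, so the argument uses a primitive F on the
simply connected domain (`exists_primitive`) and its boundary values on Δ₀. Interval and curve are
joined near each end point by an arc of a circle on which radius times integrand is small. That such
an arc lies in the domain is a winding argument: a deformation that missed a point of the arc would
yield a nonvanishing function on a rectangle that crosses the negative half-axis exactly once along
the boundary (`no_single_crossing`, `exists_crosscut`). Polynomial growth at infinity is removed by
a factor (1 + iεz)^(-N-2) with ε → 0, and the upper half-plane is reached by conjugation. -/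

namespace BlockRiccati

/-! ## Primitives on simply connected domains -/

/-- The integral of `f` along the segment from `z` to `w`. -/
noncomputable def segmentIntegral (f : ℂ → ℂ) (z w : ℂ) : ℂ :=
  (w - z) * ∫ t in (0 : ℝ)..1, f (z + t • (w - z))

theorem segmentIntegral_eq_sub {f F : ℂ → ℂ} {s : Set ℂ} (hs : Convex ℝ s)
    (hf : ContinuousOn f s) (hF : ∀ z ∈ s, HasDerivAt F (f z) z) {z w : ℂ}
    (hz : z ∈ s) (hw : w ∈ s) : segmentIntegral f z w = F w - F z := by
  have hmem : ∀ t ∈ Icc (0 : ℝ) 1, z + t • (w - z) ∈ s := fun t ht =>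
    hs.add_smul_sub_mem hz hw ht
  have h := intervalIntegral.integral_unitInterval_deriv_eq_sub (𝕜 := ℂ) (f := F) (f' := f) (z₀ := z)
    (z₁ := w - z) (hf.comp (by fun_prop) hmem) (fun t ht => hF _ (hmem t ht))
  rw [segmentIntegral, ← smul_eq_mul, h]
  simp

/-- The sum of the integrals of `f` along the segments which connect the consecutive points of the
curve `γ` at the dyadic parameters of level `n`. -/
noncomputable def dyadicSum (f : ℂ → ℂ) (γ : ℝ → ℂ) (n : ℕ) : ℂ :=
  ∑ j ∈ Finset.range (2 ^ n), segmentIntegral f (γ (j / 2 ^ n)) (γ ((j + 1) / 2 ^ n))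

theorem sum_range_two_mul {M : Type*} [AddCommMonoid M] (a : ℕ → M) (m : ℕ) :
    ∑ j ∈ Finset.range (2 * m), a j = ∑ j ∈ Finset.range m, (a (2 * j) + a (2 * j + 1)) := by
  induction m with
  | zero => simp
  | succ k ih =>
    rw [show 2 * (k + 1) = 2 * k + 1 + 1 by ring, Finset.sum_range_succ, Finset.sum_range_succ, ih,
      Finset.sum_range_succ, add_assoc]

theorem exists_primitive_ball {f : ℂ → ℂ} {D : Set ℂ} (hf : DifferentiableOn ℂ f D) {z : ℂ}
    {r : ℝ} (hr : Metric.ball z r ⊆ D) : ∃ F : ℂ → ℂ, ∀ w ∈ Metric.ball z r,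
      HasDerivAt F (f w) w :=
  (hf.mono hr).isExactOn_ball

theorem segmentIntegral_add {f : ℂ → ℂ} {D : Set ℂ} (hf : DifferentiableOn ℂ f D) {c : ℂ}
    {r : ℝ} (hr : Metric.ball c r ⊆ D) {u v w : ℂ} (hu : u ∈ Metric.ball c r)
    (hv : v ∈ Metric.ball c r) (hw : w ∈ Metric.ball c r) :
    segmentIntegral f u v + segmentIntegral f v w = segmentIntegral f u w := by
  obtain ⟨F, hF⟩ := exists_primitive_ball hf hr
  have hc := hf.continuousOn.mono hr
  rw [segmentIntegral_eq_sub (convex_ball c r) hc hF hu hv,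
    segmentIntegral_eq_sub (convex_ball c r) hc hF hv hw,
    segmentIntegral_eq_sub (convex_ball c r) hc hF hu hw]
  ring

theorem dyadic_mem {n j : ℕ} (hj : j < 2 ^ n) : (j : ℝ) / 2 ^ n ∈ Icc (0 : ℝ) 1 ∧
    ((j : ℝ) + 1) / 2 ^ n ∈ Icc (0 : ℝ) 1 := by
  have h : (j : ℝ) + 1 ≤ 2 ^ n := by exact_mod_cast hj
  refine ⟨⟨by positivity, ?_⟩, ⟨by positivity, ?_⟩⟩ <;> rw [div_le_one (by positivity)] <;> linarith

/-- The two halves of a dyadic interval and the whole of it give three chords inside one ball of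
`D`, where `f` has a primitive; inserting the midpoint therefore changes nothing. -/
theorem dyadicSum_succ {f : ℂ → ℂ} {D : Set ℂ} (hf : DifferentiableOn ℂ f D) {γ : ℝ → ℂ} {δ : ℝ}
    (hδ : 0 < δ) {n : ℕ} (hball : ∀ t ∈ Icc (0 : ℝ) 1, Metric.ball (γ t) δ ⊆ D)
    (hclose : ∀ t ∈ Icc (0 : ℝ) 1, ∀ t' ∈ Icc (0 : ℝ) 1, |t' - t| ≤ 1 / 2 ^ n →
      γ t' ∈ Metric.ball (γ t) δ) :
    dyadicSum f γ (n + 1) = dyadicSum f γ n := by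
  unfold dyadicSum
  rw [pow_succ' 2 n, sum_range_two_mul]
  refine Finset.sum_congr rfl fun j hj => ?_
  rw [Finset.mem_range] at hj
  obtain ⟨h1, h2⟩ := dyadic_mem hj
  have h2n : (0 : ℝ) < 2 ^ n := by positivity
  have e1 : ((2 * j : ℕ) : ℝ) / 2 ^ (n + 1) = j / 2 ^ n := by
    push_cast; rw [pow_succ]; field_simp
  have e2 : ((2 * j + 1 : ℕ) : ℝ) / 2 ^ (n + 1) = (j + 1 / 2) / 2 ^ n := by
    push_cast; rw [pow_succ]; field_simp
  have e3 : (((2 * j + 1 : ℕ) : ℝ) + 1) / 2 ^ (n + 1) = (j + 1) / 2 ^ n := by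
    push_cast; rw [pow_succ]; field_simp; ring
  have e4 : (((2 * j : ℕ) : ℝ) + 1) / 2 ^ (n + 1) = (j + 1 / 2) / 2 ^ n := by
    push_cast; rw [pow_succ]; field_simp
  simp only [pow_succ] at e1 e2 e3 e4 ⊢
  simp only [e1, e2, e3, e4]
  have hm : ((j : ℝ) + 1 / 2) / 2 ^ n ∈ Icc (0 : ℝ) 1 :=
    ⟨by positivity, le_trans (by gcongr; norm_num) h2.2⟩
  refine segmentIntegral_add hf (hball _ h1) (Metric.mem_ball_self hδ) ?_ ?_
  · refine hclose _ h1 _ hm ?_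
    rw [← sub_div, abs_div, abs_of_pos h2n]; gcongr
    rw [abs_le]; constructor <;> linarith
  · refine hclose _ h1 _ h2 ?_
    rw [← sub_div, abs_div, abs_of_pos h2n]; gcongr
    rw [abs_le]; constructor <;> linarith

/-- Corresponding chords of the two curves bound a quadrilateral inside one ball, so they differ by
the integrals over the two connecting segments. These telescope, and the outermost ones vanish
because the end points agree. -/
theorem dyadicSum_eq_of_close {f : ℂ → ℂ} {D : Set ℂ} (hf : DifferentiableOn ℂ f D)
    {γ γ' : ℝ → ℂ} {δ : ℝ} {n : ℕ}
    (hball : ∀ t ∈ Icc (0 : ℝ) 1, Metric.ball (γ t) δ ⊆ D)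
    (hclose : ∀ t ∈ Icc (0 : ℝ) 1, ∀ t' ∈ Icc (0 : ℝ) 1, |t' - t| ≤ 1 / 2 ^ n →
      γ t' ∈ Metric.ball (γ t) δ ∧ γ' t' ∈ Metric.ball (γ t) δ)
    (h0 : γ' 0 = γ 0) (h1 : γ' 1 = γ 1) :
    dyadicSum f γ' n = dyadicSum f γ n := by
  have h2n : (0 : ℝ) < 2 ^ n := by positivity
  have key : ∀ j ∈ Finset.range (2 ^ n),
      segmentIntegral f (γ' (j / 2 ^ n)) (γ' ((j + 1) / 2 ^ n)) =
      segmentIntegral f (γ (j / 2 ^ n)) (γ ((j + 1) / 2 ^ n)) +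
      ((fun i : ℕ => segmentIntegral f (γ (i / 2 ^ n)) (γ' (i / 2 ^ n))) (j + 1)
        - (fun i : ℕ => segmentIntegral f (γ (i / 2 ^ n)) (γ' (i / 2 ^ n))) j) := by
    intro j hj
    rw [Finset.mem_range] at hj
    obtain ⟨m1, m2⟩ := dyadic_mem hj
    have d1 : |((j : ℝ)) / 2 ^ n - j / 2 ^ n| ≤ 1 / 2 ^ n := by simp
    have d2 : |((j : ℝ) + 1) / 2 ^ n - j / 2 ^ n| ≤ 1 / 2 ^ n := by
      rw [← sub_div, abs_div, abs_of_pos h2n]; gcongr; simp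
    obtain ⟨a1, a2⟩ := hclose _ m1 _ m1 d1
    obtain ⟨b1, b2⟩ := hclose _ m1 _ m2 d2
    have A := segmentIntegral_add hf (hball _ m1) a1 a2 b2
    have B := segmentIntegral_add hf (hball _ m1) a1 b1 b2
    push_cast
    linear_combination A - B
  unfold dyadicSum
  rw [Finset.sum_congr rfl key, Finset.sum_add_distrib,
    Finset.sum_range_sub (fun i : ℕ => segmentIntegral f (γ (i / 2 ^ n)) (γ' (i / 2 ^ n)))]
  have hzero : ∀ z, segmentIntegral f z z = 0 := by simp [segmentIntegral]
  simp [h0, h1, hzero]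

/-- The compact image of the square has a δ-neighbourhood inside `D`, and uniform continuity gives a
level from which neighbouring dyadic parameters stay δ-close in both variables. From that level on
the sums are independent of the level and of the stage of the homotopy. The common eventual value
serves as the integral of a merely continuous curve. -/
theorem exists_dyadicSum_homotopy {f : ℂ → ℂ} {D : Set ℂ} (hD : IsOpen D)
    (hf : DifferentiableOn ℂ f D) {H : ℝ → ℝ → ℂ} (hH : Continuous fun p : ℝ × ℝ => H p.1 p.2)
    (hHD : ∀ s t, H s t ∈ D) (h0 : ∀ s, H s 0 = H 0 0) (h1 : ∀ s, H s 1 = H 0 1) :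
    ∃ c : ℂ, (∀ᶠ n in atTop, dyadicSum f (H 0) n = c) ∧
      ∀ᶠ n in atTop, dyadicSum f (H 1) n = c := by
  set Q : Set (ℝ × ℝ) := Icc (0 : ℝ) 1 ×ˢ Icc (0 : ℝ) 1 with hQ
  have hQc : IsCompact Q := isCompact_Icc.prod isCompact_Icc
  obtain ⟨δ, hδ, hthick⟩ := (hQc.image hH).exists_thickening_subset_open hD
    (by rintro _ ⟨p, -, rfl⟩; exact hHD _ _)
  have hball : ∀ s ∈ Icc (0 : ℝ) 1, ∀ t ∈ Icc (0 : ℝ) 1, Metric.ball (H s t) δ ⊆ D :=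
    fun s hs t ht => (Metric.ball_subset_thickening (mem_image_of_mem (fun p : ℝ × ℝ => H p.1 p.2)
      (mk_mem_prod hs ht)) δ).trans hthick
  obtain ⟨η, hη, hunif⟩ := Metric.uniformContinuousOn_iff.1
    (hQc.uniformContinuousOn_of_continuous hH.continuousOn) δ hδ
  obtain ⟨n₀, hn₀⟩ := exists_pow_lt_of_lt_one hη (by norm_num : (1 / 2 : ℝ) < 1)
  have hsmall : ∀ n ≥ n₀, (1 : ℝ) / 2 ^ n < η := fun n hn => by
    refine lt_of_le_of_lt ?_ hn₀
    rw [one_div_pow]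
    gcongr
    norm_num
  have hclose : ∀ n ≥ n₀, ∀ s ∈ Icc (0 : ℝ) 1, ∀ s' ∈ Icc (0 : ℝ) 1, |s' - s| ≤ 1 / 2 ^ n →
      ∀ t ∈ Icc (0 : ℝ) 1, ∀ t' ∈ Icc (0 : ℝ) 1, |t' - t| ≤ 1 / 2 ^ n →
      H s' t' ∈ Metric.ball (H s t) δ := by
    intro n hn s hs s' hs' hss t ht t' ht' htt
    refine hunif (s', t') ⟨hs', ht'⟩ (s, t) ⟨hs, ht⟩ ?_
    rw [Prod.dist_eq]
    exact max_lt (lt_of_le_of_lt hss (hsmall n hn)) (lt_of_le_of_lt htt (hsmall n hn))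
  have z0 : (0 : ℝ) ∈ Icc (0 : ℝ) 1 := by simp
  have z1 : (1 : ℝ) ∈ Icc (0 : ℝ) 1 := by simp
  have hsucc : ∀ n ≥ n₀, ∀ s ∈ Icc (0 : ℝ) 1, dyadicSum f (H s) (n + 1) = dyadicSum f (H s) n :=
    fun n hn s hs => dyadicSum_succ hf hδ (hball s hs)
      fun t ht t' ht' htt => hclose n hn s hs s hs (by simp) t ht t' ht' htt
  have hconst : ∀ s ∈ Icc (0 : ℝ) 1, ∀ n ≥ n₀, dyadicSum f (H s) n = dyadicSum f (H s) n₀ := by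
    intro s hs n hn
    induction n, hn using Nat.le_induction with
    | base => rfl
    | succ k hk ih => rw [hsucc k hk s hs, ih]
  have hmove : ∀ j : ℕ, j ≤ 2 ^ n₀ → dyadicSum f (H (j / 2 ^ n₀)) n₀ = dyadicSum f (H 0) n₀ := by
    intro j
    induction j with
    | zero => simp
    | succ k ih =>
      intro hk
      rw [← ih (by omega)]
      obtain ⟨m1, m2⟩ := dyadic_mem (show k < 2 ^ n₀ by omega)
      push_cast
      refine dyadicSum_eq_of_close hf (hball _ m1) (fun t ht t' ht' htt => ⟨?_, ?_⟩) ?_ ?_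
      · exact hclose n₀ le_rfl _ m1 _ m1 (by simp) t ht t' ht' htt
      · refine hclose n₀ le_rfl _ m1 _ m2 ?_ t ht t' ht' htt
        rw [← sub_div, abs_div, abs_of_pos (by positivity : (0 : ℝ) < 2 ^ n₀)]; gcongr; simp
      · rw [h0, ← h0 (k / 2 ^ n₀)]
      · rw [h1, ← h1 (k / 2 ^ n₀)]
  refine ⟨dyadicSum f (H 0) n₀, ?_, ?_⟩
  · filter_upwards [eventually_ge_atTop n₀] with n hn using hconst 0 z0 n hn
  · filter_upwards [eventually_ge_atTop n₀] with n hn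
    have := hmove (2 ^ n₀) le_rfl
    rw [show (((2 ^ n₀ : ℕ) : ℝ)) / 2 ^ n₀ = 1 by push_cast; field_simp] at this
    rw [hconst 1 z1 n hn, this]

/-- The curve in the plane that a path in a subset traces out. -/
noncomputable def pathCurve {D : Set ℂ} {a b : D} (γ : Path a b) (t : ℝ) : ℂ := (γ.extend t : ℂ)

/-- Projection onto the unit interval extends a path homotopy to all real parameters. The case `γ' =
γ` is useful as well: it says that the dyadic sums along one path are eventually constant. -/
theorem exists_dyadicSum_path_eq {f : ℂ → ℂ} {D : Set ℂ} (hD : IsOpen D)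
    [SimplyConnectedSpace D] (hf : DifferentiableOn ℂ f D) {a b : D} (γ γ' : Path a b) :
    ∃ c : ℂ, (∀ᶠ n in atTop, dyadicSum f (pathCurve γ) n = c) ∧
      ∀ᶠ n in atTop, dyadicSum f (pathCurve γ') n = c := by
  obtain ⟨K⟩ := SimplyConnectedSpace.paths_homotopic γ γ'
  have h01 : (0 : ℝ) ≤ 1 := zero_le_one
  have e0 : pathCurve γ = fun t => (K (projIcc 0 1 h01 0, projIcc 0 1 h01 t) : ℂ) := by
    ext t
    rw [projIcc_left]
    change _ = ((K (0, projIcc 0 1 h01 t) : D) : ℂ)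
    rw [K.apply_zero]; rfl
  have e1 : pathCurve γ' = fun t => (K (projIcc 0 1 h01 1, projIcc 0 1 h01 t) : ℂ) := by
    ext t
    rw [projIcc_right]
    change _ = ((K (1, projIcc 0 1 h01 t) : D) : ℂ)
    rw [K.apply_one]; rfl
  rw [e0, e1]
  refine exists_dyadicSum_homotopy (H := fun s t => (K (projIcc 0 1 h01 s, projIcc 0 1 h01 t) : ℂ))
    hD hf ?_ (fun s t => Subtype.coe_prop _) (fun s => ?_) (fun s => ?_)
  · have := continuous_projIcc (h := h01)
    exact continuous_subtype_val.comp (K.continuous.comp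
      ((this.comp continuous_fst).prodMk (this.comp continuous_snd)))
  · rw [projIcc_left]
    change ((K (_, 0) : D) : ℂ) = (K (_, 0) : D)
    rw [K.source, K.source]
  · rw [projIcc_right]
    change ((K (_, 1) : D) : ℂ) = (K (_, 1) : D)
    rw [K.target, K.target]

/-- The equality is exact, without a limit: the two paths meet at the parameter 1/2, a dyadic point
of every level `n + 1`, and each half is run at double speed. -/
theorem dyadicSum_trans {f : ℂ → ℂ} {D : Set ℂ} {a b c : D} (γ : Path a b) (σ : Path b c) (n : ℕ) :
    dyadicSum f (pathCurve (γ.trans σ)) (n + 1) =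
      dyadicSum f (pathCurve γ) n + dyadicSum f (pathCurve σ) n := by
  have h2n : (0 : ℝ) < 2 ^ n := by positivity
  unfold dyadicSum
  rw [pow_succ, mul_two, Finset.sum_range_add]
  congr 1
  · refine Finset.sum_congr rfl fun j hj => ?_
    rw [Finset.mem_range] at hj
    obtain ⟨m1, m2⟩ := dyadic_mem hj
    have e1 : (j : ℝ) / 2 ^ (n + 1) = (j / 2 ^ n) / 2 := by rw [pow_succ]; field_simp
    have e2 : ((j : ℝ) + 1) / 2 ^ (n + 1) = ((j + 1) / 2 ^ n) / 2 := by rw [pow_succ]; field_simp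
    unfold pathCurve
    rw [e1, e2, Path.extend_trans_of_le_half, Path.extend_trans_of_le_half]
    · congr 3 <;> ring_nf
    · linarith [m2.2]
    · linarith [m1.2]
  · refine Finset.sum_congr rfl fun j hj => ?_
    rw [Finset.mem_range] at hj
    obtain ⟨m1, m2⟩ := dyadic_mem hj
    have e1 : ((2 ^ n + j : ℕ) : ℝ) / (2 ^ n * 2) = 1 / 2 + (j / 2 ^ n) / 2 := by
      push_cast; field_simp
    have e2 : (((2 ^ n + j : ℕ) : ℝ) + 1) / (2 ^ n * 2) = 1 / 2 + ((j + 1) / 2 ^ n) / 2 := by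
      push_cast; field_simp; ring
    unfold pathCurve
    rw [pow_succ, e1, e2, Path.extend_trans_of_half_le, Path.extend_trans_of_half_le]
    · congr 4 <;> ring
    · linarith [m2.1]
    · linarith [m1.1]

theorem dyadicSum_segment {f : ℂ → ℂ} {D : Set ℂ} (hf : DifferentiableOn ℂ f D) {z w : ℂ}
    {r : ℝ} (hr : Metric.ball z r ⊆ D) (hw : w ∈ Metric.ball z r) {γ : ℝ → ℂ}
    (hγ : ∀ t ∈ Icc (0 : ℝ) 1, γ t = z + t • (w - z)) (n : ℕ) :
    dyadicSum f γ n = segmentIntegral f z w := by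
  have hr0 : 0 < r := dist_nonneg.trans_lt hw
  have hz : z ∈ Metric.ball z r := Metric.mem_ball_self hr0
  obtain ⟨F, hF⟩ := exists_primitive_ball hf hr
  have hc := hf.continuousOn.mono hr
  have hmem : ∀ t ∈ Icc (0 : ℝ) 1, γ t ∈ Metric.ball z r := fun t ht => by
    rw [hγ t ht]; exact (convex_ball z r).add_smul_sub_mem hz hw ht
  have key : ∀ j ∈ Finset.range (2 ^ n),
      segmentIntegral f (γ (j / 2 ^ n)) (γ ((j + 1) / 2 ^ n)) =
      (fun i : ℕ => F (γ (i / 2 ^ n))) (j + 1) - (fun i : ℕ => F (γ (i / 2 ^ n))) j := by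
    intro j hj
    rw [Finset.mem_range] at hj
    obtain ⟨m1, m2⟩ := dyadic_mem hj
    rw [segmentIntegral_eq_sub (convex_ball z r) hc hF (hmem _ m1) (hmem _ m2)]
    push_cast; rfl
  unfold dyadicSum
  rw [Finset.sum_congr rfl key, Finset.sum_range_sub (fun i : ℕ => F (γ (i / 2 ^ n))),
    segmentIntegral_eq_sub (convex_ball z r) hc hF hz hw]
  have h2n : (2 : ℝ) ^ n ≠ 0 := by positivity
  simp [h2n, hγ 0 (by simp), hγ 1 (by simp)]

/-- A holomorphic function on a simply connected domain has a primitive. -/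
theorem exists_primitive {f : ℂ → ℂ} {D : Set ℂ} (hD : IsOpen D) (hs : IsSimplyConnected D)
    (hf : DifferentiableOn ℂ f D) : ∃ F : ℂ → ℂ, ∀ z ∈ D, HasDerivAt F (f z) z := by
  classical
  have := hs.simplyConnectedSpace
  obtain ⟨z₀, hz₀⟩ := hs.nonempty
  have hp : ∀ z : D, Nonempty (Path (⟨z₀, hz₀⟩ : D) z) := fun z => PathConnectedSpace.joined _ z
  let P := fun z => (hp z).some
  -- Each chosen path is compared with itself; `V` is the eventual value of its dyadic sums and will
  -- be the primitive.
  choose V hV hV' using fun z => exists_dyadicSum_path_eq hD hf (P z) (P z)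
  refine ⟨fun z => if h : z ∈ D then V ⟨z, h⟩ else 0, fun z hz => ?_⟩
  obtain ⟨r, hr, hball⟩ := Metric.isOpen_iff.1 hD z hz
  obtain ⟨Φ, hΦ⟩ := exists_primitive_ball hf hball
  have key : ∀ w ∈ Metric.ball z r,
      (if h : w ∈ D then V ⟨w, h⟩ else 0) = V ⟨z, hz⟩ + (Φ w - Φ z) := by
    intro w hw
    have hwD := hball hw
    rw [dif_pos hwD]
    have hseg : ∀ t : unitInterval, z + (t : ℝ) • (w - z) ∈ D := fun t =>
      hball ((convex_ball z r).add_smul_sub_mem (Metric.mem_ball_self hr) hw t.2)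
    let σ : Path (⟨z, hz⟩ : D) ⟨w, hwD⟩ :=
      { toFun := fun t => ⟨z + (t : ℝ) • (w - z), hseg t⟩
        continuous_toFun := by fun_prop
        source' := by simp
        target' := by simp }
    obtain ⟨c, h1, h2⟩ := exists_dyadicSum_path_eq hD hf (P ⟨w, hwD⟩) ((P ⟨z, hz⟩).trans σ)
    -- The shift by one matches the level `n + 1` on a concatenated path to the level `n` on its two
    -- pieces.
    have h2' := (tendsto_add_atTop_nat 1).eventually h2
    obtain ⟨n, a1, a2, a3, a4⟩ := (h1.and (h2'.and ((hV ⟨z, hz⟩).and (hV ⟨w, hwD⟩)))).exists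
    rw [dyadicSum_trans, a3, dyadicSum_segment hf hball hw (γ := pathCurve σ)
      (fun t ht => by
        unfold pathCurve
        rw [Path.extend_apply _ ht]; rfl)] at a2
    rw [segmentIntegral_eq_sub (convex_ball z r) (hf.continuousOn.mono hball) hΦ
      (Metric.mem_ball_self hr) hw] at a2
    rw [← a4, a1, ← a2]
  have hzb := Metric.mem_ball_self (x := z) hr
  refine HasDerivAt.congr_of_eventuallyEq (f := fun w => V ⟨z, hz⟩ + (Φ w - Φ z))
    (((hΦ z hzb).sub_const _).const_add _) ?_
  filter_upwards [Metric.ball_mem_nhds z hr] with w hw using key w hw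

end BlockRiccati

namespace BlockRiccati

/-! ## Crosscuts of a deformation -/

/-- The values of `φ` are integer multiples of 2πi. Two different ones would, by the intermediate
value theorem for the imaginary part on a preconnected set, produce a value halfway between
neighbouring multiples. -/
theorem eq_of_exp_eq_one {X : Type*} [TopologicalSpace X] {S : Set X} (hS : IsPreconnected S)
    {φ : X → ℂ} (hφ : ContinuousOn φ S) (h1 : ∀ x ∈ S, Complex.exp (φ x) = 1) {x y : X}
    (hx : x ∈ S) (hy : y ∈ S) : φ x = φ y := by
  have hint : ∀ x ∈ S, ∃ n : ℤ, φ x = n * (2 * Real.pi * Complex.I) := fun x hx =>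
    Complex.exp_eq_one_iff.1 (h1 x hx)
  have key : ∀ x ∈ S, ∀ y ∈ S, (φ x).im ≤ (φ y).im → φ x = φ y := by
    intro x hx y hy hle
    obtain ⟨m, hm⟩ := hint x hx
    obtain ⟨n, hn⟩ := hint y hy
    have im_of : ∀ {z : ℂ} {k : ℤ}, z = k * (2 * Real.pi * Complex.I) →
        z.im = k * (2 * Real.pi) := by
      rintro _ k rfl
      simp
    rcases eq_or_ne m n with rfl | hmn
    · rw [hm, hn]
    exfalso
    have hpi := Real.pi_pos
    have h2pi : (0 : ℝ) < 2 * Real.pi := by positivity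
    have hle' : (m : ℝ) ≤ n := by
      rw [im_of hm, im_of hn] at hle
      exact le_of_mul_le_mul_right hle h2pi
    have hlt : m + 1 ≤ n := lt_of_le_of_ne (by exact_mod_cast hle') hmn
    have hlt' : (m : ℝ) + 1 ≤ n := by exact_mod_cast hlt
    have hmem : ((m : ℝ) + 1 / 2) * (2 * Real.pi) ∈ Icc (φ x).im (φ y).im := by
      rw [im_of hm, im_of hn]
      constructor <;> apply mul_le_mul_of_nonneg_right _ h2pi.le <;> linarith
    obtain ⟨z, hz, hzv⟩ := hS.intermediate_value hx hy
      (f := fun x => (φ x).im) (Complex.continuous_im.comp_continuousOn hφ) hmem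
    obtain ⟨k, hk⟩ := hint z hz
    have hzv' : (φ z).im = ((m : ℝ) + 1 / 2) * (2 * Real.pi) := hzv
    rw [im_of hk] at hzv'
    have hk2 : (k : ℝ) = m + 1 / 2 := mul_right_cancel₀ h2pi.ne' hzv'
    have hk3 : (2 * k : ℝ) = 2 * m + 1 := by linarith
    have hk4 : 2 * k = 2 * m + 1 := by exact_mod_cast hk3
    omega
  rcases le_total (φ x).im (φ y).im with h | h
  · exact key x hx y hy h
  · exact (key y hy x hx h).symm

theorem log_neg_of_im_pos {z : ℂ} (hz : 0 < z.im) :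
    Complex.log (-z) = Complex.log z - Real.pi * Complex.I := by
  simp only [Complex.log, norm_neg, Complex.arg_neg_eq_arg_sub_pi_of_im_pos hz]
  push_cast; ring

theorem log_neg_of_im_neg {z : ℂ} (hz : z.im < 0) :
    Complex.log (-z) = Complex.log z + Real.pi * Complex.I := by
  simp only [Complex.log, norm_neg, Complex.arg_neg_eq_arg_add_pi_of_im_neg hz]
  push_cast; ring

/-- A continuous nonvanishing function on a rectangle cannot cross the negative half-axis on the
boundary of the rectangle exactly once. -/
theorem no_single_crossing {a b e : ℝ} (hab : e ∈ Ioo a b) {G : ℝ → ℝ → ℂ}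
    (hG : ContinuousOn (fun p : ℝ × ℝ => G p.1 p.2) (Icc 0 1 ×ˢ Icc a b))
    (hne : ∀ s ∈ Icc (0 : ℝ) 1, ∀ t ∈ Icc a b, G s t ≠ 0)
    (ha : ∀ s ∈ Icc (0 : ℝ) 1, G s a ∈ Complex.slitPlane)
    (hb : ∀ s ∈ Icc (0 : ℝ) 1, G s b ∈ Complex.slitPlane)
    (h1 : ∀ t ∈ Icc a b, G 1 t ∈ Complex.slitPlane)
    (h0 : ∀ t ∈ Icc a b, t ≠ e → G 0 t ∈ Complex.slitPlane)
    (he : (G 0 e).re < 0)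
    (hl : ∀ᶠ t in 𝓝[<] e, 0 < (G 0 t).im) (hr : ∀ᶠ t in 𝓝[>] e, (G 0 t).im < 0) : False := by
  have hab' : a ≤ b := (hab.1.trans hab.2).le
  have z01 : (0 : ℝ) ≤ 1 := zero_le_one
  have m0 : (0 : ℝ) ∈ Icc (0 : ℝ) 1 := by simp
  have m1 : (1 : ℝ) ∈ Icc (0 : ℝ) 1 := by simp
  have ma : a ∈ Icc a b := ⟨le_rfl, hab'⟩
  have mb : b ∈ Icc a b := ⟨hab', le_rfl⟩
  -- a continuous logarithm of `G`
  obtain ⟨Λ, hΛ, hexp⟩ : ∃ Λ : ℝ × ℝ → ℂ, Continuous Λ ∧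
      ∀ s ∈ Icc (0 : ℝ) 1, ∀ t ∈ Icc a b, Complex.exp (Λ (s, t)) = G s t := by
    let P : ℝ × ℝ → ℝ × ℝ := fun p => ((projIcc 0 1 z01 p.1 : ℝ), (projIcc a b hab' p.2 : ℝ))
    have hP : Continuous P := by
      have e1 := continuous_projIcc (h := z01)
      have e2 := continuous_projIcc (h := hab')
      exact (continuous_subtype_val.comp (e1.comp continuous_fst)).prodMk
        (continuous_subtype_val.comp (e2.comp continuous_snd))
    have hPm : ∀ p, P p ∈ Icc (0 : ℝ) 1 ×ˢ Icc a b := fun p =>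
      ⟨Subtype.coe_prop _, Subtype.coe_prop _⟩
    have hGP : Continuous fun p => G (P p).1 (P p).2 := hG.comp_continuous hP hPm
    have huniv : IsSimplyConnected (univ : Set (ℝ × ℝ)) := by
      have : ContractibleSpace (univ : Set (ℝ × ℝ)) :=
        (Homeomorph.Set.univ (ℝ × ℝ)).contractibleSpace
      exact SimplyConnectedSpace.ofContractible _
    obtain ⟨Λ, hc, hE⟩ := Complex.exists_continuousOn_eqOn_exp_comp huniv isOpen_univ
      hGP.continuousOn (by rintro ⟨p, -, hp⟩; exact hne _ (hPm p).1 _ (hPm p).2 hp)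
    refine ⟨Λ, continuousOn_univ.1 hc, fun s hs t ht => ?_⟩
    have := hE (mem_univ (s, t))
    simpa [P, projIcc_of_mem _ hs, projIcc_of_mem _ ht] using this
  -- `N` compares the global logarithm with the principal one; it takes values in 2πiℤ and is
  -- constant on connected sets where `G` stays in the slit plane.
  set N : ℝ × ℝ → ℂ := fun p => Λ p - Complex.log (G p.1 p.2) with hN
  have hNc : ∀ S : Set (ℝ × ℝ), S ⊆ Icc 0 1 ×ˢ Icc a b →
      (∀ p ∈ S, G p.1 p.2 ∈ Complex.slitPlane) → ContinuousOn N S := fun S hS hs =>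
    hΛ.continuousOn.sub ((hG.mono hS).clog hs)
  have hNe : ∀ s ∈ Icc (0 : ℝ) 1, ∀ t ∈ Icc a b, Complex.exp (N (s, t)) = 1 := by
    intro s hs t ht
    simp only [hN]
    rw [Complex.exp_sub, hexp s hs t ht, Complex.exp_log (hne s hs t ht), div_self (hne s hs t ht)]
  have const : ∀ S : Set (ℝ × ℝ), IsPreconnected S → S ⊆ Icc 0 1 ×ˢ Icc a b →
      (∀ p ∈ S, G p.1 p.2 ∈ Complex.slitPlane) → ∀ p ∈ S, ∀ p' ∈ S, N p = N p' :=
    fun S hS hSs hs p hp p' hp' => eq_of_exp_eq_one hS (hNc S hSs hs)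
      (fun x hx => hNe _ (hSs hx).1 _ (hSs hx).2) hp hp'
  have hor : ∀ s c d : ℝ, IsPreconnected (({s} : Set ℝ) ×ˢ Icc c d) := fun s c d =>
    isPreconnected_singleton.prod isPreconnected_Icc
  -- The three sides `t = a`, `t = b` and `s = 1` meet no cut, so `N` agrees at the two ends of the
  -- remaining side `s = 0`.
  have e1 : N (0, a) = N (1, a) := const (Icc 0 1 ×ˢ {a})
    (isPreconnected_Icc.prod isPreconnected_singleton)
    (prod_mono le_rfl (by simpa using hab'))
    (by rintro ⟨s, t⟩ ⟨hs, ht⟩; obtain rfl : t = a := ht; exact ha s hs)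
    _ ⟨m0, rfl⟩ _ ⟨m1, rfl⟩
  have e2 : N (0, b) = N (1, b) := const (Icc 0 1 ×ˢ {b})
    (isPreconnected_Icc.prod isPreconnected_singleton)
    (prod_mono le_rfl (by simpa using hab'))
    (by rintro ⟨s, t⟩ ⟨hs, ht⟩; obtain rfl : t = b := ht; exact hb s hs)
    _ ⟨m0, rfl⟩ _ ⟨m1, rfl⟩
  have e3 : N (1, a) = N (1, b) := const ({1} ×ˢ Icc a b) (hor _ _ _)
    (prod_mono (by simp) le_rfl)
    (by rintro ⟨s, t⟩ ⟨hs, ht⟩; obtain rfl : s = 1 := hs; exact h1 t ht)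
    (1, a) ⟨mem_singleton _, ma⟩ (1, b) ⟨mem_singleton _, mb⟩
  have hG0 : ContinuousOn (fun t => G 0 t) (Icc a b) :=
    hG.comp (f := fun t : ℝ => ((0 : ℝ), t)) (by fun_prop) (fun t ht => ⟨m0, ht⟩)
  have hee : e ∈ Icc a b := Ioo_subset_Icc_self hab
  have hre : ∀ᶠ t in 𝓝 e, (G 0 t).re < 0 := by
    have : ContinuousAt (fun t => (G 0 t).re) e :=
      Complex.continuous_re.continuousAt.comp (hG0.continuousAt (Icc_mem_nhds hab.1 hab.2))
    exact this.eventually (gt_mem_nhds he)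
  obtain ⟨ρ, hρ, H⟩ : ∃ ρ > 0, ∀ t, |t - e| ≤ ρ → t ∈ Icc a b ∧ (G 0 t).re < 0 ∧
      (t < e → 0 < (G 0 t).im) ∧ (e < t → (G 0 t).im < 0) := by
    have hall : ∀ᶠ t in 𝓝 e, t ∈ Icc a b ∧ (G 0 t).re < 0 ∧
      (t < e → 0 < (G 0 t).im) ∧ (e < t → (G 0 t).im < 0) := by
      filter_upwards [Icc_mem_nhds hab.1 hab.2, hre, eventually_nhdsWithin_iff.1 hl,
        eventually_nhdsWithin_iff.1 hr] with t a1 a2 a3 a4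
      exact ⟨a1, a2, a3, a4⟩
    obtain ⟨ρ, hρ, hs⟩ := (Metric.nhds_basis_closedBall.eventually_iff).1 hall
    exact ⟨ρ, hρ, fun t ht => hs (by simpa [Real.dist_eq] using ht)⟩
  have Hm : ∀ t ∈ Icc (e - ρ) (e + ρ), t ∈ Icc a b ∧ (G 0 t).re < 0 := fun t ht =>
    have h' := H t (by rw [abs_le]; constructor <;> linarith [ht.1, ht.2])
    ⟨h'.1, h'.2.1⟩
  obtain ⟨n1, -, n2, -⟩ := H (e - ρ) (by simp [abs_of_pos hρ])
  obtain ⟨p1, -, -, p2⟩ := H (e + ρ) (by simp [abs_of_pos hρ])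
  replace n2 := n2 (by linarith)
  replace p2 := p2 (by linarith)
  have e4 : N (0, a) = N (0, e - ρ) := const ({0} ×ˢ Icc a (e - ρ)) (hor _ _ _)
    (prod_mono (by simp) (Icc_subset_Icc le_rfl n1.2))
    (by
      rintro ⟨s, t⟩ ⟨hs, ht⟩; obtain rfl : s = 0 := hs
      exact h0 t ⟨ht.1, ht.2.trans n1.2⟩ (by rintro rfl; linarith [ht.2]))
    (0, a) ⟨mem_singleton _, le_rfl, n1.1⟩ (0, e - ρ) ⟨mem_singleton _, n1.1, le_rfl⟩
  have e5 : N (0, e + ρ) = N (0, b) := const ({0} ×ˢ Icc (e + ρ) b) (hor _ _ _)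
    (prod_mono (by simp) (Icc_subset_Icc p1.1 le_rfl))
    (by
      rintro ⟨s, t⟩ ⟨hs, ht⟩; obtain rfl : s = 0 := hs
      exact h0 t ⟨p1.1.trans ht.1, ht.2⟩ (by rintro rfl; linarith [ht.1]))
    (0, e + ρ) ⟨mem_singleton _, le_rfl, p1.2⟩ (0, b) ⟨mem_singleton _, p1.2, le_rfl⟩
  -- Near the crossing `G` has negative real part, so there log(-G) + πi is a continuous branch of
  -- the logarithm, and its difference to `Λ` is constant across `e`. Rewritten with the principal
  -- logarithm, which jumps at the cut, this forces `N` to change by 2πi from one side of `e` to the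
  -- other, against `e7`.
  have e6 : Λ (0, e - ρ) - Complex.log (-G 0 (e - ρ)) - Real.pi * Complex.I
      = Λ (0, e + ρ) - Complex.log (-G 0 (e + ρ)) - Real.pi * Complex.I := by
    refine eq_of_exp_eq_one (S := Icc (e - ρ) (e + ρ)) isPreconnected_Icc
      (φ := fun t => Λ (0, t) - Complex.log (-G 0 t) - Real.pi * Complex.I) ?_ ?_
      ⟨le_rfl, by linarith⟩ ⟨by linarith, le_rfl⟩
    · refine ContinuousOn.sub (ContinuousOn.sub (by fun_prop) (ContinuousOn.clog ?_ ?_))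
        continuousOn_const
      · exact (hG0.mono fun t ht => (Hm t ht).1).neg
      · intro t ht
        left
        simpa using (Hm t ht).2
    · intro t ht
      have hz := hne 0 m0 t (Hm t ht).1
      rw [Complex.exp_sub, Complex.exp_sub, hexp 0 m0 t (Hm t ht).1,
        Complex.exp_log (neg_ne_zero.2 hz), Complex.exp_pi_mul_I]
      field_simp
  rw [log_neg_of_im_pos n2, log_neg_of_im_neg p2] at e6
  have e7 : N (0, e - ρ) = N (0, e + ρ) := by rw [← e4, e5, e1, e2, e3]
  simp only [hN] at e7
  have : (2 * Real.pi * Complex.I : ℂ) = 0 := by linear_combination e6 - e7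
  simp [Real.pi_ne_zero] at this

/-- The arc of the lower half of the circle with the centre `q` that joins the real point `q + σ r`
of the circle to its point `w`. -/
def lowerArc (q σ : ℝ) (w : ℂ) : Set ℂ :=
  {z | ‖z - q‖ = ‖w - q‖ ∧ z.im ≤ 0 ∧ σ * (w.re - q) ≤ σ * (z.re - q)}

theorem norm_sub_ofReal_sq (z : ℂ) (q : ℝ) : ‖z - q‖ ^ 2 = (z.re - q) ^ 2 + z.im ^ 2 := by
  rw [← Complex.normSq_eq_norm_sq, Complex.normSq_apply]
  simp; ring

/-- The sign of the cross product compares the angles of `z` and `w` seen from `q` and measured from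
the direction `σ`; on a lower half-circle a smaller angle means a larger value of `σ * (re - q)`. -/
theorem mem_lowerArc_of_cross {q σ : ℝ} (hσ : σ = 1 ∨ σ = -1) {w z : ℂ} (hw : w.im < 0)
    (hz : z.im ≤ 0) (hn : ‖z - q‖ = ‖w - q‖)
    (hc : 0 ≤ σ * ((z.re - q) * -w.im + z.im * (w.re - q))) : z ∈ lowerArc q σ w := by
  refine ⟨hn, hz, ?_⟩
  have h2 : (z.re - q) ^ 2 + z.im ^ 2 = (w.re - q) ^ 2 + w.im ^ 2 := by
    rw [← norm_sub_ofReal_sq, ← norm_sub_ofReal_sq, hn]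
  obtain ⟨x, hx⟩ : ∃ x, x = σ * (z.re - q) := ⟨_, rfl⟩
  obtain ⟨x0, hx0⟩ : ∃ x0, x0 = σ * (w.re - q) := ⟨_, rfl⟩
  have hs : σ ^ 2 = 1 := by rcases hσ with rfl | rfl <;> norm_num
  have h3 : x ^ 2 + z.im ^ 2 = x0 ^ 2 + w.im ^ 2 := by
    rw [hx, hx0, mul_pow, mul_pow, hs, one_mul, one_mul, h2]
  have h4 : 0 ≤ x * (-w.im) - (-z.im) * x0 := by
    rw [hx, hx0]; linarith
  rw [← hx, ← hx0]
  set y := -z.im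
  set y0 := -w.im
  have hy : 0 ≤ y := by simp only [y]; linarith
  have hy0 : 0 < y0 := by simp only [y0]; linarith
  have h5 : x ^ 2 + y ^ 2 = x0 ^ 2 + y0 ^ 2 := by simp only [y, y0, neg_sq]; exact h3
  by_contra! hlt
  rcases le_or_gt x0 0 with h0 | h0
  · have : y < y0 := by
      apply lt_of_pow_lt_pow_left₀ 2 hy0.le; nlinarith
    nlinarith
  · have hx' : 0 ≤ x := by
      by_contra! hneg; nlinarith [mul_pos_of_neg_of_neg hneg (neg_neg_of_pos hy0), mul_nonneg hy h0.le]
    have : y0 < y := by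
      apply lt_of_pow_lt_pow_left₀ 2 hy; nlinarith
    nlinarith

/-- If a deformation `h` of a real interval into the lower half-plane avoids the arc from a real
point `e` to `w` except for its bottom side, then it sweeps over `w`. -/
theorem mem_of_lowerArc_disjoint {D : Set ℂ} (hDl : ∀ z ∈ D, z.im < 0) {a b : ℝ}
    {h : ℝ → ℝ → ℂ}
    (hc : ContinuousOn (fun p : ℝ × ℝ => h p.1 p.2) (Icc 0 1 ×ˢ Icc a b))
    (h0 : ∀ t ∈ Icc a b, h 0 t = (t : ℂ))
    (hD : ∀ s ∈ Ioc (0 : ℝ) 1, ∀ t ∈ Icc a b, h s t ∈ D)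
    {q σ : ℝ} (hσ : σ = 1 ∨ σ = -1) {w : ℂ} (hw : w.im < 0)
    (he : q + σ * ‖w - q‖ ∈ Ioo a b)
    (hsa : ∀ s ∈ Icc (0 : ℝ) 1, h s a ∉ lowerArc q σ w)
    (hsb : ∀ s ∈ Icc (0 : ℝ) 1, h s b ∉ lowerArc q σ w)
    (h1 : ∀ t ∈ Icc a b, h 1 t ∉ lowerArc q σ w) : w ∈ D := by
  by_contra hwD
  obtain ⟨r, hr⟩ : ∃ r, r = ‖w - q‖ := ⟨_, rfl⟩
  rw [← hr] at he
  have hs2 : σ ^ 2 = 1 := by rcases hσ with rfl | rfl <;> norm_num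
  have hs0 : σ ≠ 0 := by rcases hσ with rfl | rfl <;> norm_num
  have hr2 : r ^ 2 = (w.re - q) ^ 2 + w.im ^ 2 := by rw [hr, norm_sub_ofReal_sq]
  have hrpos : 0 < r := by
    rw [hr, norm_pos_iff]; intro h0
    have := congrArg Complex.im h0; simp at this; linarith
  -- A Möbius map with its zero at `w` and its pole at the antipodal point `2q - w` of the circle,
  -- which lies in the upper half-plane. It maps the circle to the real axis, and the part of the
  -- circle in the closed lower half-plane that is mapped to the nonpositive half-axis is contained
  -- in the arc from `q + σ r` to `w`.
  set M : ℂ → ℂ := fun z => Complex.I * σ * (z - w) / (z - (2 * q - w)) with hM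
  have hnormSq : ∀ z : ℂ, z.im ≤ 0 → 0 < Complex.normSq (z - (2 * q - w)) := by
    intro z hz
    rw [Complex.normSq_pos]
    intro h0
    have := congrArg Complex.im h0
    simp at this
    linarith
  have hMre : ∀ z : ℂ, (M z).re =
      -2 * (σ * ((z.re - q) * -w.im + z.im * (w.re - q))) / Complex.normSq (z - (2 * q - w)) := by
    intro z
    simp only [hM, Complex.div_re]
    rw [← add_div]
    congr 1
    simp
    ring
  have hMim : ∀ z : ℂ, (M z).im =
      σ * ((z.re - q) ^ 2 + z.im ^ 2 - r ^ 2) / Complex.normSq (z - (2 * q - w)) := by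
    intro z
    simp only [hM, Complex.div_im]
    rw [← sub_div]
    congr 1
    rw [hr2]
    simp
    ring
  have hMslit : ∀ z : ℂ, z.im ≤ 0 → z ∉ lowerArc q σ w → M z ∈ Complex.slitPlane := by
    intro z hz hzA
    by_contra hcon
    rw [Complex.mem_slitPlane_iff, not_or, not_lt, not_not, hMre, hMim] at hcon
    obtain ⟨c1, c2⟩ := hcon
    have hp := hnormSq z hz
    rw [div_eq_zero_iff, or_iff_left hp.ne', mul_eq_zero, or_iff_right hs0] at c2
    rw [div_le_iff₀ hp, zero_mul] at c1
    refine hzA (mem_lowerArc_of_cross hσ hw hz ?_ (by linarith))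
    rw [← hr, ← sq_eq_sq₀ (norm_nonneg _) hrpos.le, norm_sub_ofReal_sq]
    linarith
  have him : ∀ s ∈ Icc (0 : ℝ) 1, ∀ t ∈ Icc a b, (h s t).im ≤ 0 := by
    intro s hs t ht
    rcases hs.1.eq_or_lt with rfl | hpos
    · rw [h0 t ht]; simp
    · exact (hDl _ (hD s ⟨hpos, hs.2⟩ t ht)).le
  have hnew : ∀ s ∈ Icc (0 : ℝ) 1, ∀ t ∈ Icc a b, h s t ≠ w := by
    intro s hs t ht heq
    rcases hs.1.eq_or_lt with rfl | hpos
    · rw [h0 t ht] at heq; rw [← heq] at hw; simp at hw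
    · exact hwD (heq ▸ hD s ⟨hpos, hs.2⟩ t ht)
  have hden : ∀ z : ℂ, z.im ≤ 0 → z - (2 * q - w) ≠ 0 := fun z hz =>
    Complex.normSq_pos.1 (hnormSq z hz)
  have hab : a ≤ b := (he.1.trans he.2).le
  have m0 : (0 : ℝ) ∈ Icc (0 : ℝ) 1 := by simp
  have m1 : (1 : ℝ) ∈ Icc (0 : ℝ) 1 := by simp
  have hGc : ContinuousOn (fun p : ℝ × ℝ => M (h p.1 p.2)) (Icc 0 1 ×ˢ Icc a b) := by
    simp only [hM]
    refine ContinuousOn.div (by fun_prop) (by fun_prop) fun p hp => hden _ (him _ hp.1 _ hp.2)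
  have hGne : ∀ s ∈ Icc (0 : ℝ) 1, ∀ t ∈ Icc a b, M (h s t) ≠ 0 := by
    intro s hs t ht
    simp only [hM]
    refine div_ne_zero (mul_ne_zero (mul_ne_zero Complex.I_ne_zero (by exact_mod_cast hs0)) ?_)
      (hden _ (him s hs t ht))
    exact sub_ne_zero.2 (hnew s hs t ht)
  -- The other real point `q - σ r` of the circle is excluded because `w` is not real, so `σ * (w.re
  -- - q)` exceeds `-r`.
  have hreal : ∀ t : ℝ, t ≠ q + σ * r → (t : ℂ) ∉ lowerArc q σ w := by
    rintro t hte ⟨k1, -, k3⟩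
    rw [← hr, ← sq_eq_sq₀ (norm_nonneg _) hrpos.le, norm_sub_ofReal_sq] at k1
    simp only [Complex.ofReal_re, Complex.ofReal_im] at k1 k3
    have k4 : (t - q - σ * r) * (t - q + σ * r) = 0 := by
      have : σ ^ 2 * r ^ 2 = r ^ 2 := by rw [hs2, one_mul]
      linear_combination k1 - this
    rcases mul_eq_zero.1 k4 with k | k
    · exact hte (by linarith)
    · have k5 : σ * (t - q) = -r := by
        have : t - q = -(σ * r) := by linarith
        rw [this]; linear_combination (-r) * hs2
      have k6 : (σ * (w.re - q)) ^ 2 < r ^ 2 := by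
        rw [mul_pow, hs2, hr2]; nlinarith
      have := abs_lt_of_sq_lt_sq' k6 hrpos.le
      linarith [this.1]
  have hG0 : ∀ t ∈ Icc a b, M (h 0 t) = M t := fun t ht => by rw [h0 t ht]
  have hnb : ∀ᶠ t in 𝓝 (q + σ * r), t ∈ Icc a b := Icc_mem_nhds he.1 he.2
  have hpos : ∀ᶠ t in 𝓝 (q + σ * r), 0 < σ * (t - q) + r := by
    have : ContinuousAt (fun t => σ * (t - q) + r) (q + σ * r) := by fun_prop
    refine this.eventually (lt_mem_nhds ?_)
    have : σ * (q + σ * r - q) + r = 2 * r := by linear_combination r * hs2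
    change 0 < σ * (q + σ * r - q) + r
    rw [this]; positivity
  have hfac : ∀ t : ℝ, (M t).im =
      (t - (q + σ * r)) * (σ * (t - q) + r) / Complex.normSq ((t : ℂ) - (2 * q - w)) := by
    intro t
    rw [hMim]
    congr 1
    simp only [Complex.ofReal_re, Complex.ofReal_im]
    linear_combination (r * (t - q)) * hs2
  have hNpos : ∀ t : ℝ, 0 < Complex.normSq ((t : ℂ) - (2 * q - w)) := fun t => hnormSq t (by simp)
  -- On the real line the imaginary part of `M` passes from negative to positive at `q + σ r`;
  -- conjugation gives the orientation that the crossing lemma expects.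
  refine no_single_crossing he (G := fun s t => (starRingEnd ℂ) (M (h s t)))
    (Complex.continuous_conj.comp_continuousOn hGc)
    (fun s hs t ht => by simpa using hGne s hs t ht) ?_ ?_ ?_ ?_ ?_ ?_ ?_
  · intro s hs
    have := hMslit _ (him s hs a ⟨le_rfl, hab⟩) (hsa s hs)
    rw [Complex.mem_slitPlane_iff] at this ⊢
    simpa using this
  · intro s hs
    have := hMslit _ (him s hs b ⟨hab, le_rfl⟩) (hsb s hs)
    rw [Complex.mem_slitPlane_iff] at this ⊢
    simpa using this
  · intro t ht
    have := hMslit _ (him 1 m1 t ht) (h1 t ht)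
    rw [Complex.mem_slitPlane_iff] at this ⊢
    simpa using this
  · intro t ht hte
    have := hMslit _ (him 0 m0 t ht) (by rw [h0 t ht]; exact hreal t hte)
    rw [Complex.mem_slitPlane_iff] at this ⊢
    simpa using this
  · rw [Complex.conj_re, hG0 _ (Ioo_subset_Icc_self he), hMre]
    refine div_neg_of_neg_of_pos ?_ (hNpos _)
    simp only [Complex.ofReal_re, Complex.ofReal_im]
    have : σ * ((q + σ * r - q) * -w.im + 0 * (w.re - q)) = r * -w.im := by
      linear_combination (-r * w.im) * hs2
    rw [this]
    nlinarith
  · rw [eventually_nhdsWithin_iff]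
    filter_upwards [hnb, hpos] with t ht htp hlt
    rw [Complex.conj_im, hG0 t ht, hfac, neg_pos]
    exact div_neg_of_neg_of_pos (mul_neg_of_neg_of_pos (sub_neg.2 hlt) htp) (hNpos t)
  · rw [eventually_nhdsWithin_iff]
    filter_upwards [hnb, hpos] with t ht htp hlt
    rw [Complex.conj_im, hG0 t ht, hfac, neg_lt_zero]
    exact div_pos (mul_pos (sub_pos.2 hlt) htp) (hNpos t)

end BlockRiccati

namespace BlockRiccati

/-! ## Open intervals with end points in the extended reals -/

theorem openInterval_eq (μ₁ μ₂ : EReal) :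
    openInterval μ₁ μ₂ = Real.toEReal ⁻¹' Ioo μ₁ μ₂ := rfl

theorem isOpen_openInterval (μ₁ μ₂ : EReal) : IsOpen (openInterval μ₁ μ₂) :=
  isOpen_Ioo.preimage continuous_coe_real_ereal

theorem measurableSet_openInterval (μ₁ μ₂ : EReal) : MeasurableSet (openInterval μ₁ μ₂) :=
  (isOpen_openInterval μ₁ μ₂).measurableSet

theorem Icc_subset_openInterval {μ₁ μ₂ : EReal} {a b : ℝ} (ha : a ∈ openInterval μ₁ μ₂)
    (hb : b ∈ openInterval μ₁ μ₂) : Icc a b ⊆ openInterval μ₁ μ₂ := fun _ ht =>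
  ⟨ha.1.trans_le (EReal.coe_le_coe_iff.2 ht.1), (EReal.coe_le_coe_iff.2 ht.2).trans_lt hb.2⟩

theorem exists_lt_mem_openInterval {μ₁ μ₂ : EReal} {t : ℝ} (ht : t ∈ openInterval μ₁ μ₂) :
    ∃ a ∈ openInterval μ₁ μ₂, a < t := by
  obtain ⟨a, h1, h2⟩ := EReal.lt_iff_exists_real_btwn.1 ht.1
  exact ⟨a, ⟨h1, h2.trans ht.2⟩, EReal.coe_lt_coe_iff.1 h2⟩

theorem exists_gt_mem_openInterval {μ₁ μ₂ : EReal} {t : ℝ} (ht : t ∈ openInterval μ₁ μ₂) :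
    ∃ b ∈ openInterval μ₁ μ₂, t < b := by
  obtain ⟨a, h1, h2⟩ := EReal.lt_iff_exists_real_btwn.1 ht.2
  exact ⟨a, ⟨ht.1.trans h1, h2⟩, EReal.coe_lt_coe_iff.1 h1⟩

theorem openInterval_nonempty {μ₁ μ₂ : EReal} (hμ : μ₁ < μ₂) : (openInterval μ₁ μ₂).Nonempty := by
  obtain ⟨a, h1, h2⟩ := EReal.lt_iff_exists_real_btwn.1 hμ
  exact ⟨a, h1, h2⟩

/-- An open interval is exhausted by compact intervals. -/
theorem exists_exhaustion {μ₁ μ₂ : EReal} (hμ : μ₁ < μ₂) : ∃ a b : ℕ → ℝ, Antitone a ∧ Monotone b ∧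
    (∀ n, a n ∈ openInterval μ₁ μ₂) ∧ (∀ n, b n ∈ openInterval μ₁ μ₂) ∧ (∀ n, a n ≤ b n) ∧
    ∀ t ∈ openInterval μ₁ μ₂, ∃ n, a n < t ∧ t < b n := by
  obtain ⟨c, hc⟩ := openInterval_nonempty hμ
  obtain ⟨u, hu, hum, hut⟩ := exists_seq_strictAnti_tendsto' hc.1
  obtain ⟨v, hv, hvm, hvt⟩ := exists_seq_strictMono_tendsto' hc.2
  have hu' : ∀ n, ((u n).toReal : EReal) = u n := fun n =>
    EReal.coe_toReal ((hum n).2.trans (EReal.coe_lt_top c)).ne (((bot_le).trans_lt (hum n).1).ne')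
  have hv' : ∀ n, ((v n).toReal : EReal) = v n := fun n =>
    EReal.coe_toReal ((hvm n).2.trans_le le_top).ne (((EReal.bot_lt_coe c).trans (hvm n).1).ne')
  refine ⟨fun n => (u n).toReal, fun n => (v n).toReal, ?_, ?_, ?_, ?_, ?_, ?_⟩
  · intro m n hmn
    rw [← EReal.coe_le_coe_iff, hu', hu']; exact hu.antitone hmn
  · intro m n hmn
    rw [← EReal.coe_le_coe_iff, hv', hv']; exact hv.monotone hmn
  · intro n
    rw [openInterval_eq, mem_preimage, hu']; exact ⟨(hum n).1, (hum n).2.trans hc.2⟩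
  · intro n
    rw [openInterval_eq, mem_preimage, hv']; exact ⟨hc.1.trans (hvm n).1, (hvm n).2⟩
  · intro n
    rw [← EReal.coe_le_coe_iff, hu', hv']; exact ((hum n).2.trans (hvm n).1).le
  · intro t ht
    obtain ⟨n, h1, h2⟩ := ((hut.eventually (gt_mem_nhds ht.1)).and
      (hvt.eventually (lt_mem_nhds ht.2))).exists
    refine ⟨n, ?_, ?_⟩
    · rw [← EReal.coe_lt_coe_iff, hu']; exact h1
    · rw [← EReal.coe_lt_coe_iff, hv']; exact h2

/-- The integral over an open interval is the improper integral. -/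
theorem exists_tail_lt {μ₁ μ₂ : EReal} (hμ : μ₁ < μ₂) {G : Type*} [NormedAddCommGroup G]
    [NormedSpace ℝ G] {φ : ℝ → G}
    (hφ : IntegrableOn φ (openInterval μ₁ μ₂)) {ε : ℝ} (hε : 0 < ε) :
    ∃ a₀ ∈ openInterval μ₁ μ₂, ∃ b₀ ∈ openInterval μ₁ μ₂, a₀ ≤ b₀ ∧
      (∫ t in openInterval μ₁ μ₂ \ Icc a₀ b₀, ‖φ t‖ < ε) ∧
      ∀ a ∈ openInterval μ₁ μ₂, a ≤ a₀ → ∀ b ∈ openInterval μ₁ μ₂, b₀ ≤ b →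
        ‖(∫ t in openInterval μ₁ μ₂, φ t) - ∫ t in a..b, φ t‖ < ε := by
  obtain ⟨a, b, ha, hb, hma, hmb, hab, hex⟩ := exists_exhaustion hμ
  have hU : ⋃ n, Icc (a n) (b n) = openInterval μ₁ μ₂ := by
    refine subset_antisymm (iUnion_subset fun n => Icc_subset_openInterval (hma n) (hmb n)) ?_
    intro t ht
    obtain ⟨n, h1, h2⟩ := hex t ht
    exact mem_iUnion.2 ⟨n, h1.le, h2.le⟩
  have hφn : IntegrableOn (fun t => ‖φ t‖) (openInterval μ₁ μ₂) := hφ.norm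
  have hlim := tendsto_setIntegral_of_monotone (s := fun n => Icc (a n) (b n)) (μ := volume)
    (f := fun t => ‖φ t‖) (fun n => measurableSet_Icc)
    (fun m n hmn => Icc_subset_Icc (ha hmn) (hb hmn)) (by rw [hU]; exact hφn)
  rw [hU] at hlim
  obtain ⟨n, hn⟩ := (hlim.eventually (lt_mem_nhds (sub_lt_self _ hε))).exists
  have hsub : Icc (a n) (b n) ⊆ openInterval μ₁ μ₂ := Icc_subset_openInterval (hma n) (hmb n)
  have htail : ∫ t in openInterval μ₁ μ₂ \ Icc (a n) (b n), ‖φ t‖ < ε := by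
    rw [setIntegral_sdiff measurableSet_Icc hφn hsub]; linarith
  refine ⟨a n, hma n, b n, hmb n, hab n, htail, fun a' ha' haa b' hb' hbb => ?_⟩
  have hab' : a' ≤ b' := haa.trans ((hab n).trans hbb)
  have hsub' := Icc_subset_openInterval ha' hb'
  rw [intervalIntegral.integral_of_le hab', ← integral_Icc_eq_integral_Ioc,
    ← setIntegral_sdiff measurableSet_Icc hφ hsub']
  refine (norm_integral_le_integral_norm _).trans_lt (lt_of_le_of_lt ?_ htail)
  exact setIntegral_mono_set (hφn.mono_set sdiff_subset)
    (Eventually.of_forall fun _ => norm_nonneg _)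
    (sdiff_subset_sdiff_right (Icc_subset_Icc haa hbb)).eventuallyLE

/-! ## The geometry of a deformation -/

/-- The crosscut along a circle whose interior contains exactly one of the two sides of a
deformation: the arc from the real line to its first common point with the final curve lies
in the domain. -/
theorem exists_crosscut {D : Set ℂ} (hDl : ∀ z ∈ D, z.im < 0) {a b : ℝ}
    {h : ℝ → ℝ → ℂ}
    (hc : ContinuousOn (fun p : ℝ × ℝ => h p.1 p.2) (Icc 0 1 ×ˢ Icc a b))
    (h0 : ∀ t ∈ Icc a b, h 0 t = (t : ℂ))
    (hD : ∀ s ∈ Ioc (0 : ℝ) 1, ∀ t ∈ Icc a b, h s t ∈ D)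
    {q σ r : ℝ} (hσ : σ = 1 ∨ σ = -1) (he : q + σ * r ∈ Ioo a b) (hr : 0 < r)
    (hside : (∀ s ∈ Icc (0 : ℝ) 1, ‖h s a - q‖ < r ∧ r < ‖h s b - q‖) ∨
      (∀ s ∈ Icc (0 : ℝ) 1, r < ‖h s a - q‖ ∧ ‖h s b - q‖ < r)) :
    ∃ t ∈ Ioo a b, ‖h 1 t - q‖ = r ∧
      ∀ z ∈ lowerArc q σ (h 1 t), z ≠ ((q + σ * r : ℝ) : ℂ) → z ∈ D := by
  have hab : a ≤ b := (he.1.trans he.2).le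
  have m1 : (1 : ℝ) ∈ Icc (0 : ℝ) 1 := by simp
  have ma : a ∈ Icc a b := ⟨le_rfl, hab⟩
  have mb : b ∈ Icc a b := ⟨hab, le_rfl⟩
  have hs2 : σ ^ 2 = 1 := by rcases hσ with rfl | rfl <;> norm_num
  have hg : ContinuousOn (h 1) (Icc a b) :=
    hc.comp (f := fun t : ℝ => ((1 : ℝ), t)) (by fun_prop) (fun t ht => ⟨m1, ht⟩)
  have hgn : ContinuousOn (fun t => ‖h 1 t - q‖) (Icc a b) :=
    (hg.sub continuousOn_const).norm
  set T : Set ℝ := {t ∈ Icc a b | ‖h 1 t - q‖ = r} with hT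
  have hTne : T.Nonempty := by
    rcases hside with hs | hs
    · obtain ⟨t, ht, htr⟩ := intermediate_value_Icc hab hgn ⟨(hs 1 m1).1.le, (hs 1 m1).2.le⟩
      exact ⟨t, ht, htr⟩
    · obtain ⟨t, ht, htr⟩ := intermediate_value_Icc' hab hgn ⟨(hs 1 m1).2.le, (hs 1 m1).1.le⟩
      exact ⟨t, ht, htr⟩
  have hTc : IsCompact T := by
    have : T = Icc a b ∩ (fun t => ‖h 1 t - q‖) ⁻¹' {r} := by ext; simp [hT]
    rw [this]
    exact isCompact_Icc.of_isClosed_subset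
      (hgn.preimage_isClosed_of_isClosed isClosed_Icc isClosed_singleton) inter_subset_left
  -- Among the points of the final curve on the circle, the one with the largest `σ * (re - q)` is
  -- the first that is met along the lower arc from the real point.
  obtain ⟨t, htT, hmax⟩ := hTc.exists_isMaxOn hTne
    (f := fun t => σ * ((h 1 t).re - q))
    (((Complex.continuous_re.comp_continuousOn hg).mono (fun t ht => ht.1)).sub
      continuousOn_const |>.const_mul _ )
  have hsides : ∀ s ∈ Icc (0 : ℝ) 1, ‖h s a - q‖ ≠ r ∧ ‖h s b - q‖ ≠ r := by
    intro s hs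
    rcases hside with H | H
    · exact ⟨(H s hs).1.ne, (H s hs).2.ne'⟩
    · exact ⟨(H s hs).1.ne', (H s hs).2.ne⟩
  have htne : t ∈ Ioo a b := by
    refine ⟨lt_of_le_of_ne htT.1.1 ?_, lt_of_le_of_ne htT.1.2 ?_⟩
    · rintro rfl; exact (hsides 1 m1).1 htT.2
    · rintro rfl; exact (hsides 1 m1).2 htT.2
  refine ⟨t, htne, htT.2, ?_⟩
  rintro w ⟨hwn, hwi, hwr⟩ hwe
  rw [htT.2] at hwn
  have hgD : h 1 t ∈ D := hD 1 ⟨one_pos, le_rfl⟩ t htT.1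
  have hsq : ∀ z : ℂ, ‖z - q‖ = r → (z.re - q) ^ 2 + z.im ^ 2 = r ^ 2 := fun z hz => by
    rw [← hz, norm_sub_ofReal_sq]
  have him := hDl _ hgD
  have hgsq := hsq _ htT.2
  have hwsq := hsq _ hwn
  -- a point of the arc is determined by its real part
  rcases hwr.eq_or_lt with heq | hlt
  · have hre : w.re = (h 1 t).re := by
      have := congrArg (fun x => σ * x) heq
      simp only [← mul_assoc, ← sq, hs2, one_mul] at this
      linarith
    have him2 : w.im ^ 2 = (h 1 t).im ^ 2 := by rw [hre] at hwsq; linarith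
    have him' : w.im = (h 1 t).im := by
      rcases sq_eq_sq_iff_eq_or_eq_neg.1 him2 with h' | h'
      · exact h'
      · linarith
    rwa [Complex.ext hre him']
  · have hwi' : w.im < 0 := by
      refine lt_of_le_of_ne hwi fun h0' => hwe ?_
      rw [h0'] at hwsq
      have h4 : (w.re - q - σ * r) * (w.re - q + σ * r) = 0 := by
        linear_combination hwsq - r ^ 2 * hs2
      rcases mul_eq_zero.1 h4 with k | k
      · apply Complex.ext
        · rw [Complex.ofReal_re]; linarith
        · rw [h0', Complex.ofReal_im]
      · exfalso
        have k5 : σ * (w.re - q) = -r := by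
          have : w.re - q = -(σ * r) := by linarith
          rw [this]; linear_combination (-r) * hs2
        have k6 : (σ * ((h 1 t).re - q)) ^ 2 < r ^ 2 := by
          rw [mul_pow, hs2, ← hgsq]; nlinarith
        have := abs_lt_of_sq_lt_sq' k6 hr.le
        linarith [this.1]
    -- The tracks of `a` and `b` avoid the whole circle, and by maximality the final curve has no
    -- point on the arc that ends at `w`.
    refine mem_of_lowerArc_disjoint hDl hc h0 hD hσ hwi' (by rwa [hwn])
      (fun s hs hA => (hsides s hs).1 (hA.1.trans hwn))
      (fun s hs hA => (hsides s hs).2 (hA.1.trans hwn)) ?_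
    intro t' ht' hA
    have := hmax (show t' ∈ T from ⟨ht', hA.1.trans hwn⟩)
    have h5 : σ * ((h 1 t').re - q) ≤ σ * ((h 1 t).re - q) := this
    linarith [hA.2.2]

/-- Half-discs below the points of the deformed interval belong to the domain. -/
theorem exists_halfDisc {D : Set ℂ} (hDl : ∀ z ∈ D, z.im < 0) {a b : ℝ}
    {h : ℝ → ℝ → ℂ}
    (hc : ContinuousOn (fun p : ℝ × ℝ => h p.1 p.2) (Icc 0 1 ×ˢ Icc a b))
    (h0 : ∀ t ∈ Icc a b, h 0 t = (t : ℂ))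
    (hD : ∀ s ∈ Ioc (0 : ℝ) 1, ∀ t ∈ Icc a b, h s t ∈ D) {e : ℝ} (he : e ∈ Ioo a b) :
    ∃ ρ > 0, ∀ z : ℂ, ‖z - e‖ < ρ → z.im < 0 → z ∈ D := by
  have hab : a ≤ b := (he.1.trans he.2).le
  have ma : a ∈ Icc a b := ⟨le_rfl, hab⟩
  have mb : b ∈ Icc a b := ⟨hab, le_rfl⟩
  -- The three sides of the rectangle other than the bottom. Their image is compact and misses `e`,
  -- which the deformation attains only at the bottom point (0, e).
  set S : Set (ℝ × ℝ) := (Icc 0 1 ×ˢ {a} ∪ Icc 0 1 ×ˢ {b}) ∪ {1} ×ˢ Icc a b with hS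
  have hSc : IsCompact S := ((isCompact_Icc.prod isCompact_singleton).union
    (isCompact_Icc.prod isCompact_singleton)).union (isCompact_singleton.prod isCompact_Icc)
  have hSsub : S ⊆ Icc 0 1 ×ˢ Icc a b := by
    refine union_subset (union_subset ?_ ?_) ?_
    · exact prod_mono le_rfl (by simpa using hab)
    · exact prod_mono le_rfl (by simpa using hab)
    · exact prod_mono (by simp) le_rfl
  have hK := hSc.image_of_continuousOn (hc.mono hSsub)
  have heK : (e : ℂ) ∉ (fun p : ℝ × ℝ => h p.1 p.2) '' S := by
    rintro ⟨⟨s, t⟩, hp, hval⟩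
    simp only at hval
    have hp' := hSsub hp
    rcases hp'.1.1.eq_or_lt with hs0 | hs0
    · simp only at hs0
      subst hs0
      rw [h0 t hp'.2, Complex.ofReal_inj] at hval
      subst hval
      rcases hp with (hp | hp) | hp
      · exact he.1.ne' hp.2
      · exact he.2.ne hp.2
      · exact zero_ne_one hp.1
    · have := hDl _ (hD s ⟨hs0, hp'.1.2⟩ t hp'.2)
      rw [hval] at this
      simp at this
  obtain ⟨ρ₀, hρ₀, hball⟩ := Metric.isOpen_iff.1 hK.isClosed.isOpen_compl _ heK
  -- The arcs are taken on circles about `e - 1` of radius close to 1. The bound ρ₀/2 keeps the arc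
  -- within ρ₀ of `e`, 1/2 keeps `w` to the right of the centre, and the last two bounds keep the
  -- real end point of the arc inside (a, b).
  refine ⟨min (min (ρ₀ / 2) (1 / 2)) (min (e - a) (b - e)),
    lt_min (lt_min (by linarith) (by norm_num)) (lt_min (by linarith [he.1]) (by linarith [he.2])),
    fun w hw hwi => ?_⟩
  simp only [lt_min_iff] at hw
  obtain ⟨⟨w1, w2⟩, w3, w4⟩ := hw
  have hre := (Complex.abs_re_le_norm (w - e))
  have him := (Complex.abs_im_le_norm (w - e))
  simp only [Complex.sub_re, Complex.sub_im, Complex.ofReal_re, Complex.ofReal_im, sub_zero]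
    at hre him
  have hn1 : |‖w - ((e - 1 : ℝ) : ℂ)‖ - 1| ≤ ‖w - e‖ := by
    have h1 : ‖(e : ℂ) - ((e - 1 : ℝ) : ℂ)‖ = 1 := by
      push_cast; simp
    have := abs_norm_sub_norm_le (w - ((e - 1 : ℝ) : ℂ)) ((e : ℂ) - ((e - 1 : ℝ) : ℂ))
    rwa [h1, sub_sub_sub_cancel_right] at this
  have hn2 := abs_le.1 hn1
  have hre2 := abs_le.1 hre
  have arc : ∀ z ∈ lowerArc (e - 1) 1 w, z ∈ Metric.ball (e : ℂ) ρ₀ := by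
    rintro z ⟨z1, z2, z3⟩
    have a1 := norm_sub_ofReal_sq z (e - 1)
    have a2 := norm_sub_ofReal_sq w (e - 1)
    rw [z1] at a1
    have a3 : z.re - (e - 1) ≤ ‖w - ((e - 1 : ℝ) : ℂ)‖ := by
      rw [← z1]
      have := (le_abs_self _).trans (Complex.abs_re_le_norm (z - ((e - 1 : ℝ) : ℂ)))
      simpa using this
    have a4 : w.re - (e - 1) ≤ z.re - (e - 1) := by linarith
    have a5 : z.im ^ 2 ≤ w.im ^ 2 := by nlinarith
    have a6 : |z.im| ≤ |w.im| := sq_le_sq.1 a5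
    have a7 : |z.re - e| ≤ ‖w - e‖ := by
      rw [abs_le]; constructor <;> linarith
    rw [Metric.mem_ball, Complex.dist_eq]
    calc ‖z - e‖ ≤ |(z - e).re| + |(z - e).im| := Complex.norm_le_abs_re_add_abs_im _
      _ = |z.re - e| + |z.im| := by simp
      _ < ρ₀ := by linarith
  have harc : ∀ p ∈ S, h p.1 p.2 ∉ lowerArc (e - 1) 1 w := fun p hp hA =>
    hball (arc _ hA) ⟨p, hp, rfl⟩
  refine mem_of_lowerArc_disjoint hDl hc h0 hD (Or.inl rfl) hwi ?_
    (fun s hs => harc (s, a) (Or.inl (Or.inl ⟨hs, rfl⟩)))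
    (fun s hs => harc (s, b) (Or.inl (Or.inr ⟨hs, rfl⟩)))
    (fun t ht => harc (1, t) (Or.inr ⟨rfl, ht⟩))
  constructor <;> linarith

end BlockRiccati

namespace BlockRiccati

/-! ## Deformation of contour integrals -/

theorem lipschitz_comp_primitive {D : Set ℂ} (hDo : IsOpen D) {f F : ℂ → ℂ}
    (hF : ∀ z ∈ D, HasDerivAt F (f z) z) {g : ℝ → ℂ} {a b : ℝ}
    (hg : LocallyLipschitzOn (Icc a b) g) (hgD : ∀ t ∈ Icc a b, g t ∈ D) :
    ∃ K, LipschitzOnWith K (F ∘ g) (Icc a b) := by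
  refine LocallyLipschitzOn.exists_lipschitzOnWith_of_compact isCompact_Icc ?_
  intro x hx
  obtain ⟨K, t, ht, hK⟩ := hg hx
  have hFd : DifferentiableOn ℂ F D := fun z hz => (hF z hz).differentiableAt.differentiableWithinAt
  have hstrict : HasStrictDerivAt F (deriv F (g x)) (g x) :=
    (hFd.analyticAt (hDo.mem_nhds (hgD x hx))).hasStrictDerivAt
  obtain ⟨K', t', ht', hK'⟩ := hstrict.hasStrictFDerivAt.exists_lipschitzOnWith
  have hgc : ContinuousWithinAt g (Icc a b) x := hg.continuousOn x hx
  exact ⟨K' * K, t ∩ g ⁻¹' t', inter_mem ht (hgc ht'),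
    (hK'.comp (hK.mono inter_subset_left) fun y hy => hy.2)⟩

/-- The curve is only locally Lipschitz, hence differentiable almost everywhere. The composition
with the holomorphic `F` is Lipschitz on the compact interval, so its real and imaginary parts are
absolutely continuous and are recovered from their derivatives. -/
theorem integral_deriv_mul_comp {D : Set ℂ} (hDo : IsOpen D) {f F : ℂ → ℂ}
    (hF : ∀ z ∈ D, HasDerivAt F (f z) z) {g : ℝ → ℂ} {a b : ℝ} (hab : a ≤ b)
    (hg : LocallyLipschitzOn (Icc a b) g) (hgD : ∀ t ∈ Icc a b, g t ∈ D)
    (hint : IntervalIntegrable (fun t => deriv g t * f (g t)) volume a b) :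
    ∫ t in a..b, deriv g t * f (g t) = F (g b) - F (g a) := by
  obtain ⟨K, hK⟩ := lipschitz_comp_primitive hDo hF hg hgD
  obtain ⟨K₁, hK₁⟩ := hg.exists_lipschitzOnWith_of_compact isCompact_Icc
  have hder : ∀ᵐ t : ℝ, t ∈ uIoc a b → HasDerivAt (F ∘ g) (deriv g t * f (g t)) t := by
    have hb : ∀ᵐ t : ℝ, t ≠ b := by simp [ae_iff]
    filter_upwards [hK₁.ae_differentiableWithinAt_of_mem, hb] with t h1 h2 ht
    rw [uIoc_of_le hab] at ht
    have ht' : t ∈ Icc a b := Ioc_subset_Icc_self ht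
    have hd : DifferentiableAt ℝ g t :=
      (h1 ht').differentiableAt (Icc_mem_nhds ht.1 (lt_of_le_of_ne ht.2 h2))
    have := (hF _ (hgD t ht')).comp_of_eq t hd.hasDerivAt rfl
    rwa [mul_comm] at this
  have real : ∀ L : ℂ →L[ℝ] ℝ,
      L (∫ t in a..b, deriv g t * f (g t)) = L (F (g b) - F (g a)) := by
    intro L
    have hac : AbsolutelyContinuousOnInterval (L ∘ (F ∘ g)) a b := by
      refine LipschitzOnWith.absolutelyContinuousOnInterval (K := ‖L‖₊ * K) ?_
      rw [uIcc_of_le hab]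
      exact L.lipschitz.comp_lipschitzOnWith hK
    have h1 := hac.integral_deriv_eq_sub
    rw [← L.intervalIntegral_comp_comm hint, map_sub]
    refine Eq.trans ?_ h1
    refine intervalIntegral.integral_congr_ae ?_
    filter_upwards [hder] with t ht htm
    exact (L.hasFDerivAt.comp_hasDerivAt t (ht htm)).deriv.symm
  exact Complex.ext (real Complex.reCLM) (real Complex.imCLM)

theorem neBot_nhdsWithin_lower (e : ℝ) : (𝓝[{z : ℂ | z.im < 0}] (e : ℂ)).NeBot := by
  rw [← mem_closure_iff_nhdsWithin_neBot, Complex.closure_setOfPred_im_lt]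
  simp

/-- Boundary values of a primitive on the real line. -/
theorem exists_boundary_primitive {D : Set ℂ} {Δ : Set ℝ} {f F : ℂ → ℂ}
    (hF : ∀ z ∈ D, HasDerivAt F (f z) z)
    (hhalf : ∀ e ∈ Δ, ∃ ρ > 0, ∀ z : ℂ, ‖z - e‖ < ρ → z.im < 0 → z ∈ D)
    (hf : ∀ e ∈ Δ, AnalyticAt ℂ f (e : ℂ)) :
    ∃ F₀ : ℝ → ℂ, (∀ e ∈ Δ, HasDerivAt F₀ (f (e : ℂ)) e) ∧
      ∀ e ∈ Δ, Tendsto F (𝓝[{z : ℂ | z.im < 0}] (e : ℂ)) (𝓝 (F₀ e)) := by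
  classical
  have key : ∀ e ∈ Δ, ∃ Φ : ℂ → ℂ, ∃ ρ > 0, (∀ z ∈ Metric.ball (e : ℂ) ρ, HasDerivAt Φ (f z) z) ∧
      ∀ z ∈ Metric.ball (e : ℂ) ρ, z.im < 0 → F z = Φ z := by
    intro e he
    obtain ⟨ρ₁, hρ₁, h1⟩ := hhalf e he
    obtain ⟨ρ₂, hρ₂, h2⟩ := Metric.eventually_nhds_iff_ball.1 (hf e he).eventually_analyticAt
    set ρ := min ρ₁ ρ₂
    have hρ : 0 < ρ := lt_min hρ₁ hρ₂
    have hfd : DifferentiableOn ℂ f (Metric.ball (e : ℂ) ρ) := fun z hz =>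
      (h2 z (Metric.ball_subset_ball (min_le_right _ _) hz)).differentiableAt.differentiableWithinAt
    obtain ⟨Φ, hΦ⟩ := exists_primitive_ball hfd subset_rfl
    set V : Set ℂ := Metric.ball (e : ℂ) ρ ∩ {z | z.im < 0} with hV
    have hVo : IsOpen V := Metric.isOpen_ball.inter
      (isOpen_lt Complex.continuous_im continuous_const)
    have hVc : Convex ℝ V := (convex_ball _ _).inter (convex_halfSpace_im_lt 0)
    have hVD : ∀ z ∈ V, z ∈ D := fun z hz => h1 z
      (by have := hz.1; rw [Metric.mem_ball, Complex.dist_eq] at this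
          exact this.trans_le (min_le_left _ _)) hz.2
    set z₀ : ℂ := e - (ρ / 2 : ℝ) * Complex.I
    have hz₀ : z₀ ∈ V := by
      refine ⟨?_, ?_⟩
      · rw [Metric.mem_ball, Complex.dist_eq]
        simp only [z₀, sub_sub_cancel_left, norm_neg, norm_mul, Complex.norm_I, mul_one,
          Complex.norm_real, Real.norm_of_nonneg (half_pos hρ).le]
        linarith
      · have : z₀.im = -(ρ / 2) := by simp [z₀]
        change z₀.im < 0
        rw [this]; linarith
    -- The local primitive on the full disc is shifted to agree with `F` at `z₀`; on the convex
    -- half-disc the difference has derivative zero and so vanishes.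
    refine ⟨fun z => Φ z + (F z₀ - Φ z₀), ρ, hρ, fun z hz => (hΦ z hz).add_const _, ?_⟩
    intro z hz hzi
    have hd : ∀ z ∈ V, HasDerivAt (fun z => F z - Φ z) 0 z := fun z hz => by
      have := (hF z (hVD z hz)).sub (hΦ z hz.1)
      rwa [sub_self] at this
    have := hVc.norm_image_sub_le_of_norm_hasDerivWithin_le (C := 0) (𝕜 := ℂ)
      (fun z hz => (hd z hz).hasDerivWithinAt) (fun z _ => by simp) hz₀ ⟨hz, hzi⟩
    rw [zero_mul] at this
    have := norm_le_zero_iff.1 this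
    linear_combination this
  choose! Φ ρ hρ hΦ hFΦ using key
  have hlim : ∀ e ∈ Δ, ∀ t : ℝ, (t : ℂ) ∈ Metric.ball (e : ℂ) (ρ e) →
      Tendsto F (𝓝[{z : ℂ | z.im < 0}] (t : ℂ)) (𝓝 (Φ e t)) := by
    intro e he t ht
    have h1 : Tendsto (Φ e) (𝓝[{z : ℂ | z.im < 0}] (t : ℂ)) (𝓝 (Φ e t)) :=
      (hΦ e he t ht).continuousAt.tendsto.mono_left nhdsWithin_le_nhds
    refine h1.congr' ?_
    filter_upwards [self_mem_nhdsWithin,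
      mem_nhdsWithin_of_mem_nhds (Metric.isOpen_ball.mem_nhds ht)] with z h2 h3
    exact (hFΦ e he z h3 h2).symm
  have hself : ∀ e ∈ Δ, (e : ℂ) ∈ Metric.ball (e : ℂ) (ρ e) := fun e he =>
    Metric.mem_ball_self (hρ e he)
  -- Taking limits from below makes the boundary function independent of the local primitives,
  -- although near every point it coincides with one of them and inherits its derivative.
  refine ⟨fun t => limUnder (𝓝[{z : ℂ | z.im < 0}] (t : ℂ)) F, ?_, ?_⟩
  · intro e he
    have h1 : HasDerivAt (fun t : ℝ => Φ e t) (f e) e := by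
      simpa using (hΦ e he e (hself e he)).comp_ofReal
    refine h1.congr_of_eventuallyEq ?_
    have hnb : ∀ᶠ t : ℝ in 𝓝 e, (t : ℂ) ∈ Metric.ball (e : ℂ) (ρ e) :=
      Complex.continuous_ofReal.continuousAt.eventually
        (Metric.isOpen_ball.mem_nhds (hself e he))
    filter_upwards [hnb] with t ht
    have := neBot_nhdsWithin_lower t
    exact (hlim e he t ht).limUnder_eq
  · intro e he
    have := neBot_nhdsWithin_lower e
    dsimp only
    rw [(hlim e he e (hself e he)).limUnder_eq]
    exact hlim e he e (hself e he)

/-- The mean value inequality along a crosscut. -/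
theorem norm_sub_le_of_lowerArc {D : Set ℂ} {f F : ℂ → ℂ} (hF : ∀ z ∈ D, HasDerivAt F (f z) z)
    {q σ r M : ℝ} (hσ : σ = 1 ∨ σ = -1) (hr : 0 < r) {w L : ℂ} (hw : ‖w - q‖ = r)
    (hwi : w.im < 0)
    (hD : ∀ z ∈ lowerArc q σ w, z ≠ ((q + σ * r : ℝ) : ℂ) → z ∈ D)
    (hM : ∀ z ∈ D, ‖z - q‖ = r → r * ‖f z‖ ≤ M)
    (hL : Tendsto F (𝓝[{z : ℂ | z.im < 0}] ((q + σ * r : ℝ) : ℂ)) (𝓝 L)) :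
    ‖F w - L‖ ≤ Real.pi * M := by
  have hs2 : σ ^ 2 = 1 := by rcases hσ with rfl | rfl <;> norm_num
  obtain ⟨x, hx⟩ : ∃ x, x = σ * (w.re - q) := ⟨_, rfl⟩
  have hsq : x ^ 2 + w.im ^ 2 = r ^ 2 := by
    rw [hx, mul_pow, hs2, one_mul, ← hw, norm_sub_ofReal_sq]
  have hwim2 : 0 < w.im ^ 2 := by nlinarith
  have hxr := abs_lt_of_sq_lt_sq' (show x ^ 2 < r ^ 2 by linarith) hr.le
  set θ₁ := Real.arccos (x / r) with hθ₁
  have hx1 : -1 < x / r := by rw [lt_div_iff₀ hr]; linarith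
  have hx2 : x / r < 1 := by rw [div_lt_one hr]; exact hxr.2
  have hcos : Real.cos θ₁ = x / r := Real.cos_arccos hx1.le hx2.le
  have hθpos : 0 < θ₁ := Real.arccos_pos.2 hx2
  have hθpi : θ₁ < Real.pi := by
    rw [hθ₁, Real.arccos_lt_pi]; exact hx1
  -- The arc is parametrized by the angle from its real end point, with θ₁ at `w`. The angle 0 is
  -- left out, since the real point is not in `D`, and is reached by a limit. The speed is `r` and
  -- the length in θ is less than π.
  set ζ : ℝ → ℂ := fun θ => (q + σ * r * Real.cos θ : ℝ) - (r * Real.sin θ : ℝ) * Complex.I with hζ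
  have hζre : ∀ θ, (ζ θ).re = q + σ * r * Real.cos θ := fun θ => by simp [hζ, -Complex.ofReal_add, -Complex.ofReal_mul]
  have hζim : ∀ θ, (ζ θ).im = -(r * Real.sin θ) := fun θ => by simp [hζ, -Complex.ofReal_add, -Complex.ofReal_mul]
  have hζn : ∀ θ, ‖ζ θ - q‖ = r := fun θ => by
    rw [← sq_eq_sq₀ (norm_nonneg _) hr.le, norm_sub_ofReal_sq, hζre, hζim]
    linear_combination r ^ 2 * Real.cos θ ^ 2 * hs2 + r ^ 2 * Real.sin_sq_add_cos_sq θ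
  have hζw : ζ θ₁ = w := by
    apply Complex.ext
    · rw [hζre, hcos, hx]; field_simp; linear_combination (w.re - q) * hs2
    · rw [hζim]
      have h1 : 0 ≤ Real.sin θ₁ := Real.sin_nonneg_of_nonneg_of_le_pi hθpos.le hθpi.le
      have h2 : (r * Real.sin θ₁) ^ 2 = (-w.im) ^ 2 := by
        rw [mul_pow, Real.sin_sq, hcos]; field_simp; linarith
      have h3 := (sq_eq_sq₀ (mul_nonneg hr.le h1) (by linarith)).1 h2
      linarith
  have hsin : ∀ θ ∈ Ioc 0 θ₁, 0 < Real.sin θ := fun θ hθ =>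
    Real.sin_pos_of_pos_of_lt_pi hθ.1 (hθ.2.trans_lt hθpi)
  have hζlow : ∀ θ ∈ Ioc 0 θ₁, (ζ θ).im < 0 := fun θ hθ => by
    rw [hζim]; have := mul_pos hr (hsin θ hθ); linarith
  have hζD : ∀ θ ∈ Ioc 0 θ₁, ζ θ ∈ D := by
    intro θ hθ
    refine hD _ ⟨by rw [hζn, hw], (hζlow θ hθ).le, ?_⟩ ?_
    · rw [← hx, hζre]
      have h1 : Real.cos θ₁ ≤ Real.cos θ :=
        Real.cos_le_cos_of_nonneg_of_le_pi hθ.1.le hθpi.le hθ.2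
      rw [hcos, div_le_iff₀ hr] at h1
      calc x ≤ Real.cos θ * r := h1
        _ = σ * (q + σ * r * Real.cos θ - q) := by linear_combination (-r * Real.cos θ) * hs2
    · intro heq
      have := hζlow θ hθ
      rw [heq, Complex.ofReal_im] at this
      exact lt_irrefl _ this
  have hζd : ∀ θ, HasDerivAt ζ ((σ * r * -Real.sin θ : ℝ) - (r * Real.cos θ : ℝ) * Complex.I) θ := by
    intro θ
    have h1 : HasDerivAt (fun θ => q + σ * r * Real.cos θ) (σ * r * -Real.sin θ) θ :=
      ((Real.hasDerivAt_cos θ).const_mul _).const_add _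
    have h2 : HasDerivAt (fun θ => r * Real.sin θ) (r * Real.cos θ) θ :=
      (Real.hasDerivAt_sin θ).const_mul _
    exact h1.ofReal_comp.sub (h2.ofReal_comp.mul_const _)
  have hζdn : ∀ θ, ‖((σ * r * -Real.sin θ : ℝ) - (r * Real.cos θ : ℝ) * Complex.I : ℂ)‖ = r := by
    intro θ
    rw [← sq_eq_sq₀ (norm_nonneg _) hr.le, ← Complex.normSq_eq_norm_sq, Complex.normSq_apply]
    simp only [Complex.sub_re, Complex.sub_im, Complex.ofReal_re, Complex.ofReal_im,
      Complex.re_ofReal_mul, Complex.im_ofReal_mul, Complex.I_re, Complex.I_im]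
    linear_combination r ^ 2 * Real.sin θ ^ 2 * hs2 + r ^ 2 * Real.sin_sq_add_cos_sq θ
  have hM0 : 0 ≤ M := (mul_nonneg hr.le (norm_nonneg _)).trans
    (hM _ (hζD θ₁ ⟨hθpos, le_rfl⟩) (hζn _))
  have hbound : ∀ θ ∈ Ioc 0 θ₁, ‖F w - F (ζ θ)‖ ≤ Real.pi * M := by
    intro θ hθ
    have hsub : ∀ φ ∈ Icc θ θ₁, φ ∈ Ioc 0 θ₁ := fun φ hφ => ⟨hθ.1.trans_le hφ.1, hφ.2⟩
    have := (convex_Icc θ θ₁).norm_image_sub_le_of_norm_hasDerivWithin_le (f := F ∘ ζ)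
      (C := M)
      (f' := fun φ => f (ζ φ) * ((σ * r * -Real.sin φ : ℝ) - (r * Real.cos φ : ℝ) * Complex.I))
      (fun φ hφ => ((hF _ (hζD φ (hsub φ hφ))).comp_of_eq φ (hζd φ) rfl).hasDerivWithinAt)
      (fun φ hφ => by
        rw [norm_mul, hζdn, mul_comm]
        exact hM _ (hζD φ (hsub φ hφ)) (hζn φ))
      (left_mem_Icc.2 hθ.2) (right_mem_Icc.2 hθ.2)
    simp only [Function.comp_apply, hζw] at this
    refine this.trans ?_
    rw [mul_comm, Real.norm_of_nonneg (by linarith [hθ.2])]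
    exact mul_le_mul_of_nonneg_right (by linarith [hθ.1]) hM0
  have hζ0 : Tendsto ζ (𝓝[Ioc 0 θ₁] 0) (𝓝[{z : ℂ | z.im < 0}] ((q + σ * r : ℝ) : ℂ)) := by
    refine tendsto_nhdsWithin_of_tendsto_nhds_of_eventually_within _ ?_ ?_
    · have h1 : ContinuousAt ζ 0 := (hζd 0).continuousAt
      have h2 : ζ 0 = ((q + σ * r : ℝ) : ℂ) := by simp [hζ]
      rw [← h2]
      exact h1.tendsto.mono_left nhdsWithin_le_nhds
    · filter_upwards [self_mem_nhdsWithin] with θ hθ using hζlow θ hθ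
  have hne : (𝓝[Ioc 0 θ₁] (0 : ℝ)).NeBot := by
    rw [← mem_closure_iff_nhdsWithin_neBot, closure_Ioc hθpos.ne]
    exact ⟨le_rfl, hθpos.le⟩
  refine le_of_tendsto (((tendsto_const_nhds (x := F w)).sub (hL.comp hζ0)).norm) ?_
  filter_upwards [self_mem_nhdsWithin] with θ hθ using hbound θ hθ

end BlockRiccati

/-! ### Crosscuts near the end points and Cauchy's theorem for decaying integrands. -/

namespace BlockRiccati

/-- The crosscut lies on a small circle about a finite end point (σ = -1), or on a large circle
about 0 if the end point is infinite (σ = 1). The track of `c` under the deformation is compact and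
stays on one side of the circle, while the track of a point `b` close enough to the end stays on the
other. -/
theorem exists_crosscut_right {μ₁ μ₂ : EReal} {D : Set ℂ} (hDl : ∀ z ∈ D, z.im < 0) {g : ℝ → ℂ}
    (hg : IsContour μ₁ μ₂ D g) {f : ℂ → ℂ} {ε : ℝ}
    (hend : ∀ c : ℝ, (c : EReal) = μ₂ → ∃ δ > 0, ∀ z ∈ D, ‖z - c‖ < δ → ‖z - c‖ * ‖f z‖ ≤ ε)
    (hinf : μ₂ = ⊤ → ∃ R : ℝ, ∀ z ∈ D, R < ‖z‖ → ‖z‖ * ‖f z‖ ≤ ε)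
    {c : ℝ} (hc : c ∈ openInterval μ₁ μ₂) :
    ∃ q σ r : ℝ, (σ = 1 ∨ σ = -1) ∧ 0 < r ∧ c < q + σ * r ∧ q + σ * r ∈ openInterval μ₁ μ₂ ∧
      (∀ z ∈ D, ‖z - q‖ = r → r * ‖f z‖ ≤ ε) ∧
      ∃ t ∈ openInterval μ₁ μ₂, c < t ∧ ‖g t - q‖ = r ∧
        ∀ z ∈ lowerArc q σ (g t), z ≠ ((q + σ * r : ℝ) : ℂ) → z ∈ D := by
  obtain ⟨h, hcont, h0, h1, hD, -, hR, -, hTop⟩ := hg.deformation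
  have hsc : ContinuousOn (fun s => h s c) (Icc 0 1) :=
    hcont.comp (f := fun s : ℝ => (s, c)) (by fun_prop) (fun s hs => ⟨hs, hc⟩)
  have ends : ∀ {q σ r b : ℝ}, (σ = 1 ∨ σ = -1) → 0 < r → c < q + σ * r → q + σ * r < b →
      b ∈ openInterval μ₁ μ₂ → (∀ z ∈ D, ‖z - q‖ = r → r * ‖f z‖ ≤ ε) →
      ((∀ s ∈ Icc (0 : ℝ) 1, ‖h s c - q‖ < r ∧ r < ‖h s b - q‖) ∨
        (∀ s ∈ Icc (0 : ℝ) 1, r < ‖h s c - q‖ ∧ ‖h s b - q‖ < r)) →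
      ∃ q σ r : ℝ, (σ = 1 ∨ σ = -1) ∧ 0 < r ∧ c < q + σ * r ∧ q + σ * r ∈ openInterval μ₁ μ₂ ∧
      (∀ z ∈ D, ‖z - q‖ = r → r * ‖f z‖ ≤ ε) ∧
      ∃ t ∈ openInterval μ₁ μ₂, c < t ∧ ‖g t - q‖ = r ∧
        ∀ z ∈ lowerArc q σ (g t), z ≠ ((q + σ * r : ℝ) : ℂ) → z ∈ D := by
    intro q σ r b hσ hr hce heb hb hM hside
    have hsub := Icc_subset_openInterval hc hb
    obtain ⟨t, ht, htr, hA⟩ := exists_crosscut hDl (hcont.mono (prod_mono le_rfl hsub))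
      (fun t ht => h0 t (hsub ht)) (fun s hs t ht => hD s hs t (hsub ht)) hσ ⟨hce, heb⟩ hr hside
    have htΔ := hsub (Ioo_subset_Icc_self ht)
    rw [h1 t htΔ] at htr hA
    exact ⟨q, σ, r, hσ, hr, hce, hsub ⟨hce.le, heb.le⟩, hM, t, htΔ, ht.1, htr, hA⟩
  rcases eq_or_ne μ₂ ⊤ with htop | htop
  · obtain ⟨R₁, hR₁⟩ := hinf htop
    obtain ⟨C, hC⟩ := isCompact_Icc.exists_bound_of_continuousOn hsc
    set r := max (max R₁ C) |c| + 1 with hrdef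
    have hr1 : R₁ < r := lt_of_le_of_lt ((le_max_left _ _).trans (le_max_left _ _)) (lt_add_one _)
    have hr2 : C < r := lt_of_le_of_lt ((le_max_right _ _).trans (le_max_left _ _)) (lt_add_one _)
    have hr3 : |c| < r := lt_of_le_of_lt (le_max_right _ _) (lt_add_one _)
    have hr0 : 0 < r := (abs_nonneg c).trans_lt hr3
    obtain ⟨b, hb1, hb2⟩ := ((hTop htop (r + 1)).and (eventually_gt_atTop r)).exists
    have hcr : c < r := (le_abs_self c).trans_lt hr3
    have hbΔ : b ∈ openInterval μ₁ μ₂ :=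
      ⟨hc.1.trans (EReal.coe_lt_coe_iff.2 (hcr.trans hb2)), by rw [htop]; exact EReal.coe_lt_top b⟩
    refine ends (q := 0) (σ := 1) (r := r) (b := b) (Or.inl rfl) hr0 (by linarith) (by linarith)
      hbΔ (fun z hz hzr => ?_) (Or.inl fun s hs => ⟨?_, ?_⟩)
    · simp only [Complex.ofReal_zero, sub_zero] at hzr
      have := hR₁ z hz (by rw [hzr]; exact hr1)
      rwa [hzr] at this
    · simpa using (hC s hs).trans_lt hr2
    · have := hb1 s hs
      simp only [Complex.ofReal_zero, sub_zero]; linarith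
  · have hbot : μ₂ ≠ ⊥ := (bot_le.trans_lt (hc.1.trans hc.2)).ne'
    obtain ⟨c₂, rfl⟩ : ∃ c₂ : ℝ, (c₂ : EReal) = μ₂ := ⟨μ₂.toReal, EReal.coe_toReal htop hbot⟩
    have hcc : c < c₂ := EReal.coe_lt_coe_iff.1 hc.2
    obtain ⟨δ, hδ, hfδ⟩ := hend c₂ rfl
    -- The track of `c` keeps a positive distance from the end point: it starts at the real number
    -- `c ≠ c₂` and lies in the lower half-plane afterwards.
    obtain ⟨s₀, hs₀, hmin⟩ := isCompact_Icc.exists_isMinOn (nonempty_Icc.2 zero_le_one)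
      (hsc.sub continuousOn_const (g := fun _ => (c₂ : ℂ))).norm
    have hpos : 0 < ‖h s₀ c - c₂‖ := by
      rw [norm_pos_iff, sub_ne_zero]
      intro heq
      rcases hs₀.1.eq_or_lt with h' | h'
      · rw [← h', h0 c hc, Complex.ofReal_inj] at heq
        exact hcc.ne heq
      · have := hDl _ (hD s₀ ⟨h', hs₀.2⟩ c hc)
        rw [heq, Complex.ofReal_im] at this
        exact lt_irrefl _ this
    set r := min (min δ ‖h s₀ c - c₂‖) (c₂ - c) / 2 with hrdef
    have hr0 : 0 < r := half_pos (lt_min (lt_min hδ hpos) (sub_pos.2 hcc))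
    have hrr : 2 * r = min (min δ ‖h s₀ c - c₂‖) (c₂ - c) := by rw [hrdef]; ring
    have hr1 : 2 * r ≤ δ := hrr ▸ (min_le_left _ _).trans (min_le_left _ _)
    have hr2 : 2 * r ≤ ‖h s₀ c - c₂‖ := hrr ▸ (min_le_left _ _).trans (min_le_right _ _)
    have hr3 : 2 * r ≤ c₂ - c := hrr ▸ min_le_right _ _
    have ev := Metric.tendstoUniformlyOn_iff.1 (hR c₂ rfl) r hr0
    obtain ⟨b, hb1, hb2⟩ := (ev.and (Ioo_mem_nhdsLT (show c₂ - r < c₂ by linarith))).exists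
    have hbΔ : b ∈ openInterval μ₁ (c₂ : EReal) :=
      ⟨hc.1.trans (EReal.coe_lt_coe_iff.2 (by linarith [hb2.1])), EReal.coe_lt_coe_iff.2 hb2.2⟩
    refine ends (q := c₂) (σ := -1) (r := r) (b := b) (Or.inr rfl) hr0 (by linarith)
      (by linarith [hb2.1]) hbΔ (fun z hz hzr => ?_) (Or.inr fun s hs => ⟨?_, ?_⟩)
    · have := hfδ z hz (by rw [hzr]; linarith)
      rwa [hzr] at this
    · have : ‖h s₀ c - c₂‖ ≤ ‖h s c - c₂‖ := hmin hs
      linarith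
    · have := hb1 s hs
      rwa [dist_comm, Complex.dist_eq] at this

/-- The mirror image of the right end: now σ = 1 at a finite end point and σ = -1 on large circles.
-/
theorem exists_crosscut_left {μ₁ μ₂ : EReal} {D : Set ℂ} (hDl : ∀ z ∈ D, z.im < 0) {g : ℝ → ℂ}
    (hg : IsContour μ₁ μ₂ D g) {f : ℂ → ℂ} {ε : ℝ}
    (hend : ∀ c : ℝ, (c : EReal) = μ₁ → ∃ δ > 0, ∀ z ∈ D, ‖z - c‖ < δ → ‖z - c‖ * ‖f z‖ ≤ ε)
    (hinf : μ₁ = ⊥ → ∃ R : ℝ, ∀ z ∈ D, R < ‖z‖ → ‖z‖ * ‖f z‖ ≤ ε)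
    {c : ℝ} (hc : c ∈ openInterval μ₁ μ₂) :
    ∃ q σ r : ℝ, (σ = 1 ∨ σ = -1) ∧ 0 < r ∧ q + σ * r < c ∧ q + σ * r ∈ openInterval μ₁ μ₂ ∧
      (∀ z ∈ D, ‖z - q‖ = r → r * ‖f z‖ ≤ ε) ∧
      ∃ t ∈ openInterval μ₁ μ₂, t < c ∧ ‖g t - q‖ = r ∧
        ∀ z ∈ lowerArc q σ (g t), z ≠ ((q + σ * r : ℝ) : ℂ) → z ∈ D := by
  obtain ⟨h, hcont, h0, h1, hD, hL, -, hBot, -⟩ := hg.deformation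
  have hsc : ContinuousOn (fun s => h s c) (Icc 0 1) :=
    hcont.comp (f := fun s : ℝ => (s, c)) (by fun_prop) (fun s hs => ⟨hs, hc⟩)
  have ends : ∀ {q σ r a : ℝ}, (σ = 1 ∨ σ = -1) → 0 < r → q + σ * r < c → a < q + σ * r →
      a ∈ openInterval μ₁ μ₂ → (∀ z ∈ D, ‖z - q‖ = r → r * ‖f z‖ ≤ ε) →
      ((∀ s ∈ Icc (0 : ℝ) 1, ‖h s a - q‖ < r ∧ r < ‖h s c - q‖) ∨
        (∀ s ∈ Icc (0 : ℝ) 1, r < ‖h s a - q‖ ∧ ‖h s c - q‖ < r)) →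
      ∃ q σ r : ℝ, (σ = 1 ∨ σ = -1) ∧ 0 < r ∧ q + σ * r < c ∧ q + σ * r ∈ openInterval μ₁ μ₂ ∧
      (∀ z ∈ D, ‖z - q‖ = r → r * ‖f z‖ ≤ ε) ∧
      ∃ t ∈ openInterval μ₁ μ₂, t < c ∧ ‖g t - q‖ = r ∧
        ∀ z ∈ lowerArc q σ (g t), z ≠ ((q + σ * r : ℝ) : ℂ) → z ∈ D := by
    intro q σ r a hσ hr hce hea ha hM hside
    have hsub := Icc_subset_openInterval ha hc
    obtain ⟨t, ht, htr, hA⟩ := exists_crosscut hDl (hcont.mono (prod_mono le_rfl hsub))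
      (fun t ht => h0 t (hsub ht)) (fun s hs t ht => hD s hs t (hsub ht)) hσ ⟨hea, hce⟩ hr hside
    have htΔ := hsub (Ioo_subset_Icc_self ht)
    rw [h1 t htΔ] at htr hA
    exact ⟨q, σ, r, hσ, hr, hce, hsub ⟨hea.le, hce.le⟩, hM, t, htΔ, ht.2, htr, hA⟩
  rcases eq_or_ne μ₁ ⊥ with hbot | hbot
  · obtain ⟨R₁, hR₁⟩ := hinf hbot
    obtain ⟨C, hC⟩ := isCompact_Icc.exists_bound_of_continuousOn hsc
    set r := max (max R₁ C) |c| + 1 with hrdef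
    have hr1 : R₁ < r := lt_of_le_of_lt ((le_max_left _ _).trans (le_max_left _ _)) (lt_add_one _)
    have hr2 : C < r := lt_of_le_of_lt ((le_max_right _ _).trans (le_max_left _ _)) (lt_add_one _)
    have hr3 : |c| < r := lt_of_le_of_lt (le_max_right _ _) (lt_add_one _)
    have hr0 : 0 < r := (abs_nonneg c).trans_lt hr3
    obtain ⟨b, hb1, hb2⟩ := ((hBot hbot (r + 1)).and (eventually_lt_atBot (-r))).exists
    have hcr : -r < c := by linarith [neg_abs_le c]
    have hbΔ : b ∈ openInterval μ₁ μ₂ :=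
      ⟨by rw [hbot]; exact EReal.bot_lt_coe b,
        (EReal.coe_lt_coe_iff.2 (hb2.trans hcr)).trans hc.2⟩
    refine ends (q := 0) (σ := -1) (r := r) (a := b) (Or.inr rfl) hr0 (by linarith) (by linarith)
      hbΔ (fun z hz hzr => ?_) (Or.inr fun s hs => ⟨?_, ?_⟩)
    · simp only [Complex.ofReal_zero, sub_zero] at hzr
      have := hR₁ z hz (by rw [hzr]; exact hr1)
      rwa [hzr] at this
    · have := hb1 s hs
      simp only [Complex.ofReal_zero, sub_zero]; linarith
    · simpa using (hC s hs).trans_lt hr2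
  · have htop : μ₁ ≠ ⊤ := ((hc.1.trans hc.2).trans_le le_top).ne
    obtain ⟨c₁, rfl⟩ : ∃ c₁ : ℝ, (c₁ : EReal) = μ₁ := ⟨μ₁.toReal, EReal.coe_toReal htop hbot⟩
    have hcc : c₁ < c := EReal.coe_lt_coe_iff.1 hc.1
    obtain ⟨δ, hδ, hfδ⟩ := hend c₁ rfl
    obtain ⟨s₀, hs₀, hmin⟩ := isCompact_Icc.exists_isMinOn (nonempty_Icc.2 zero_le_one)
      (hsc.sub continuousOn_const (g := fun _ => (c₁ : ℂ))).norm
    have hpos : 0 < ‖h s₀ c - c₁‖ := by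
      rw [norm_pos_iff, sub_ne_zero]
      intro heq
      rcases hs₀.1.eq_or_lt with h' | h'
      · rw [← h', h0 c hc, Complex.ofReal_inj] at heq
        exact hcc.ne' heq
      · have := hDl _ (hD s₀ ⟨h', hs₀.2⟩ c hc)
        rw [heq, Complex.ofReal_im] at this
        exact lt_irrefl _ this
    set r := min (min δ ‖h s₀ c - c₁‖) (c - c₁) / 2 with hrdef
    have hr0 : 0 < r := half_pos (lt_min (lt_min hδ hpos) (sub_pos.2 hcc))
    have hrr : 2 * r = min (min δ ‖h s₀ c - c₁‖) (c - c₁) := by rw [hrdef]; ring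
    have hr1 : 2 * r ≤ δ := hrr ▸ (min_le_left _ _).trans (min_le_left _ _)
    have hr2 : 2 * r ≤ ‖h s₀ c - c₁‖ := hrr ▸ (min_le_left _ _).trans (min_le_right _ _)
    have hr3 : 2 * r ≤ c - c₁ := hrr ▸ min_le_right _ _
    have ev := Metric.tendstoUniformlyOn_iff.1 (hL c₁ rfl) r hr0
    obtain ⟨b, hb1, hb2⟩ := (ev.and (Ioo_mem_nhdsGT (show c₁ < c₁ + r by linarith))).exists
    have hbΔ : b ∈ openInterval (c₁ : EReal) μ₂ :=
      ⟨EReal.coe_lt_coe_iff.2 hb2.1,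
        (EReal.coe_lt_coe_iff.2 (by linarith [hb2.2])).trans hc.2⟩
    refine ends (q := c₁) (σ := 1) (r := r) (a := b) (Or.inl rfl) hr0 (by linarith)
      (by linarith [hb2.2]) hbΔ (fun z hz hzr => ?_) (Or.inl fun s hs => ⟨?_, ?_⟩)
    · have := hfδ z hz (by rw [hzr]; linarith)
      rwa [hzr] at this
    · have := hb1 s hs
      rwa [dist_comm, Complex.dist_eq] at this
    · have : ‖h s₀ c - c₁‖ ≤ ‖h s c - c₁‖ := hmin hs
      linarith

/-- Cauchy's theorem for the deformation of an interval into the lower half-plane. -/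
theorem contour_integral_eq {μ₁ μ₂ : EReal} (hμ : μ₁ < μ₂) {D : Set ℂ} (hDo : IsOpen D)
    (hDs : IsSimplyConnected D) (hDl : ∀ z ∈ D, z.im < 0) {g : ℝ → ℂ}
    (hg : IsContour μ₁ μ₂ D g) {f : ℂ → ℂ}
    (hf : AnalyticOnNhd ℂ f (Complex.ofReal '' openInterval μ₁ μ₂ ∪ D))
    (hend : ∀ c : ℝ, ((c : EReal) = μ₁ ∨ (c : EReal) = μ₂) → ∀ ε > 0, ∃ δ > 0, ∀ z ∈ D,
      ‖z - c‖ < δ → ‖z - c‖ * ‖f z‖ ≤ ε)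
    (hinf : (μ₁ = ⊥ ∨ μ₂ = ⊤) → ∀ ε > 0, ∃ R : ℝ, ∀ z ∈ D, R < ‖z‖ → ‖z‖ * ‖f z‖ ≤ ε)
    (hi₀ : IntegrableOn (fun t : ℝ => f t) (openInterval μ₁ μ₂))
    (hi₁ : IntegrableOn (fun t : ℝ => deriv g t * f (g t)) (openInterval μ₁ μ₂)) :
    ∫ t in openInterval μ₁ μ₂, f t = ∫ t in openInterval μ₁ μ₂, deriv g t * f (g t) := by
  obtain ⟨F, hF⟩ := exists_primitive hDo hDs (f := f)
    (fun z hz => (hf z (Or.inr hz)).differentiableAt.differentiableWithinAt)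
  obtain ⟨h, hcont, h0, h1, hD, -⟩ := hg.deformation
  have hgD : ∀ t ∈ openInterval μ₁ μ₂, g t ∈ D := fun t ht =>
    h1 t ht ▸ hD 1 ⟨one_pos, le_rfl⟩ t ht
  have hhalf : ∀ e ∈ openInterval μ₁ μ₂, ∃ ρ > 0, ∀ z : ℂ, ‖z - e‖ < ρ → z.im < 0 → z ∈ D := by
    intro e he
    obtain ⟨a, ha, hae⟩ := exists_lt_mem_openInterval he
    obtain ⟨b, hb, heb⟩ := exists_gt_mem_openInterval he
    have hsub := Icc_subset_openInterval ha hb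
    exact exists_halfDisc hDl (hcont.mono (prod_mono le_rfl hsub))
      (fun t ht => h0 t (hsub ht)) (fun s hs t ht => hD s hs t (hsub ht)) ⟨hae, heb⟩
  obtain ⟨F₀, hF₀, hlim⟩ := exists_boundary_primitive hF hhalf
    (fun e he => hf e (Or.inl ⟨e, he, rfl⟩))
  rw [← sub_eq_zero, ← norm_le_zero_iff]
  refine le_of_forall_pos_le_add fun η hη => ?_
  rw [zero_add]
  have hpi := Real.pi_pos
  -- The error consists of two tails of at most ε each and two crosscuts of at most πε each, in all
  -- 2(1 + π)ε = η.
  set ε := η / (2 * (1 + Real.pi)) with hε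
  have hε0 : 0 < ε := by positivity
  obtain ⟨a₀, ha₀, b₀, hb₀, hab₀, -, hT₀⟩ := exists_tail_lt hμ hi₀ hε0
  obtain ⟨a₁, ha₁, b₁, hb₁, hab₁, -, hT₁⟩ := exists_tail_lt hμ hi₁ hε0
  have ham : min a₀ a₁ ∈ openInterval μ₁ μ₂ := by
    rcases min_choice a₀ a₁ with h | h <;> rw [h] <;> assumption
  have hbm : max b₀ b₁ ∈ openInterval μ₁ μ₂ := by
    rcases max_choice b₀ b₁ with h | h <;> rw [h] <;> assumption
  -- A crosscut joins a point `e` of the interval to a point `g t` of the curve; the parameters `e`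
  -- and `t` need not agree, but both lie beyond the range where the tails are controlled.
  obtain ⟨q, σ, r, hσ, hr, hlt, heΔ, hM, t, htΔ, hlt', htr, hA⟩ := exists_crosscut_left hDl hg
    (f := f) (ε := ε) (fun c hc => hend c (Or.inl hc) ε hε0) (fun h => hinf (Or.inl h) ε hε0) ham
  obtain ⟨q', σ', r', hσ', hr', hgt, heΔ', hM', t', htΔ', hgt', htr', hA'⟩ :=
    exists_crosscut_right hDl hg (f := f) (ε := ε)
    (fun c hc => hend c (Or.inr hc) ε hε0) (fun h => hinf (Or.inr h) ε hε0) hbm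
  set e := q + σ * r
  set e' := q' + σ' * r'
  have B := norm_sub_le_of_lowerArc hF hσ hr htr (hDl _ (hgD t htΔ)) hA hM (hlim _ heΔ)
  have B' := norm_sub_le_of_lowerArc hF hσ' hr' htr' (hDl _ (hgD t' htΔ')) hA' hM' (hlim _ heΔ')
  have T₀ := hT₀ e heΔ (hlt.le.trans (min_le_left _ _)) e' heΔ' ((le_max_left _ _).trans hgt.le)
  have T₁ := hT₁ t htΔ (hlt'.le.trans (min_le_right _ _)) t' htΔ'
    ((le_max_right _ _).trans hgt'.le)
  have hee : e ≤ e' := by linarith [min_le_left a₀ a₁, le_max_left b₀ b₁]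
  have htt : t ≤ t' := by linarith [min_le_left a₀ a₁, le_max_left b₀ b₁]
  have hsub := Icc_subset_openInterval heΔ heΔ'
  have hsub' := Icc_subset_openInterval htΔ htΔ'
  have I₀ : ∫ s in e..e', f s = F₀ e' - F₀ e := by
    refine intervalIntegral.integral_eq_sub_of_hasDerivAt (fun s hs => ?_) ?_
    · rw [uIcc_of_le hee] at hs
      exact hF₀ s (hsub hs)
    · rw [intervalIntegrable_iff_integrableOn_Icc_of_le hee]
      exact hi₀.mono_set hsub
  have I₁ : ∫ s in t..t', deriv g s * f (g s) = F (g t') - F (g t) := by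
    refine integral_deriv_mul_comp hDo hF htt (hg.locallyLipschitzOn.mono hsub')
      (fun s hs => hgD s (hsub' hs)) ?_
    rw [intervalIntegrable_iff_integrableOn_Icc_of_le htt]
    exact hi₁.mono_set hsub'
  rw [I₀] at T₀
  rw [I₁] at T₁
  set J₀ := ∫ t in openInterval μ₁ μ₂, f t
  set J₁ := ∫ t in openInterval μ₁ μ₂, deriv g t * f (g t)
  calc ‖J₀ - J₁‖ = ‖(J₀ - (F₀ e' - F₀ e)) - (J₁ - (F (g t') - F (g t)))
        - ((F (g t') - F₀ e') - (F (g t) - F₀ e))‖ := by congr 1; ring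
    _ ≤ ‖J₀ - (F₀ e' - F₀ e)‖ + ‖J₁ - (F (g t') - F (g t))‖
        + (‖F (g t') - F₀ e'‖ + ‖F (g t) - F₀ e‖) :=
      (norm_sub_le _ _).trans (add_le_add (norm_sub_le _ _) (norm_sub_le _ _))
    _ ≤ ε + ε + (Real.pi * ε + Real.pi * ε) := by gcongr
    _ = η := by rw [hε]; field_simp; ring

end BlockRiccati

/-! ### Polynomial growth at infinity, and reflection to the upper half-plane. -/

namespace BlockRiccati

/-- In the closed lower half-plane iεz has the nonnegative real part -ε Im z, so adding 1 cannot
decrease its modulus and leaves it at least 1. -/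
theorem norm_one_add_mul_ge {ε : ℝ} (hε : 0 ≤ ε) {z : ℂ} (hz : z.im ≤ 0) :
    1 ≤ ‖1 + ε * Complex.I * z‖ ∧ ε * ‖z‖ ≤ ‖1 + ε * Complex.I * z‖ := by
  have h : ‖1 + ε * Complex.I * z‖ ^ 2 = (1 - ε * z.im) ^ 2 + (ε * z.re) ^ 2 := by
    rw [← Complex.normSq_eq_norm_sq, Complex.normSq_apply]
    simp
    ring
  have hz2 : ‖z‖ ^ 2 = z.re ^ 2 + z.im ^ 2 := by
    rw [← Complex.normSq_eq_norm_sq, Complex.normSq_apply]; ring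
  have h1 : 0 ≤ ε * -z.im := mul_nonneg hε (by linarith)
  constructor
  · rw [← sq_le_sq₀ zero_le_one (norm_nonneg _), h]
    nlinarith [sq_nonneg (ε * z.re), sq_nonneg (ε * z.im)]
  · rw [← sq_le_sq₀ (mul_nonneg hε (norm_nonneg _)) (norm_nonneg _), h, mul_pow, hz2]
    nlinarith

/-- The deformation of an interval into the lower half-plane, for functions with integrable power
singularities at the finite end points and with polynomial growth at infinity. -/
theorem contour_integral_eq_of_growth {μ₁ μ₂ : EReal} (hμ : μ₁ < μ₂) {D : Set ℂ} (hDo : IsOpen D)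
    (hDs : IsSimplyConnected D) (hDl : ∀ z ∈ D, z.im < 0) {g : ℝ → ℂ}
    (hg : IsContour μ₁ μ₂ D g) {f : ℂ → ℂ}
    (hf : AnalyticOnNhd ℂ f (Complex.ofReal '' openInterval μ₁ μ₂ ∪ D))
    (hend : ∀ c : ℝ, ((c : EReal) = μ₁ ∨ (c : EReal) = μ₂) → ∃ C : ℝ, ∃ γ > (-1 : ℝ), ∃ δ > 0,
      ∀ z ∈ D, ‖z - c‖ < δ → ‖f z‖ ≤ C * ‖z - c‖ ^ γ)
    (hinf : (μ₁ = ⊥ ∨ μ₂ = ⊤) → ∃ C : ℝ, ∃ N : ℕ, ∃ R : ℝ, ∀ z ∈ D, R < ‖z‖ →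
      ‖f z‖ ≤ C * ‖z‖ ^ N)
    (hi₀ : IntegrableOn (fun t : ℝ => f t) (openInterval μ₁ μ₂))
    (hi₁ : IntegrableOn (fun t : ℝ => deriv g t * f (g t)) (openInterval μ₁ μ₂)) :
    ∫ t in openInterval μ₁ μ₂, f t = ∫ t in openInterval μ₁ μ₂, deriv g t * f (g t) := by
  -- The regularizing factor needs an exponent also for a bounded interval, where the growth
  -- condition is void; the default is `N = 0`.
  obtain ⟨C, N, R, hCN⟩ : ∃ C : ℝ, ∃ N : ℕ, ∃ R : ℝ, (μ₁ = ⊥ ∨ μ₂ = ⊤) → ∀ z ∈ D, R < ‖z‖ →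
      ‖f z‖ ≤ C * ‖z‖ ^ N := by
    by_cases h : μ₁ = ⊥ ∨ μ₂ = ⊤
    · obtain ⟨C, N, R, H⟩ := hinf h
      exact ⟨C, N, R, fun _ => H⟩
    · exact ⟨0, 0, 0, fun h' => absurd h' h⟩
  obtain ⟨h, hcont, h0, h1, hD, -⟩ := hg.deformation
  have hgD : ∀ t ∈ openInterval μ₁ μ₂, g t ∈ D := fun t ht =>
    h1 t ht ▸ hD 1 ⟨one_pos, le_rfl⟩ t ht
  have hgc : ContinuousOn g (openInterval μ₁ μ₂) := hg.locallyLipschitzOn.continuousOn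
  -- The power N + 2 outweighs the growth |z|^N and the factor |z| from the radius of the crosscut
  -- with one power to spare. As |ψ| ≤ 1 and ψ → 1 when ε → 0, dominated convergence removes the
  -- factor at the end.
  set ψ : ℝ → ℂ → ℂ := fun ε z => ((1 + ε * Complex.I * z) ^ (N + 2))⁻¹ with hψ
  have hne : ∀ ε : ℝ, 0 ≤ ε → ∀ z : ℂ, z.im ≤ 0 → (1 + ε * Complex.I * z) ^ (N + 2) ≠ 0 := by
    intro ε hε z hz
    refine pow_ne_zero _ fun h0 => ?_
    have := (norm_one_add_mul_ge hε hz).1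
    rw [h0, norm_zero] at this
    linarith
  have hψ1 : ∀ ε : ℝ, 0 ≤ ε → ∀ z : ℂ, z.im ≤ 0 → ‖ψ ε z‖ ≤ 1 := by
    intro ε hε z hz
    simp only [hψ, norm_inv, norm_pow]
    exact inv_le_one_of_one_le₀ (one_le_pow₀ (norm_one_add_mul_ge hε hz).1)
  have hψc : ∀ ε : ℝ, 0 ≤ ε → ContinuousOn (ψ ε) {z | z.im ≤ 0} := by
    intro ε hε
    exact ContinuousOn.inv₀ (by fun_prop) (fun z hz => hne ε hε z hz)
  have hm := measurableSet_openInterval μ₁ μ₂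
  have him : ∀ t ∈ openInterval μ₁ μ₂, (g t).im ≤ 0 := fun t ht => (hDl _ (hgD t ht)).le
  have hc₀ : ∀ ε : ℝ, 0 ≤ ε → AEStronglyMeasurable (fun t : ℝ => ψ ε t)
      (volume.restrict (openInterval μ₁ μ₂)) := fun ε hε =>
    ((hψc ε hε).comp Complex.continuous_ofReal.continuousOn
      (fun t _ => by simp)).aestronglyMeasurable hm
  have hc₁ : ∀ ε : ℝ, 0 ≤ ε → AEStronglyMeasurable (fun t : ℝ => ψ ε (g t))
      (volume.restrict (openInterval μ₁ μ₂)) := fun ε hε =>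
    ((hψc ε hε).comp hgc him).aestronglyMeasurable hm
  have J₀ : ∀ ε : ℝ, 0 ≤ ε → IntegrableOn (fun t : ℝ => f t * ψ ε t) (openInterval μ₁ μ₂) :=
    fun ε hε => Integrable.mul_bdd hi₀ (hc₀ ε hε) (Eventually.of_forall fun t => hψ1 ε hε t (by simp))
  have J₁ : ∀ ε : ℝ, 0 ≤ ε → IntegrableOn (fun t : ℝ => deriv g t * (f (g t) * ψ ε (g t)))
      (openInterval μ₁ μ₂) := fun ε hε => by
    have := Integrable.mul_bdd hi₁ (hc₁ ε hε)
      ((ae_restrict_iff' hm).2 (Eventually.of_forall fun t ht => hψ1 ε hε (g t) (him t ht)))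
    simp only [mul_assoc] at this
    exact this
  have key : ∀ ε : ℝ, 0 < ε → ∫ t in openInterval μ₁ μ₂, f t * ψ ε t
      = ∫ t in openInterval μ₁ μ₂, deriv g t * (f (g t) * ψ ε (g t)) := by
    intro ε hε
    refine contour_integral_eq hμ hDo hDs hDl hg (f := fun z => f z * ψ ε z) ?_ ?_ ?_
      (J₀ ε hε.le) (J₁ ε hε.le)
    · intro z hz
      have hzi : z.im ≤ 0 := by
        rcases hz with ⟨t, -, rfl⟩ | hz
        · simp
        · exact (hDl z hz).le
      exact (hf z hz).mul (((analyticAt_const.add (analyticAt_const.mul analyticAt_id)).pow _).inv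
        (hne ε hε.le z hzi))
    · intro c hc η hη
      obtain ⟨C', γ, hγ, δ, hδ, H⟩ := hend c hc
      -- Radius times integrand is of order |z - c|^(γ + 1), which vanishes at the end point because
      -- γ > -1.
      have hlim : Tendsto (fun x : ℝ => C' * x ^ (γ + 1)) (𝓝 0) (𝓝 0) := by
        have h1 : ContinuousAt (fun x : ℝ => C' * x ^ (γ + 1)) 0 :=
          continuousAt_const.mul (Real.continuousAt_rpow_const _ _ (Or.inr (by linarith)))
        have h2 := h1.tendsto
        rwa [Real.zero_rpow (by linarith), mul_zero] at h2
      obtain ⟨δ', hδ', hsm⟩ := Metric.eventually_nhds_iff.1 (hlim.eventually (gt_mem_nhds hη))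
      refine ⟨min δ δ', lt_min hδ hδ', fun z hz hzc => ?_⟩
      have hpos : 0 < ‖z - c‖ := by
        rw [norm_pos_iff, sub_ne_zero]
        rintro rfl
        have := hDl _ hz
        simp at this
      have e1 := H z hz (hzc.trans_le (min_le_left _ _))
      have e2 := hsm (y := ‖z - c‖) (by
        rw [Real.dist_eq, sub_zero, abs_of_pos hpos]; exact hzc.trans_le (min_le_right _ _))
      calc ‖z - c‖ * ‖f z * ψ ε z‖ ≤ ‖z - c‖ * (C' * ‖z - c‖ ^ γ) := by
            gcongr
            rw [norm_mul]
            exact (mul_le_of_le_one_right (norm_nonneg _) (hψ1 ε hε.le z (hDl z hz).le)).trans e1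
        _ = C' * ‖z - c‖ ^ (γ + 1) := by rw [Real.rpow_add hpos, Real.rpow_one]; ring
        _ ≤ η := e2.le
    · intro hinf' η hη
      have H := hCN hinf'
      refine ⟨max (max R 1) (C / ε ^ (N + 2) / η), fun z hz hzR => ?_⟩
      have z1 : R < ‖z‖ := (((le_max_left _ _).trans (le_max_left _ _)).trans_lt hzR)
      have z2 : 1 < ‖z‖ := (((le_max_right _ _).trans (le_max_left _ _)).trans_lt hzR)
      have z3 : C / ε ^ (N + 2) / η < ‖z‖ := (le_max_right _ _).trans_lt hzR
      have hz0 : 0 < ‖z‖ := zero_lt_one.trans z2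
      have e1 := H z hz z1
      have e2 : ‖ψ ε z‖ ≤ ((ε * ‖z‖) ^ (N + 2))⁻¹ := by
        simp only [hψ, norm_inv, norm_pow]
        gcongr
        exact (norm_one_add_mul_ge hε.le (hDl z hz).le).2
      have hC : 0 ≤ C * ‖z‖ ^ N := (norm_nonneg _).trans e1
      calc ‖z‖ * ‖f z * ψ ε z‖ ≤ ‖z‖ * ((C * ‖z‖ ^ N) * ((ε * ‖z‖) ^ (N + 2))⁻¹) := by
            rw [norm_mul]; gcongr
        _ = C / ε ^ (N + 2) / ‖z‖ := by rw [mul_pow]; field_simp; ring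
        _ ≤ η := by
          rw [div_lt_iff₀ hη] at z3
          rw [div_le_iff₀ hz0]; linarith
  have hlim0 : Tendsto (fun n : ℕ => (1 / ((n : ℝ) + 1))) atTop (𝓝 0) :=
    tendsto_one_div_add_atTop_nhds_zero_nat
  have hεn : ∀ n : ℕ, 0 < 1 / ((n : ℝ) + 1) := fun n => by positivity
  have hψlim : ∀ z : ℂ, Tendsto (fun n : ℕ => ψ (1 / ((n : ℝ) + 1)) z) atTop (𝓝 1) := by
    intro z
    have hc : ContinuousAt (fun ε : ℝ => ψ ε z) 0 := by
      refine ContinuousAt.inv₀ (by fun_prop) (by simp)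
    have h2 : ψ 0 z = 1 := by simp [hψ]
    rw [← h2]
    exact hc.tendsto.comp hlim0
  have L₀ : Tendsto (fun n : ℕ => ∫ t in openInterval μ₁ μ₂, f t * ψ (1 / ((n : ℝ) + 1)) t) atTop
      (𝓝 (∫ t in openInterval μ₁ μ₂, f t)) := by
    refine tendsto_integral_of_dominated_convergence (fun t : ℝ => ‖f t‖)
      (fun n => (J₀ _ (hεn n).le).aestronglyMeasurable) hi₀.norm (fun n => ?_) ?_
    · refine Eventually.of_forall fun t => ?_
      rw [norm_mul]
      exact mul_le_of_le_one_right (norm_nonneg _) (hψ1 _ (hεn n).le t (by simp))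
    · refine Eventually.of_forall fun t => ?_
      simpa using (hψlim t).const_mul (f t)
  have L₁ : Tendsto (fun n : ℕ => ∫ t in openInterval μ₁ μ₂,
      deriv g t * (f (g t) * ψ (1 / ((n : ℝ) + 1)) (g t))) atTop
      (𝓝 (∫ t in openInterval μ₁ μ₂, deriv g t * f (g t))) := by
    refine tendsto_integral_of_dominated_convergence (fun t : ℝ => ‖deriv g t * f (g t)‖)
      (fun n => (J₁ _ (hεn n).le).aestronglyMeasurable) hi₁.norm (fun n => ?_) ?_
    · refine (ae_restrict_iff' hm).2 (Eventually.of_forall fun t ht => ?_)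
      rw [← mul_assoc, norm_mul]
      exact mul_le_of_le_one_right (norm_nonneg _) (hψ1 _ (hεn n).le (g t) (him t ht))
    · refine Eventually.of_forall fun t => ?_
      simpa using ((hψlim (g t)).const_mul (f (g t))).const_mul (deriv g t)
  exact tendsto_nhds_unique L₀ (L₁.congr fun n => (key _ (hεn n)).symm)

theorem analyticAt_conj_conj {f : ℂ → ℂ} {z : ℂ} (hf : AnalyticAt ℂ f ((starRingEnd ℂ) z)) :
    AnalyticAt ℂ (fun w => (starRingEnd ℂ) (f ((starRingEnd ℂ) w))) z := by
  rw [Complex.analyticAt_iff_eventually_differentiableAt]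
  have h1 := Complex.continuous_conj.continuousAt.eventually hf.eventually_analyticAt
  filter_upwards [h1] with w hw
  have := hw.differentiableAt.conj_conj
  rwa [Complex.conj_conj] at this

theorem IsContour.conj {μ₁ μ₂ : EReal} {D : Set ℂ} {g : ℝ → ℂ} (hg : IsContour μ₁ μ₂ D g) :
    IsContour μ₁ μ₂ {z | (starRingEnd ℂ) z ∈ D} (fun t => (starRingEnd ℂ) (g t)) where
  injOn := fun x hx y hy hxy => hg.injOn hx hy ((starRingEnd ℂ).injective hxy)
  locallyLipschitzOn := by
    intro x hx
    obtain ⟨K, t, ht, hK⟩ := hg.locallyLipschitzOn hx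
    refine ⟨K, t, ht, fun a ha b hb => ?_⟩
    rw [show edist ((starRingEnd ℂ) (g a)) ((starRingEnd ℂ) (g b)) = edist (g a) (g b) from
      Complex.isometry_conj.edist_eq _ _]
    exact hK ha hb
  deformation := by
    obtain ⟨h, hc, h0, h1, hD, hL, hR, hB, hT⟩ := hg.deformation
    refine ⟨fun s t => (starRingEnd ℂ) (h s t), Complex.continuous_conj.comp_continuousOn hc,
      fun t ht => by simp only [h0 t ht, Complex.conj_ofReal],
      fun t ht => by simp only [h1 t ht],
      fun s hs t ht => ?_, fun c hc => ?_, fun c hc => ?_, fun h R => ?_, fun h R => ?_⟩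
    · change (starRingEnd ℂ) ((starRingEnd ℂ) (h s t)) ∈ D
      rw [Complex.conj_conj]; exact hD s hs t ht
    · have := hL c hc
      rw [Metric.tendstoUniformlyOn_iff] at this ⊢
      intro ε hε
      filter_upwards [this ε hε] with t ht s hs
      rw [← Complex.conj_ofReal, Complex.isometry_conj.dist_eq]
      exact ht s hs
    · have := hR c hc
      rw [Metric.tendstoUniformlyOn_iff] at this ⊢
      intro ε hε
      filter_upwards [this ε hε] with t ht s hs
      rw [← Complex.conj_ofReal, Complex.isometry_conj.dist_eq]
      exact ht s hs
    · filter_upwards [hB h R] with t ht s hs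
      rw [RCLike.norm_conj]; exact ht s hs
    · filter_upwards [hT h R] with t ht s hs
      rw [RCLike.norm_conj]; exact ht s hs

/-- The deformation of an interval into a domain in the lower or in the upper half-plane. -/
theorem contour_integral_eq_sheet {μ₁ μ₂ : EReal} (hμ : μ₁ < μ₂) {D : Set ℂ} (hDo : IsOpen D)
    (hDs : IsSimplyConnected D) (hDl : ∀ z ∈ D, z.im < 0) {l : ℤˣ} {g : ℝ → ℂ}
    (hg : IsContour μ₁ μ₂ (sheetDomain D l) g) {f : ℂ → ℂ}
    (hf : AnalyticOnNhd ℂ f (Complex.ofReal '' openInterval μ₁ μ₂ ∪ sheetDomain D l))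
    (hend : ∀ c : ℝ, ((c : EReal) = μ₁ ∨ (c : EReal) = μ₂) → ∃ C : ℝ, ∃ γ > (-1 : ℝ), ∃ δ > 0,
      ∀ z ∈ sheetDomain D l, ‖z - c‖ < δ → ‖f z‖ ≤ C * ‖z - c‖ ^ γ)
    (hinf : (μ₁ = ⊥ ∨ μ₂ = ⊤) → ∃ C : ℝ, ∃ N : ℕ, ∃ R : ℝ, ∀ z ∈ sheetDomain D l, R < ‖z‖ →
      ‖f z‖ ≤ C * ‖z‖ ^ N)
    (hi₀ : IntegrableOn (fun t : ℝ => f t) (openInterval μ₁ μ₂))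
    (hi₁ : IntegrableOn (fun t : ℝ => deriv g t * f (g t)) (openInterval μ₁ μ₂)) :
    ∫ t in openInterval μ₁ μ₂, f t = ∫ t in openInterval μ₁ μ₂, deriv g t * f (g t) := by
  unfold sheetDomain at hg hf hend hinf
  split_ifs at hg hf hend hinf
  · exact contour_integral_eq_of_growth hμ hDo hDs hDl hg hf hend hinf hi₀ hi₁
  · have hg' := hg.conj
    have hDD : {z : ℂ | (starRingEnd ℂ) z ∈ {z : ℂ | (starRingEnd ℂ) z ∈ D}} = D := by
      ext z; simp
    rw [hDD] at hg'
    have hcD : ∀ z ∈ D, (starRingEnd ℂ) z ∈ {z : ℂ | (starRingEnd ℂ) z ∈ D} := fun z hz => by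
      simpa using hz
    have hderiv : ∀ t, deriv (fun t => (starRingEnd ℂ) (g t)) t = (starRingEnd ℂ) (deriv g t) :=
      fun t => deriv.star
    have hi₁' : ∀ t, deriv (fun t => (starRingEnd ℂ) (g t)) t *
        (starRingEnd ℂ) (f ((starRingEnd ℂ) ((starRingEnd ℂ) (g t)))) =
        (starRingEnd ℂ) (deriv g t * f (g t)) := fun t => by
      rw [hderiv, Complex.conj_conj, map_mul]
    have := contour_integral_eq_of_growth hμ hDo hDs hDl hg'
      (f := fun w => (starRingEnd ℂ) (f ((starRingEnd ℂ) w))) ?_ ?_ ?_ ?_ ?_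
    · simp only [Complex.conj_ofReal, hi₁', integral_conj] at this
      exact (starRingEnd ℂ).injective this
    · rintro z hz
      refine analyticAt_conj_conj (hf _ ?_)
      rcases hz with ⟨t, ht, rfl⟩ | hz
      · rw [Complex.conj_ofReal]; exact Or.inl ⟨t, ht, rfl⟩
      · exact Or.inr (hcD z hz)
    · intro c hc
      obtain ⟨C, γ, hγ, δ, hδ, H⟩ := hend c hc
      refine ⟨C, γ, hγ, δ, hδ, fun z hz hzc => ?_⟩
      have e : ‖(starRingEnd ℂ) z - c‖ = ‖z - c‖ := by
        rw [← RCLike.norm_conj (z - c), map_sub, Complex.conj_ofReal]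
      have := H _ (hcD z hz) (by rwa [e])
      rwa [e, ← RCLike.norm_conj] at this
    · intro hi
      obtain ⟨C, N, R, H⟩ := hinf hi
      refine ⟨C, N, R, fun z hz hzR => ?_⟩
      have := H _ (hcD z hz) (by rwa [RCLike.norm_conj])
      rwa [RCLike.norm_conj, ← RCLike.norm_conj] at this
    · simp only [Complex.conj_ofReal]
      exact Complex.conjLIE.toContinuousLinearEquiv.toContinuousLinearMap.integrable_comp hi₀
    · simp only [hi₁']
      exact Complex.conjLIE.toContinuousLinearEquiv.toContinuousLinearMap.integrable_comp hi₁

end BlockRiccati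

namespace BlockRiccati

/-! ## Spectral measures -/

section SpectralLemmas

variable {H : Type*} [NormedAddCommGroup H] [InnerProductSpace ℂ H] [CompleteSpace H]

namespace SpectralMeasure

variable (E : SpectralMeasure H)

theorem proj_proj {s t : Set ℝ} (hs : MeasurableSet s) (ht : MeasurableSet t) (x : H) :
    E.proj s (E.proj t x) = E.proj (s ∩ t) x := by
  rw [E.inter s t hs ht]; rfl

theorem proj_self {s : Set ℝ} (hs : MeasurableSet s) (x : H) :
    E.proj s (E.proj s x) = E.proj s x := by
  rw [E.proj_proj hs hs, inter_self]

theorem inner_proj_left {s : Set ℝ} (hs : MeasurableSet s) (x y : H) :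
    inner ℂ (E.proj s x) y = inner ℂ x (E.proj s y) :=
  ContinuousLinearMap.isSelfAdjoint_iff_isSymmetric.mp (E.isStarProjection s hs).isSelfAdjoint x y

theorem inner_proj_self {s : Set ℝ} (hs : MeasurableSet s) (x : H) :
    inner ℂ x (E.proj s x) = ((‖E.proj s x‖ ^ 2 : ℝ) : ℂ) := by
  rw [← E.proj_self hs, ← E.inner_proj_left hs, inner_self_eq_norm_sq_to_K, E.proj_self hs]
  simp

theorem inner_proj_proj_of_disjoint {s t : Set ℝ} (hs : MeasurableSet s) (ht : MeasurableSet t)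
    (hst : Disjoint s t) (x y : H) : inner ℂ (E.proj s x) (E.proj t y) = 0 := by
  rw [E.inner_proj_left hs, E.proj_proj hs ht, hst.inter_eq, E.empty]
  simp

theorem norm_proj_le {s : Set ℝ} (hs : MeasurableSet s) (x : H) : ‖E.proj s x‖ ≤ ‖x‖ := by
  rcases (norm_nonneg (E.proj s x)).eq_or_lt with h | h
  · rw [← h]; exact norm_nonneg _
  · have h1 : ‖E.proj s x‖ ^ 2 ≤ ‖x‖ * ‖E.proj s x‖ := by
      have := norm_inner_le_norm (𝕜 := ℂ) x (E.proj s x)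
      rw [E.inner_proj_self hs, Complex.norm_real, Real.norm_of_nonneg (by positivity)] at this
      exact this
    rw [sq] at h1
    exact le_of_mul_le_mul_right h1 h

theorem proj_union {s t : Set ℝ} (hs : MeasurableSet s) (ht : MeasurableSet t)
    (hst : Disjoint s t) (x : H) : E.proj (s ∪ t) x = E.proj s x + E.proj t x := by
  have h1 : ∀ u : Set ℝ, MeasurableSet u → ∀ y : H, inner ℂ y (E.proj u y) =
      ((‖E.proj u y‖ ^ 2 : ℝ) : ℂ) := fun u hu y => E.inner_proj_self hu y
  let f : ℕ → Set ℝ := fun n => if n = 0 then s else if n = 1 then t else ∅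
  have hf : ∀ i, MeasurableSet (f i) := by
    intro i
    simp only [f]
    split_ifs
    exacts [hs, ht, MeasurableSet.empty]
  have hd : Pairwise (Function.onFun Disjoint f) := by
    intro i j hij
    simp only [f, Function.onFun]
    split_ifs with h1 h2 h3 h4
    all_goals first
      | exact absurd (h1.trans h2.symm) hij
      | exact hst
      | exact hst.symm
      | exact disjoint_bot_left
      | exact disjoint_bot_right
      | skip
    all_goals omega
  have hU : ⋃ i, f i = s ∪ t := by
    ext y
    simp only [mem_iUnion, f, mem_union]
    constructor
    · rintro ⟨i, hi⟩
      split_ifs at hi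
      · exact Or.inl hi
      · exact Or.inr hi
      · exact hi.elim
    · rintro (h | h)
      · exact ⟨0, by simpa using h⟩
      · exact ⟨1, by simpa using h⟩
  have hsum := E.iUnion f hf hd x
  rw [hU] at hsum
  have hsum2 : HasSum (fun i => E.proj (f i) x) (∑ i ∈ Finset.range 2, E.proj (f i) x) := by
    refine hasSum_sum_of_ne_finset_zero fun i hi => ?_
    have h0 : i ≠ 0 := by rintro rfl; simp at hi
    have h1 : i ≠ 1 := by rintro rfl; simp at hi
    simp [f, h0, h1, E.empty]
  rw [hsum.unique hsum2]
  simp [Finset.sum_range_succ, f]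

theorem proj_compl {s : Set ℝ} (hs : MeasurableSet s) (x : H) :
    E.proj sᶜ x = x - E.proj s x := by
  have := E.proj_union hs hs.compl disjoint_compl_right x
  rw [union_compl_self, E.univ] at this
  rw [eq_sub_iff_add_eq', ← this]; rfl

theorem proj_Ico_add {a b c : ℝ} (hab : a ≤ b) (hbc : b ≤ c) (x : H) :
    E.proj (Ico a b) x + E.proj (Ico b c) x = E.proj (Ico a c) x := by
  rw [← E.proj_union measurableSet_Ico measurableSet_Ico, Ico_union_Ico_eq_Ico hab hbc]
  rw [Set.disjoint_left]
  exact fun t h1 h2 => not_le.2 h1.2 h2.1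

theorem norm_proj_mono {s t : Set ℝ} (hs : MeasurableSet s) (ht : MeasurableSet t) (hst : s ⊆ t)
    (x : H) : ‖E.proj s x‖ ≤ ‖E.proj t x‖ := by
  have : E.proj s x = E.proj s (E.proj t x) := by
    rw [E.proj_proj hs ht, inter_eq_self_of_subset_left hst]
  rw [this]
  exact E.norm_proj_le hs _

theorem scalar_apply {s : Set ℝ} (hs : MeasurableSet s) (x : H) :
    E.scalar x s = ENNReal.ofReal (‖E.proj s x‖ ^ 2) := by
  rw [SpectralMeasure.scalar, Measure.ofMeasurable_apply s hs, E.inner_proj_self hs,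
    Complex.ofReal_re]

theorem scalar_univ (x : H) : E.scalar x Set.univ = ENNReal.ofReal (‖x‖ ^ 2) := by
  rw [E.scalar_apply MeasurableSet.univ, E.univ]; rfl

instance isFiniteMeasure_scalar (x : H) : IsFiniteMeasure (E.scalar x) :=
  ⟨by rw [E.scalar_univ]; exact ENNReal.ofReal_lt_top⟩

theorem measureReal_univ_scalar (x : H) : (E.scalar x).real Set.univ = ‖x‖ ^ 2 := by
  rw [Measure.real, E.scalar_univ, ENNReal.toReal_ofReal (by positivity)]

theorem proj_eq_zero_iff {s : Set ℝ} (hs : MeasurableSet s) (x : H) :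
    E.proj s x = 0 ↔ E.scalar x s = 0 := by
  rw [E.scalar_apply hs, ENNReal.ofReal_eq_zero]
  constructor
  · intro h; rw [h]; simp
  · intro h
    have : ‖E.proj s x‖ ^ 2 = 0 := le_antisymm h (by positivity)
    simpa using this

theorem scalar_proj_compl {s : Set ℝ} (hs : MeasurableSet s) (x : H) :
    E.scalar (E.proj s x) sᶜ = 0 := by
  rw [← E.proj_eq_zero_iff hs.compl, E.proj_proj hs.compl hs, compl_inter_self, E.empty]; rfl

/-- The vectors belong to complementary spectral subspaces, which every `E.proj u` preserves, so
Pythagoras applies on every measurable set. -/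
theorem scalar_add {s : Set ℝ} (hs : MeasurableSet s) {x y : H} (hx : E.proj s x = 0)
    (hy : E.proj s y = y) : E.scalar (x + y) = E.scalar x + E.scalar y := by
  ext u hu
  rw [Measure.add_apply, E.scalar_apply hu, E.scalar_apply hu, E.scalar_apply hu,
    ← ENNReal.ofReal_add (by positivity) (by positivity)]
  congr 1
  have h0 : inner ℂ (E.proj u x) (E.proj u y) = 0 := by
    rw [E.inner_proj_left hu, E.proj_self hu, ← hy, E.proj_proj hu hs, inter_comm,
      ← E.proj_proj hs hu, ← E.inner_proj_left hs, hx, inner_zero_left]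
  have := norm_add_sq_eq_norm_sq_add_norm_sq_of_inner_eq_zero _ _ h0
  rw [map_add, sq, sq, sq]
  exact this

/-- The vectors `E([s,t)) x` are uniformly small if `t - s` is small and the spectral measure is
absolutely continuous. -/
theorem exists_norm_proj_Ico_lt (hac : ∀ x : H, E.scalar x ≪ volume) (x : H) {ε : ℝ} (hε : 0 < ε) :
    ∃ δ > 0, ∀ s t : ℝ, t - s < δ → ‖E.proj (Ico s t) x‖ < ε := by
  set φ := (E.scalar x).rnDeriv volume
  have hφ : (volume : Measure ℝ).withDensity φ = E.scalar x :=
    Measure.withDensity_rnDeriv_eq _ _ (hac x)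
  have hfin : ∫⁻ t, φ t ≠ ∞ := by
    rw [← setLIntegral_univ, ← withDensity_apply _ MeasurableSet.univ, hφ]
    exact measure_ne_top _ _
  obtain ⟨δ, hδ, H⟩ := exists_pos_setLIntegral_lt_of_measure_lt hfin
    (ε := ENNReal.ofReal (ε ^ 2)) (by simpa using by positivity)
  obtain ⟨δ', hδ'0, hδ'⟩ : ∃ δ' : ℝ, 0 < δ' ∧ ENNReal.ofReal δ' ≤ δ := by
    rcases eq_or_ne δ ⊤ with rfl | htop
    · exact ⟨1, one_pos, le_top⟩
    · exact ⟨δ.toReal, ENNReal.toReal_pos hδ.ne' htop, ENNReal.ofReal_toReal_le⟩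
  refine ⟨δ', hδ'0, fun s t hst => ?_⟩
  have h1 := H (Ico s t) (by
    rw [Real.volume_Ico]
    exact ((ENNReal.ofReal_lt_ofReal_iff hδ'0).2 hst).trans_le hδ')
  rw [← withDensity_apply _ measurableSet_Ico, hφ, E.scalar_apply measurableSet_Ico,
    ENNReal.ofReal_lt_ofReal_iff (by positivity)] at h1
  exact lt_of_pow_lt_pow_left₀ 2 hε.le h1

end SpectralMeasure

theorem inner_apply_comm_of_isSelfAdjoint {A : H →ₗ.[ℂ] H} (hA : IsSelfAdjoint A)
    {x y : H} (hx : x ∈ A.domain) (hy : y ∈ A.domain) :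
    inner ℂ (A ⟨x, hx⟩) y = inner ℂ x (A ⟨y, hy⟩) := by
  have h := LinearPMap.adjoint_isFormalAdjoint hA.dense_domain
  rw [LinearPMap.isSelfAdjoint_def.1 hA] at h
  exact h ⟨x, hx⟩ ⟨y, hy⟩

namespace IsSpectralMeasureOf

variable {E : SpectralMeasure H} {A : H →ₗ.[ℂ] H} (hE : IsSpectralMeasureOf E A)

include hE

theorem integrable_id {x : H} (hx : x ∈ A.domain) : Integrable (fun t : ℝ => t) (E.scalar x) := by
  have h2 : Integrable (fun t : ℝ => t ^ 2) (E.scalar x) := by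
    refine ⟨by fun_prop, ?_⟩
    have := (hE.mem_domain_iff x).1 hx
    rw [hasFiniteIntegral_iff_norm]
    simpa using this
  refine ((integrable_const (1 : ℝ)).add h2).mono' (by fun_prop) (Eventually.of_forall fun t => ?_)
  simp only [Pi.add_apply, Real.norm_eq_abs]
  nlinarith [abs_nonneg t, sq_abs t, sq_nonneg (|t| - 1)]

theorem proj_mem_domain {s : Set ℝ} (hs : MeasurableSet s) {ξ η : ℝ}
    (hsub : ∀ t ∈ s, |t - ξ| ≤ η) (x : H) : E.proj s x ∈ A.domain := by
  rw [hE.mem_domain_iff]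
  have hae : ∀ᵐ t ∂(E.scalar (E.proj s x)), t ∈ s := by
    rw [ae_iff]; exact E.scalar_proj_compl hs x
  calc ∫⁻ t, ENNReal.ofReal (t ^ 2) ∂(E.scalar (E.proj s x))
      ≤ ∫⁻ _, ENNReal.ofReal ((|ξ| + η) ^ 2) ∂(E.scalar (E.proj s x)) := by
        refine lintegral_mono_ae ?_
        filter_upwards [hae] with t ht
        refine ENNReal.ofReal_le_ofReal ?_
        have h1 := hsub t ht
        have h2 : |t| ≤ |ξ| + η := by
          have := abs_add_le (t - ξ) ξ
          simp only [sub_add_cancel] at this; linarith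
        rw [← sq_abs t]
        gcongr
    _ < ⊤ := by
      rw [lintegral_const]
      exact ENNReal.mul_lt_top ENNReal.ofReal_lt_top (measure_lt_top _ _)

/-- The operator `A` has no matrix elements between the range of a spectral projection and its
complement. -/
theorem inner_eq_zero_of_proj {s : Set ℝ} (hs : MeasurableSet s) {x y : H} (hx : x ∈ A.domain)
    (hy : y ∈ A.domain) (hxs : E.proj s x = 0) (hys : E.proj s y = y) :
    inner ℂ x (A ⟨y, hy⟩) = 0 := by
  -- Additivity of the scalar measures makes the quadratic form of `A` additive on `x + y'`, so the
  -- sum of the cross terms is zero.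
  have add : ∀ y' (hy' : y' ∈ A.domain), E.proj s y' = y' →
      inner ℂ x (A ⟨y', hy'⟩) + inner ℂ y' (A ⟨x, hx⟩) = 0 := by
    intro y' hy' hys'
    have h1 := hE.inner_eq ⟨x + y', A.domain.add_mem hx hy'⟩
    have h2 := hE.inner_eq ⟨x, hx⟩
    have h3 := hE.inner_eq ⟨y', hy'⟩
    have h4 : A ⟨x + y', A.domain.add_mem hx hy'⟩ = A ⟨x, hx⟩ + A ⟨y', hy'⟩ :=
      A.map_add ⟨x, hx⟩ ⟨y', hy'⟩
    rw [h4] at h1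
    simp only [inner_add_left, inner_add_right] at h1
    rw [E.scalar_add hs hxs hys', integral_add_measure (hE.integrable_id hx)
      (hE.integrable_id hy'), Complex.ofReal_add, ← h2, ← h3] at h1
    linear_combination h1
  have a1 := add y hy hys
  -- With p = ⟪x, A y⟫ and q = ⟪y, A x⟫, the vector `y` gives p + q = 0 and `I • y` gives i(p - q) =
  -- 0; hence p = 0.
  have hIy : Complex.I • y ∈ A.domain := A.domain.smul_mem _ hy
  have a2 := add (Complex.I • y) hIy (by rw [map_smul, hys])
  have h5 : A ⟨Complex.I • y, hIy⟩ = Complex.I • A ⟨y, hy⟩ := A.map_smul Complex.I ⟨y, hy⟩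
  rw [h5, inner_smul_right, inner_smul_left, Complex.conj_I] at a2
  have a3 : Complex.I * (2 * inner ℂ x (A ⟨y, hy⟩)) = 0 := by
    linear_combination a2 + Complex.I * a1
  simpa using a3

/-- The range of a spectral projection is invariant. -/
theorem proj_apply_of_proj_eq (hA : IsSelfAdjoint A) {s : Set ℝ} (hs : MeasurableSet s) {ξ η : ℝ}
    (hsub : ∀ t ∈ s, |t - ξ| ≤ η) {x : H} (hx : x ∈ A.domain) (hxs : E.proj s x = x) :
    E.proj s (A ⟨x, hx⟩) = A ⟨x, hx⟩ := by
  rw [← sub_eq_zero]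
  refine hA.dense_domain.eq_zero_of_inner_right ℂ fun y hy => ?_
  have hy' := hE.proj_mem_domain hs hsub y
  have h := hE.inner_eq_zero_of_proj hs (A.domain.sub_mem hy hy') hx
    (by rw [map_sub, E.proj_self hs, sub_self]) hxs
  rw [inner_sub_left, E.inner_proj_left hs] at h
  rw [inner_sub_right]
  linear_combination -h

/-- The scalar measure of `x` has mass ‖x‖² and is carried by `s`, and the form of A - ξ is the
integral of t - ξ against it. -/
theorem abs_inner_sub_le {s : Set ℝ} (hs : MeasurableSet s) {ξ η : ℝ}
    (hsub : ∀ t ∈ s, |t - ξ| ≤ η) {x : H} (hx : x ∈ A.domain) (hxs : E.proj s x = x) :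
    |(inner ℂ x (A ⟨x, hx⟩ - (ξ : ℂ) • x)).re| ≤ η * ‖x‖ ^ 2 := by
  have hae : ∀ᵐ t ∂(E.scalar x), t ∈ s := by
    rw [ae_iff, ← hxs]; exact E.scalar_proj_compl hs x
  have h1 : (inner ℂ x (A ⟨x, hx⟩ - (ξ : ℂ) • x)).re = ∫ t, (t - ξ) ∂(E.scalar x) := by
    rw [integral_sub (hE.integrable_id hx) (integrable_const ξ), integral_const,
      E.measureReal_univ_scalar, inner_sub_right, inner_smul_right, hE.inner_eq ⟨x, hx⟩,
      inner_self_eq_norm_sq_to_K]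
    have : (ξ : ℂ) * ((‖x‖ : ℝ) : ℂ) ^ 2 = ((ξ * ‖x‖ ^ 2 : ℝ) : ℂ) := by push_cast; ring
    simp only [Complex.coe_algebraMap, this, Complex.sub_re, Complex.ofReal_re, smul_eq_mul]
    ring
  rw [h1, ← Real.norm_eq_abs, ← E.measureReal_univ_scalar x]
  exact norm_integral_le_of_norm_le_const (hae.mono hsub)

/-- On the spectral subspace of a set within distance `η` of `ξ`, the operator `A` is within
distance `η` of `ξ`. -/
theorem norm_apply_sub_le (hA : IsSelfAdjoint A) {s : Set ℝ} (hs : MeasurableSet s) {ξ η : ℝ}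
    (hsub : ∀ t ∈ s, |t - ξ| ≤ η) {x : H} (hx : x ∈ A.domain) (hxs : E.proj s x = x) :
    ‖A ⟨x, hx⟩ - (ξ : ℂ) • x‖ ≤ η * ‖x‖ := by
  set w := A ⟨x, hx⟩ - (ξ : ℂ) • x with hw
  have hws : E.proj s w = w := by
    rw [hw, map_sub, map_smul, hE.proj_apply_of_proj_eq hA hs hsub hx hxs, hxs]
  rcases (norm_nonneg w).eq_or_lt with h0 | hwpos
  · rw [← h0]
    rcases (norm_nonneg x).eq_or_lt with hx0 | hxpos
    · rw [← hx0, mul_zero]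
    · have := (abs_nonneg _).trans (hE.abs_inner_sub_le hs hsub hx hxs)
      nlinarith [pow_pos hxpos 2]
  -- The form bound for x + τw and x - τw is polarized with the symmetry of `A`; the parallelogram
  -- law evaluates the right-hand side.
  have key : ∀ τ : ℝ, 2 * τ * ‖w‖ ^ 2 ≤ η * (‖x‖ ^ 2 + τ ^ 2 * ‖w‖ ^ 2) := by
    intro τ
    set y := (τ : ℂ) • w with hy
    have hwd : w ∈ A.domain := by rw [← hws]; exact hE.proj_mem_domain hs hsub w
    have hyd : y ∈ A.domain := A.domain.smul_mem _ hwd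
    have hys : E.proj s y = y := by rw [hy, map_smul, hws]
    have hp := (abs_le.1 (hE.abs_inner_sub_le hs hsub (A.domain.add_mem hx hyd)
      (by rw [map_add, hxs, hys]))).2
    have hm := (abs_le.1 (hE.abs_inner_sub_le hs hsub (A.domain.sub_mem hx hyd)
      (by rw [map_sub, hxs, hys]))).1
    have e1 : A ⟨x + y, A.domain.add_mem hx hyd⟩ = A ⟨x, hx⟩ + A ⟨y, hyd⟩ :=
      A.map_add ⟨x, hx⟩ ⟨y, hyd⟩
    have e2 : A ⟨x - y, A.domain.sub_mem hx hyd⟩ = A ⟨x, hx⟩ - A ⟨y, hyd⟩ :=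
      A.map_sub ⟨x, hx⟩ ⟨y, hyd⟩
    have e3 : (inner ℂ y w).re = τ * ‖w‖ ^ 2 := by
      rw [hy, inner_smul_left, inner_self_eq_norm_sq_to_K]
      have : (starRingEnd ℂ) (τ : ℂ) * ((‖w‖ : ℝ) : ℂ) ^ 2 = ((τ * ‖w‖ ^ 2 : ℝ) : ℂ) := by
        rw [Complex.conj_ofReal]; push_cast; ring
      simp only [Complex.coe_algebraMap, this, Complex.ofReal_re]
    have e4 : (inner ℂ x (A ⟨y, hyd⟩ - (ξ : ℂ) • y)).re = τ * ‖w‖ ^ 2 := by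
      have : inner ℂ x (A ⟨y, hyd⟩ - (ξ : ℂ) • y) = inner ℂ w y := by
        rw [hw, inner_sub_left, inner_sub_right, inner_apply_comm_of_isSelfAdjoint hA hx hyd,
          inner_smul_left, inner_smul_right, Complex.conj_ofReal]
      rw [this, ← e3]
      exact inner_re_symm (𝕜 := ℂ) w y
    have e5 : ‖x + y‖ ^ 2 + ‖x - y‖ ^ 2 = 2 * (‖x‖ ^ 2 + τ ^ 2 * ‖w‖ ^ 2) := by
      have h := parallelogram_law_with_norm ℂ x y
      have hn : ‖y‖ ^ 2 = τ ^ 2 * ‖w‖ ^ 2 := by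
        rw [hy, norm_smul, Complex.norm_real, Real.norm_eq_abs, ← sq_abs τ]; ring
      rw [h, hn]
    have f1 : A ⟨x + y, A.domain.add_mem hx hyd⟩ - (ξ : ℂ) • (x + y) =
        w + (A ⟨y, hyd⟩ - (ξ : ℂ) • y) := by rw [e1, hw, smul_add]; abel
    have f2 : A ⟨x - y, A.domain.sub_mem hx hyd⟩ - (ξ : ℂ) • (x - y) =
        w - (A ⟨y, hyd⟩ - (ξ : ℂ) • y) := by rw [e2, hw, smul_sub]; abel
    rw [f1] at hp
    rw [f2] at hm
    simp only [inner_add_left, inner_add_right, inner_sub_left, inner_sub_right, Complex.add_re,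
      Complex.sub_re] at hp hm e4
    have e6 : η * ‖x + y‖ ^ 2 + η * ‖x - y‖ ^ 2 = 2 * (η * (‖x‖ ^ 2 + τ ^ 2 * ‖w‖ ^ 2)) := by
      rw [← mul_add, e5]; ring
    linarith
  -- This τ balances the two terms on the right and yields 2‖x‖‖w‖ ≤ 2η‖x‖².
  have := key (‖x‖ / ‖w‖)
  have e : (‖x‖ / ‖w‖) ^ 2 * ‖w‖ ^ 2 = ‖x‖ ^ 2 := by field_simp
  have e' : 2 * (‖x‖ / ‖w‖) * ‖w‖ ^ 2 = 2 * ‖x‖ * ‖w‖ := by field_simp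
  rw [e, e'] at this
  rcases (norm_nonneg x).eq_or_lt with hx0 | hxpos
  · exfalso
    have hxz : x = 0 := norm_eq_zero.1 hx0.symm
    have : w = 0 := by
      rw [hw]
      have : (⟨x, hx⟩ : A.domain) = 0 := Subtype.ext hxz
      rw [this, A.map_zero, hxz]; simp
    rw [this, norm_zero] at hwpos
    exact lt_irrefl _ hwpos
  · nlinarith

theorem norm_inner_proj_sub_le (hA : IsSelfAdjoint A) {s : Set ℝ} (hs : MeasurableSet s) {ξ η : ℝ}
    (hsub : ∀ t ∈ s, |t - ξ| ≤ η) {x : H} (hx : x ∈ A.domain) (v : H) :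
    ‖inner ℂ (A ⟨x, hx⟩) (E.proj s v) - ξ * inner ℂ x (E.proj s v)‖ ≤
      η * (‖E.proj s x‖ * ‖E.proj s v‖) := by
  have hvd := hE.proj_mem_domain hs hsub v
  have e : inner ℂ (A ⟨x, hx⟩) (E.proj s v) - ξ * inner ℂ x (E.proj s v) =
      inner ℂ (E.proj s x) (A ⟨E.proj s v, hvd⟩ - (ξ : ℂ) • E.proj s v) := by
    rw [inner_apply_comm_of_isSelfAdjoint hA hx hvd, inner_sub_right, E.inner_proj_left hs,
      hE.proj_apply_of_proj_eq hA hs hsub hvd (E.proj_self hs v), inner_smul_right,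
      E.inner_proj_left hs, E.proj_self hs]
  rw [e]
  refine (norm_inner_le_norm _ _).trans ?_
  have := hE.norm_apply_sub_le hA hs hsub hvd (E.proj_self hs v)
  calc _ ≤ ‖E.proj s x‖ * (η * ‖E.proj s v‖) := by gcongr
    _ = _ := by ring

/-- At a point `t` off the spectrum A - t has a bounded left inverse `R`, whereas on the spectral
subspace of an interval of radius η about `t` its norm is at most η. The choice of η gives ‖R‖η ≤
1/2, so this subspace is zero; locally null sets are null. -/
theorem scalar_compl_eq_zero (hA : IsSelfAdjoint A) {S : Set ℝ}
    (hσ : unboundedSpectrum A ⊆ Complex.ofReal '' S) (x : H) : E.scalar x Sᶜ = 0 := by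
  refine measure_null_of_locally_null _ fun t ht => ?_
  have h1 : (t : ℂ) ∉ unboundedSpectrum A := by
    intro h
    obtain ⟨t', ht', he⟩ := hσ h
    rw [Complex.ofReal_inj] at he
    exact ht (he ▸ ht')
  simp only [unboundedSpectrum, mem_ofPred_eq, not_not] at h1
  obtain ⟨R, -, hR⟩ := h1
  set η : ℝ := 1 / (2 * (‖R‖ + 1)) with hη
  have hηpos : 0 < η := by positivity
  refine ⟨Ioo (t - η) (t + η), mem_nhdsWithin_of_mem_nhds (Ioo_mem_nhds (by linarith)
    (by linarith)), ?_⟩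
  rw [← E.proj_eq_zero_iff measurableSet_Ioo]
  have hsub : ∀ s ∈ Ioo (t - η) (t + η), |s - t| ≤ η := fun s hs => by
    rw [abs_le]; constructor <;> linarith [hs.1, hs.2]
  set y := E.proj (Ioo (t - η) (t + η)) x with hy
  have hyd : y ∈ A.domain := hE.proj_mem_domain measurableSet_Ioo hsub x
  have h2 := hE.norm_apply_sub_le hA measurableSet_Ioo hsub hyd (E.proj_self measurableSet_Ioo x)
  have h3 : ‖y‖ ≤ ‖R‖ * (η * ‖y‖) := by
    calc ‖y‖ = ‖R (A ⟨y, hyd⟩ - (t : ℂ) • y)‖ := by rw [hR ⟨y, hyd⟩]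
      _ ≤ _ := (R.le_opNorm _).trans (by gcongr)
  have h4 : ‖R‖ * η ≤ 1 / 2 := by
    rw [hη, mul_one_div, div_le_div_iff₀ (by positivity) (by norm_num)]
    linarith [norm_nonneg R]
  have h5 : ‖y‖ ≤ 0 := by nlinarith [norm_nonneg y]
  exact norm_le_zero_iff.1 h5

end IsSpectralMeasureOf

theorem frontier_openInterval_finite (μ₁ μ₂ : EReal) :
    (closure (openInterval μ₁ μ₂) \ openInterval μ₁ μ₂).Finite := by
  refine Set.Finite.subset (s := {μ₁.toReal, μ₂.toReal}) (by simp) fun t ht => ?_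
  have h1 : closure (openInterval μ₁ μ₂) ⊆ {t : ℝ | μ₁ ≤ (t : EReal) ∧ (t : EReal) ≤ μ₂} := by
    refine closure_minimal (fun t h => ⟨h.1.le, h.2.le⟩) ?_
    exact (isClosed_le continuous_const continuous_coe_real_ereal).inter
      (isClosed_le continuous_coe_real_ereal continuous_const)
  obtain ⟨h2, h3⟩ := h1 ht.1
  by_contra hne
  simp only [mem_insert_iff, mem_singleton_iff, not_or] at hne
  refine ht.2 ⟨lt_of_le_of_ne h2 ?_, lt_of_le_of_ne h3 ?_⟩
  · rintro rfl; exact hne.1 (EReal.toReal_coe t).symm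
  · rintro rfl; exact hne.2 (EReal.toReal_coe t).symm

/-- The spectral measure lives on the closure of the interval, and absolute continuity discards its
finitely many end points. -/
theorem scalar_openInterval_compl {E : SpectralMeasure H} {A : H →ₗ.[ℂ] H}
    (hE : IsSpectralMeasureOf E A) (hA : IsSelfAdjoint A) {μ₁ μ₂ : EReal}
    (hac : ∀ x : H, E.scalar x ≪ volume)
    (hσ : unboundedSpectrum A = Complex.ofReal '' closure (openInterval μ₁ μ₂)) (x : H) :
    E.scalar x (openInterval μ₁ μ₂)ᶜ = 0 := by
  have h1 := hE.scalar_compl_eq_zero hA hσ.le x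
  have h2 : E.scalar x (closure (openInterval μ₁ μ₂) \ openInterval μ₁ μ₂) = 0 :=
    hac x ((frontier_openInterval_finite μ₁ μ₂).measure_zero _)
  refine measure_mono_null (fun t ht => ?_) (measure_union_null h1 h2)
  by_cases h : t ∈ closure (openInterval μ₁ μ₂)
  · exact Or.inr ⟨h, ht⟩
  · exact Or.inl h

/-- The spectral projections of an exhaustion of the interval converge strongly to the
identity. -/
theorem tendsto_proj_Ico {E : SpectralMeasure H} {μ₁ μ₂ : EReal} {x : H}
    (h0 : E.scalar x (openInterval μ₁ μ₂)ᶜ = 0) {a b : ℕ → ℝ} (ha : Antitone a) (hb : Monotone b)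
    (hab : ∀ t ∈ openInterval μ₁ μ₂, ∃ n, a n < t ∧ t < b n) :
    Tendsto (fun n => E.proj (Ico (a n) (b n)) x) atTop (𝓝 x) := by
  rw [tendsto_iff_norm_sub_tendsto_zero]
  have h1 : Tendsto (fun n => E.scalar x (Ico (a n) (b n))ᶜ) atTop (𝓝 0) := by
    have hanti : Antitone fun n => (Ico (a n) (b n))ᶜ := fun m n hmn =>
      compl_subset_compl.2 (Ico_subset_Ico (ha hmn) (hb hmn))
    have := tendsto_measure_iInter_atTop (μ := E.scalar x)
      (fun n => (measurableSet_Ico (a := a n) (b := b n)).compl.nullMeasurableSet) hanti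
      ⟨0, measure_ne_top _ _⟩
    have hz : E.scalar x (⋂ n, (Ico (a n) (b n))ᶜ) = 0 := by
      refine measure_mono_null (fun t ht => ?_) h0
      intro h
      obtain ⟨n, hn⟩ := hab t h
      exact (mem_iInter.1 ht n) ⟨hn.1.le, hn.2⟩
    rwa [hz] at this
  have h2 := (ENNReal.tendsto_toReal ENNReal.zero_ne_top).comp h1
  have h3 := h2.sqrt
  simp only [ENNReal.toReal_zero, Real.sqrt_zero] at h3
  refine h3.congr fun n => ?_
  rw [Function.comp, E.scalar_apply measurableSet_Ico.compl, ENNReal.toReal_ofReal (by positivity),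
    Real.sqrt_sq (norm_nonneg _), E.proj_compl measurableSet_Ico, norm_sub_rev]

end SpectralLemmas
end BlockRiccati

namespace BlockRiccati

/-! ## Stieltjes integrals of continuously differentiable functions -/

section Stieltjes

variable {H : Type*} [NormedAddCommGroup H] [InnerProductSpace ℂ H] [CompleteSpace H]

namespace SpectralMeasure

/-- The integral `∫_[a,b) E(dm) v(m)` of a function `v` with the derivative `v'`, defined by
integration by parts. -/
noncomputable def stieltjes (E : SpectralMeasure H) (v v' : ℝ → H) (a b : ℝ) : H :=
  E.proj (Ico a b) (v b) - ∫ m in a..b, E.proj (Ico a m) (v' m)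

variable {E : SpectralMeasure H}

/-- Absolute continuity makes `m ↦ E([a, m)) z` norm continuous for fixed `z`; contractivity of
projections takes care of the varying vector. -/
theorem continuousOn_proj_Ico (hac : ∀ x : H, E.scalar x ≪ volume) {S : Set ℝ} {w : ℝ → H}
    (hw : ContinuousOn w S) (a : ℝ) :
    ContinuousOn (fun m => E.proj (Ico a m) (w m)) (S ∩ Ici a) := by
  intro m₀ hm₀
  rw [Metric.continuousWithinAt_iff']
  intro ε hε
  obtain ⟨δ, hδ, hE⟩ := E.exists_norm_proj_Ico_lt hac (w m₀) (half_pos hε)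
  have h1 := Metric.continuousWithinAt_iff'.1 ((hw m₀ hm₀.1).mono (inter_subset_left (t := Ici a))) _
    (half_pos hε)
  have h2 : ∀ᶠ m in 𝓝[S ∩ Ici a] m₀, |m - m₀| < δ :=
    mem_nhdsWithin_of_mem_nhds (Metric.ball_mem_nhds m₀ hδ)
  filter_upwards [h1, h2, self_mem_nhdsWithin] with m hm1 hm2 hm3
  rw [dist_eq_norm] at hm1 ⊢
  have h3 : ‖E.proj (Ico a m) (w m₀) - E.proj (Ico a m₀) (w m₀)‖ < ε / 2 := by
    rcases le_total m m₀ with h | h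
    · rw [← E.proj_Ico_add hm3.2 h, sub_add_cancel_left, norm_neg]
      exact hE _ _ (by rw [abs_lt] at hm2; linarith)
    · rw [← E.proj_Ico_add hm₀.2 h, add_sub_cancel_left]
      exact hE _ _ (by rw [abs_lt] at hm2; linarith)
  have h4 : E.proj (Ico a m) (w m) - E.proj (Ico a m₀) (w m₀) = E.proj (Ico a m) (w m - w m₀) +
      (E.proj (Ico a m) (w m₀) - E.proj (Ico a m₀) (w m₀)) := by rw [map_sub]; abel
  rw [h4]
  have h5 := E.norm_proj_le (measurableSet_Ico (a := a) (b := m)) (w m - w m₀)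
  linarith [norm_add_le (E.proj (Ico a m) (w m - w m₀))
    (E.proj (Ico a m) (w m₀) - E.proj (Ico a m₀) (w m₀))]

theorem intervalIntegrable_proj_Ico (hac : ∀ x : H, E.scalar x ≪ volume) {w : ℝ → H}
    {a s t : ℝ} (has : a ≤ s) (hst : s ≤ t) (hw : ContinuousOn w (Icc s t)) :
    IntervalIntegrable (fun m => E.proj (Ico a m) (w m)) volume s t := by
  refine ContinuousOn.intervalIntegrable ?_
  rw [uIcc_of_le hst]
  exact (continuousOn_proj_Ico hac hw a).mono fun m hm => ⟨hm, has.trans hm.1⟩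

variable {S : Set ℝ} {v v' : ℝ → H}

@[simp] theorem stieltjes_self (a : ℝ) : E.stieltjes v v' a a = 0 := by
  simp [stieltjes, E.empty]

theorem proj_stieltjes (hac : ∀ x : H, E.scalar x ≪ volume) (hS : S.OrdConnected)
    (hv' : ContinuousOn v' S) {s t : ℝ} (hs : s ∈ S) (ht : t ∈ S) (hst : s ≤ t) :
    E.proj (Ico s t) (E.stieltjes v v' s t) = E.stieltjes v v' s t := by
  have hint := intervalIntegrable_proj_Ico hac le_rfl hst (hv'.mono (hS.out hs ht))
  rw [stieltjes, map_sub, E.proj_self measurableSet_Ico,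
    ← ContinuousLinearMap.intervalIntegral_comp_comm _ hint]
  congr 1
  refine intervalIntegral.integral_congr fun m hm => ?_
  rw [uIcc_of_le hst] at hm
  rw [E.proj_proj measurableSet_Ico measurableSet_Ico,
    inter_eq_self_of_subset_right (Ico_subset_Ico_right hm.2)]

/-- On [b, c] one splits E([a, m)) = E([a, b)) + E([b, m)); the constant projection is integrated by
the fundamental theorem for `v`, and the boundary terms cancel. -/
theorem stieltjes_add (hac : ∀ x : H, E.scalar x ≪ volume) (hS : S.OrdConnected)
    (hv : ∀ t ∈ S, HasDerivAt v (v' t) t) (hv' : ContinuousOn v' S) {a b c : ℝ} (ha : a ∈ S)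
    (hc : c ∈ S) (hab : a ≤ b) (hbc : b ≤ c) :
    E.stieltjes v v' a b + E.stieltjes v v' b c = E.stieltjes v v' a c := by
  have hb : b ∈ S := hS.out ha hc ⟨hab, hbc⟩
  have i1 := intervalIntegrable_proj_Ico hac le_rfl hab (hv'.mono (hS.out ha hb))
  have i2 := intervalIntegrable_proj_Ico hac le_rfl hbc (hv'.mono (hS.out hb hc))
  have i3 := intervalIntegrable_proj_Ico hac hab hbc (hv'.mono (hS.out hb hc))
  have i4 : IntervalIntegrable v' volume b c := by
    refine ContinuousOn.intervalIntegrable ?_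
    rw [uIcc_of_le hbc]; exact hv'.mono (hS.out hb hc)
  have f : ∫ m in b..c, v' m = v c - v b := by
    refine intervalIntegral.integral_eq_sub_of_hasDerivAt (fun m hm => hv m ?_) i4
    rw [uIcc_of_le hbc] at hm
    exact hS.out hb hc hm
  have e : ∫ m in b..c, E.proj (Ico a m) (v' m) =
      E.proj (Ico a b) (v c - v b) + ∫ m in b..c, E.proj (Ico b m) (v' m) := by
    rw [← f, ← ContinuousLinearMap.intervalIntegral_comp_comm _ i4,
      ← intervalIntegral.integral_add ?_ i2]
    · refine intervalIntegral.integral_congr fun m hm => ?_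
      rw [uIcc_of_le hbc] at hm
      exact (E.proj_Ico_add hab hm.1 _).symm
    · exact ⟨(E.proj (Ico a b)).integrable_comp i4.1, (E.proj (Ico a b)).integrable_comp i4.2⟩
  rw [stieltjes, stieltjes, stieltjes, ← intervalIntegral.integral_add_adjacent_intervals i1 i3, e,
    ← E.proj_Ico_add hab hbc, map_sub]
  abel

/-- One `M * (t - s)` bounds v(t) - v(ξ), the other the integral in the definition by parts. -/
theorem norm_stieltjes_sub_le (hS : S.OrdConnected) (hv : ∀ t ∈ S, HasDerivAt v (v' t) t) {M : ℝ}
    (hM : ∀ t ∈ S, ‖v' t‖ ≤ M) {s t ξ : ℝ} (hs : s ∈ S) (ht : t ∈ S) (hξ : ξ ∈ Icc s t) :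
    ‖E.stieltjes v v' s t - E.proj (Ico s t) (v ξ)‖ ≤ 2 * M * (t - s) := by
  have hst : s ≤ t := hξ.1.trans hξ.2
  have hM0 : 0 ≤ M := (norm_nonneg _).trans (hM s hs)
  have h1 : ‖v t - v ξ‖ ≤ M * (t - s) := by
    have := (convex_Icc s t).norm_image_sub_le_of_norm_hasDerivWithin_le (f := v) (f' := v')
      (C := M) (fun m hm => (hv m (hS.out hs ht hm)).hasDerivWithinAt)
      (fun m hm => hM m (hS.out hs ht hm)) hξ (right_mem_Icc.2 hst)
    refine this.trans ?_
    rw [Real.norm_of_nonneg (by linarith [hξ.2])]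
    gcongr
    exact hξ.1
  have h2 : ‖∫ m in s..t, E.proj (Ico s m) (v' m)‖ ≤ M * (t - s) := by
    rw [← abs_of_nonneg (sub_nonneg.2 hst)]
    refine intervalIntegral.norm_integral_le_of_norm_le_const fun m hm => ?_
    rw [uIoc_of_le hst] at hm
    exact (E.norm_proj_le measurableSet_Ico _).trans (hM m (hS.out hs ht (Ioc_subset_Icc_self hm)))
  have h3 : E.stieltjes v v' s t - E.proj (Ico s t) (v ξ) =
      E.proj (Ico s t) (v t - v ξ) - ∫ m in s..t, E.proj (Ico s m) (v' m) := by
    rw [stieltjes, map_sub]; abel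
  rw [h3]
  have h4 := E.norm_proj_le (measurableSet_Ico (a := s) (b := t)) (v t - v ξ)
  linarith [norm_sub_le (E.proj (Ico s t) (v t - v ξ)) (∫ m in s..t, E.proj (Ico s m) (v' m))]

theorem continuousOn_stieltjes (hac : ∀ x : H, E.scalar x ≪ volume) {a b : ℝ}
    (hv : ContinuousOn v (Icc a b)) (hv' : ContinuousOn v' (Icc a b)) :
    ContinuousOn (fun r => E.stieltjes v v' a r) (Icc a b) := by
  rcases lt_or_ge b a with hab | hab
  · rw [Icc_eq_empty (not_le.2 hab)]; exact continuousOn_empty _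
  have hsub : Icc a b ⊆ Icc a b ∩ Ici a := fun m hm => ⟨hm, hm.1⟩
  refine ((continuousOn_proj_Ico hac hv a).mono hsub).sub ?_
  have := intervalIntegral.continuousOn_primitive_interval (μ := volume) (a := a) (b := b)
    (f := fun m => E.proj (Ico a m) (v' m))
    (by
      rw [uIcc_of_le hab]
      exact ((continuousOn_proj_Ico hac hv' a).mono hsub).integrableOn_Icc)
  rwa [uIcc_of_le hab] at this

/-- The errors on the subintervals lie in mutually orthogonal spectral subspaces, so their squares
add up: Σ (2M Δₖ)² ≤ 4M² δ Σ Δₖ. This is the source of the norm convergence of the sums. -/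
theorem norm_sum_sub_stieltjes_sq_le (hac : ∀ x : H, E.scalar x ≪ volume) {a b : ℝ}
    (hv : ∀ t ∈ Icc a b, HasDerivAt v (v' t) t) (hv' : ContinuousOn v' (Icc a b)) {M : ℝ}
    (hM : ∀ t ∈ Icc a b, ‖v' t‖ ≤ M) {δ : ℝ} (n : ℕ) (t ξ : ℕ → ℝ) (ht0 : t 0 = a) (htn : t n = b)
    (ht : ∀ k < n, t k ≤ ξ k ∧ ξ k ≤ t (k + 1) ∧ t (k + 1) - t k < δ) :
    ‖∑ k ∈ Finset.range n, E.proj (Ico (t k) (t (k + 1))) (v (ξ k)) - E.stieltjes v v' a b‖ ^ 2 ≤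
      4 * M ^ 2 * δ * (b - a) := by
  have hle : ∀ k < n, t k ≤ t (k + 1) := fun k hk => (ht k hk).1.trans (ht k hk).2.1
  have hmono : ∀ i j, i ≤ j → j ≤ n → t i ≤ t j := by
    intro i j hij
    induction j, hij using Nat.le_induction with
    | base => intro _; exact le_rfl
    | succ j _ ih => intro hj; exact (ih (by omega)).trans (hle j (by omega))
  have hmem : ∀ k ≤ n, t k ∈ Icc a b := fun k hk =>
    ⟨ht0 ▸ hmono 0 k (by omega) hk, htn ▸ hmono k n hk le_rfl⟩
  have hoc : (Icc a b).OrdConnected := ordConnected_Icc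
  have haS : a ∈ Icc a b := ht0 ▸ hmem 0 (by omega)
  -- The induction also carries that the accumulated error lies in the range of E([a, tⱼ)), which
  -- makes it orthogonal to the next one.
  have key : ∀ j ≤ n, E.proj (Ico a (t j)) (∑ k ∈ Finset.range j,
        E.proj (Ico (t k) (t (k + 1))) (v (ξ k)) - E.stieltjes v v' a (t j)) =
        ∑ k ∈ Finset.range j, E.proj (Ico (t k) (t (k + 1))) (v (ξ k)) -
          E.stieltjes v v' a (t j) ∧
      ‖∑ k ∈ Finset.range j, E.proj (Ico (t k) (t (k + 1))) (v (ξ k)) -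
        E.stieltjes v v' a (t j)‖ ^ 2 ≤ 4 * M ^ 2 * δ * (t j - a) := by
    intro j
    induction j with
    | zero => intro _; simp [ht0]
    | succ j ih =>
      intro hj
      obtain ⟨ih1, ih2⟩ := ih (by omega)
      set P := ∑ k ∈ Finset.range j, E.proj (Ico (t k) (t (k + 1))) (v (ξ k)) -
        E.stieltjes v v' a (t j) with hP
      set w := E.proj (Ico (t j) (t (j + 1))) (v (ξ j)) - E.stieltjes v v' (t j) (t (j + 1))
        with hw
      have m1 := hmem j (by omega)
      have m2 := hmem (j + 1) hj
      have e : ∑ k ∈ Finset.range (j + 1), E.proj (Ico (t k) (t (k + 1))) (v (ξ k)) -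
          E.stieltjes v v' a (t (j + 1)) = P + w := by
        rw [Finset.sum_range_succ, ← stieltjes_add hac hoc hv hv' haS m2 m1.1 (hle j (by omega)),
          hP, hw]
        abel
      have hws : E.proj (Ico (t j) (t (j + 1))) w = w := by
        rw [hw, map_sub, E.proj_self measurableSet_Ico,
          proj_stieltjes hac hoc hv' m1 m2 (hle j (by omega))]
      have hdis : Disjoint (Ico a (t j)) (Ico (t j) (t (j + 1))) :=
        Set.disjoint_left.2 fun x h1 h2 => not_le.2 h1.2 h2.1
      have horth : inner ℂ P w = 0 := by
        rw [← ih1, ← hws]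
        exact E.inner_proj_proj_of_disjoint measurableSet_Ico measurableSet_Ico hdis _ _
      have hwn : ‖w‖ ≤ 2 * M * (t (j + 1) - t j) := by
        rw [hw, norm_sub_rev]
        exact norm_stieltjes_sub_le hoc hv hM m1 m2 ⟨(ht j (by omega)).1, (ht j (by omega)).2.1⟩
      rw [e]
      constructor
      · have s1 : E.proj (Ico a (t (j + 1))) P = P := by
          rw [← ih1, E.proj_proj measurableSet_Ico measurableSet_Ico,
            inter_eq_self_of_subset_right (Ico_subset_Ico_right (hle j (by omega)))]
        have s2 : E.proj (Ico a (t (j + 1))) w = w := by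
          rw [← hws, E.proj_proj measurableSet_Ico measurableSet_Ico,
            inter_eq_self_of_subset_right (Ico_subset_Ico_left m1.1)]
        rw [map_add, s1, s2]
      · have h := norm_add_sq_eq_norm_sq_add_norm_sq_of_inner_eq_zero P w horth
        have d0 : 0 ≤ t (j + 1) - t j := sub_nonneg.2 (hle j (by omega))
        have h5 : ‖w‖ ^ 2 ≤ (2 * M * (t (j + 1) - t j)) ^ 2 := by gcongr
        have h6 : (2 * M * (t (j + 1) - t j)) ^ 2 ≤ 4 * M ^ 2 * δ * (t (j + 1) - t j) := by
          have : (t (j + 1) - t j) * (t (j + 1) - t j) ≤ δ * (t (j + 1) - t j) := by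
            gcongr
            exact (ht j (by omega)).2.2.le
          nlinarith [sq_nonneg M]
        nlinarith
  have := (key n le_rfl).2
  rwa [htn] at this

end SpectralMeasure

theorem hasStieltjesIntegral_stieltjes {H₁ : Type*} [NormedAddCommGroup H₁]
    [InnerProductSpace ℂ H₁] [CompleteSpace H₁] {E : SpectralMeasure H}
    (hac : ∀ x : H, E.scalar x ≪ volume)
    {F : ℝ → H₁ →L[ℂ] H} {v' : ℝ → H} {x : H₁} {a b : ℝ} (hab : a ≤ b)
    (hv : ∀ t ∈ Icc a b, HasDerivAt (fun m => F m x) (v' t) t) (hv' : ContinuousOn v' (Icc a b)) :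
    HasStieltjesIntegral E F a b x (E.stieltjes (fun m => F m x) v' a b) := by
  intro ε hε
  obtain ⟨M, hM⟩ := isCompact_Icc.exists_bound_of_continuousOn hv'
  set c := 4 * M ^ 2 * (b - a) with hc
  have hc0 : 0 ≤ c := mul_nonneg (by positivity) (sub_nonneg.2 hab)
  -- The 1 in the denominator covers c = 0 and makes the final inequality strict.
  refine ⟨ε ^ 2 / (c + 1), by positivity, fun n t ξ h0 hn ht => ?_⟩
  have h := SpectralMeasure.norm_sum_sub_stieltjes_sq_le hac hv hv' hM n t ξ h0 hn ht
  have h2 : 4 * M ^ 2 * (ε ^ 2 / (c + 1)) * (b - a) < ε ^ 2 := by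
    have : 4 * M ^ 2 * (ε ^ 2 / (c + 1)) * (b - a) = ε ^ 2 * c / (c + 1) := by rw [hc]; ring
    rw [this, div_lt_iff₀ (by positivity)]
    nlinarith [pow_pos hε 2]
  exact lt_of_pow_lt_pow_left₀ 2 hε.le (h.trans_lt h2)

end Stieltjes
end BlockRiccati

/-! ### Inner products and norms of Stieltjes integrals by differentiation in the upper limit. -/

namespace BlockRiccati

section StieltjesForms

variable {H : Type*} [NormedAddCommGroup H] [InnerProductSpace ℂ H] [CompleteSpace H]
  {E : SpectralMeasure H}

namespace SpectralMeasure

theorem tendsto_norm_proj_Ico (hac : ∀ x : H, E.scalar x ≪ volume) (z : H) (t : ℝ) :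
    Tendsto (fun r => ‖E.proj (Ico t r) z‖) (𝓝[>] t) (𝓝 0) := by
  rw [Metric.tendsto_nhds]
  intro ε hε
  obtain ⟨δ, hδ, hE⟩ := E.exists_norm_proj_Ico_lt hac z hε
  have : ∀ᶠ r in 𝓝[>] t, r < t + δ :=
    mem_nhdsWithin_of_mem_nhds (Iio_mem_nhds (by linarith))
  filter_upwards [this] with r hr
  simpa using hE t r (by linarith)

/-- A quantity bounded by a vanishing factor times the increment is of lower order. -/
theorem isLittleO_of_le_mul {F : Type*} [NormedAddCommGroup F] {t : ℝ} {f : ℝ → F} {p : ℝ → ℝ}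
    (hp : Tendsto p (𝓝[>] t) (𝓝 0)) (h : ∀ᶠ r in 𝓝[>] t, ‖f r‖ ≤ p r * (r - t)) :
    f =o[𝓝[>] t] fun r => r - t := by
  have h1 : f =O[𝓝[>] t] fun r => p r * (r - t) := by
    refine Asymptotics.IsBigO.of_bound 1 ?_
    filter_upwards [h] with r hr
    rw [one_mul]
    exact hr.trans (le_abs_self _)
  have h2 : (fun r => p r * (r - t)) =o[𝓝[>] t] fun r => (1 : ℝ) * (r - t) :=
    ((Asymptotics.isLittleO_one_iff ℝ).2 hp).mul_isBigO (Asymptotics.isBigO_refl _ _)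
  simpa using h1.trans_isLittleO h2

variable {v v' : ℝ → H} {a b : ℝ}

/-- The norm of the difference is only O(r - t), but it lies in the range of E([t, r)), so the
pairing with `z` gains the factor ‖E([t, r)) z‖, which tends to 0. -/
theorem isLittleO_inner_stieltjes (hac : ∀ x : H, E.scalar x ≪ volume)
    (hv : ∀ t ∈ Icc a b, HasDerivAt v (v' t) t) (hv' : ContinuousOn v' (Icc a b))
    (z : H) {t : ℝ} (ht : t ∈ Ioo a b) :
    (fun r => inner ℂ z (E.stieltjes v v' t r - E.proj (Ico t r) (v t))) =o[𝓝[>] t]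
      fun r => r - t := by
  obtain ⟨M, hM⟩ := isCompact_Icc.exists_bound_of_continuousOn hv'
  have hp : Tendsto (fun r => ‖E.proj (Ico t r) z‖ * (2 * M)) (𝓝[>] t) (𝓝 0) := by
    simpa using (tendsto_norm_proj_Ico hac z t).mul_const (2 * M)
  refine isLittleO_of_le_mul hp ?_
  filter_upwards [Ioo_mem_nhdsGT ht.2] with r hr
  have ht' : t ∈ Icc a b := Ioo_subset_Icc_self ht
  have hr' : r ∈ Icc a b := ⟨ht.1.le.trans hr.1.le, hr.2.le⟩
  have e : E.stieltjes v v' t r - E.proj (Ico t r) (v t) =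
      E.proj (Ico t r) (E.stieltjes v v' t r - E.proj (Ico t r) (v t)) := by
    rw [map_sub, E.proj_self measurableSet_Ico,
      proj_stieltjes hac ordConnected_Icc hv' ht' hr' hr.1.le]
  have h1 := norm_stieltjes_sub_le (E := E) ordConnected_Icc hv hM ht' hr'
    (left_mem_Icc.2 hr.1.le)
  rw [e, ← E.inner_proj_left measurableSet_Ico]
  calc _ ≤ ‖E.proj (Ico t r) z‖ * ‖E.stieltjes v v' t r - E.proj (Ico t r) (v t)‖ :=
        norm_inner_le_norm _ _
    _ ≤ ‖E.proj (Ico t r) z‖ * (2 * M * (r - t)) := by gcongr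
    _ = _ := by ring

end SpectralMeasure

variable {H₁ : Type*} [NormedAddCommGroup H₁] [InnerProductSpace ℂ H₁] [CompleteSpace H₁]
  {B : H₁ →L[ℂ] H}

theorem spectralK_sub {s t : ℝ} (hst : s ≤ t) (y : H₁) :
    spectralK E B t y - spectralK E B s y =
      ContinuousLinearMap.adjoint B (E.proj (Ico s t) (B y)) := by
  have : E.proj (Iio t) (B y) = E.proj (Iio s) (B y) + E.proj (Ico s t) (B y) := by
    rw [← E.proj_union measurableSet_Iio measurableSet_Ico, Iio_union_Ico_eq_Iio hst]
    exact Set.disjoint_left.2 fun x h1 h2 => not_le.2 h1 h2.1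
  simp only [spectralK, ContinuousLinearMap.comp_apply, this, map_add, add_sub_cancel_left]

theorem inner_spectralK_sub {s t : ℝ} (hst : s ≤ t) (y x : H₁) :
    inner ℂ y (spectralK E B t x) - inner ℂ y (spectralK E B s x) =
      inner ℂ (B y) (E.proj (Ico s t) (B x)) := by
  rw [← inner_sub_right, spectralK_sub hst, ContinuousLinearMap.adjoint_inner_right]

theorem hasDerivAt_inner_spectralK {k : H₁ →L[ℂ] H₁} {t : ℝ}
    (hk : HasDerivAt (spectralK E B) k t) (y x : H₁) :
    HasDerivAt (fun r => inner ℂ y (spectralK E B r x)) (inner ℂ y (k x)) t := by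
  have h1 : HasDerivAt (fun r => spectralK E B r x) (k x) t := by
    have := ((ContinuousLinearMap.apply ℂ H₁ x).restrictScalars ℝ).hasFDerivAt.comp_hasDerivAt t hk
    exact this
  exact ((innerSL ℂ y).restrictScalars ℝ).hasFDerivAt.comp_hasDerivAt t h1

variable {u u' : ℝ → H₁} {a b : ℝ} {k : ℝ → H₁ →L[ℂ] H₁}

theorem hasDerivAt_comp_clm {F G : Type*} [NormedAddCommGroup F] [NormedSpace ℂ F]
    [NormedAddCommGroup G] [NormedSpace ℂ G] (T : F →L[ℂ] G) {f : ℝ → F} {f' : F} {t : ℝ}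
    (hf : HasDerivAt f f' t) : HasDerivAt (fun r => T (f r)) (T f') t :=
  (T.restrictScalars ℝ).hasFDerivAt.comp_hasDerivAt t hf

section

variable (hac : ∀ x : H, E.scalar x ≪ volume) (hab : a ≤ b)
  (hu : ∀ t ∈ Icc a b, HasDerivAt u (u' t) t) (hu' : ContinuousOn u' (Icc a b))
  (hk : ∀ t ∈ Icc a b, HasDerivAt (spectralK E B) (k t) t) (hkc : ContinuousOn k (Icc a b))

include hac hab hu hu' hk hkc

/-- Up to o(r - t), the integral over [t, r) may be replaced by E([t, r)) B u(t), whose pairing with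
`B y` is the increment of ⟪y, K_B u(t)⟫ with `u(t)` frozen. The right derivative in the upper limit
is thus the integrand. -/
theorem inner_stieltjes_eq_integral (y : H₁) :
    inner ℂ (B y) (E.stieltjes (fun t => B (u t)) (fun t => B (u' t)) a b) =
      ∫ t in a..b, inner ℂ y (k t (u t)) := by
  have hv : ∀ t ∈ Icc a b, HasDerivAt (fun t => B (u t)) (B (u' t)) t := fun t ht =>
    hasDerivAt_comp_clm B (hu t ht)
  have hv' : ContinuousOn (fun t => B (u' t)) (Icc a b) := B.continuous.comp_continuousOn hu'
  have hvc : ContinuousOn (fun t => B (u t)) (Icc a b) := fun t ht =>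
    (hv t ht).continuousAt.continuousWithinAt
  have huc : ContinuousOn u (Icc a b) := fun t ht => (hu t ht).continuousAt.continuousWithinAt
  have hint : IntervalIntegrable (fun t => inner ℂ y (k t (u t))) volume a b := by
    refine ContinuousOn.intervalIntegrable ?_
    rw [uIcc_of_le hab]
    exact continuousOn_const.inner (hkc.clm_apply huc)
  have := intervalIntegral.integral_eq_sub_of_hasDeriv_right
    (f := fun r => inner ℂ (B y) (E.stieltjes (fun t => B (u t)) (fun t => B (u' t)) a r))
    (f' := fun t => inner ℂ y (k t (u t))) (a := a) (b := b) ?_ ?_ hint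
  · rw [this, SpectralMeasure.stieltjes_self, inner_zero_right, sub_zero]
  · rw [uIcc_of_le hab]
    exact continuousOn_const.inner (SpectralMeasure.continuousOn_stieltjes hac hvc hv')
  · intro t ht
    rw [min_eq_left hab, max_eq_right hab] at ht
    have ht' := Ioo_subset_Icc_self ht
    rw [hasDerivWithinAt_iff_isLittleO]
    have h1 := SpectralMeasure.isLittleO_inner_stieltjes hac hv hv' (B y) ht
    have h2 := hasDerivWithinAt_iff_isLittleO.1
      ((hasDerivAt_inner_spectralK (hk t ht') y (u t)).hasDerivWithinAt (s := Ioi t))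
    refine (h1.add h2).congr' ?_ EventuallyEq.rfl
    filter_upwards [Ioo_mem_nhdsGT ht.2] with r hr
    have hr' : r ∈ Icc a b := ⟨ht.1.le.trans hr.1.le, hr.2.le⟩
    rw [← SpectralMeasure.stieltjes_add hac ordConnected_Icc hv hv' (left_mem_Icc.2 hab) hr'
      ht.1.le hr.1.le, inner_spectralK_sub hr.1.le, inner_add_right, inner_sub_right]
    ring

/-- Integrals over [a, t) and [t, r) are orthogonal, so the squared norm is additive, and ‖E([t, r))
B u(t)‖² is the increment of ⟪u(t), K_B u(t)⟫ with `u(t)` frozen. -/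
theorem norm_stieltjes_sq_eq_integral :
    ‖E.stieltjes (fun t => B (u t)) (fun t => B (u' t)) a b‖ ^ 2 =
      ∫ t in a..b, (inner ℂ (u t) (k t (u t))).re := by
  set v := fun t => B (u t) with hvdef
  set v' := fun t => B (u' t) with hvdef'
  have hv : ∀ t ∈ Icc a b, HasDerivAt v (v' t) t := fun t ht =>
    hasDerivAt_comp_clm B (hu t ht)
  have hv' : ContinuousOn v' (Icc a b) := B.continuous.comp_continuousOn hu'
  have hvc : ContinuousOn v (Icc a b) := fun t ht =>
    (hv t ht).continuousAt.continuousWithinAt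
  have huc : ContinuousOn u (Icc a b) := fun t ht => (hu t ht).continuousAt.continuousWithinAt
  have hint : IntervalIntegrable (fun t => (inner ℂ (u t) (k t (u t))).re) volume a b := by
    refine ContinuousOn.intervalIntegrable ?_
    rw [uIcc_of_le hab]
    exact Complex.continuous_re.comp_continuousOn (huc.inner (hkc.clm_apply huc))
  obtain ⟨M, hM⟩ := isCompact_Icc.exists_bound_of_continuousOn hv'
  have := intervalIntegral.integral_eq_sub_of_hasDeriv_right
    (f := fun r => ‖E.stieltjes v v' a r‖ ^ 2)
    (f' := fun t => (inner ℂ (u t) (k t (u t))).re) (a := a) (b := b) ?_ ?_ hint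
  · rw [this, SpectralMeasure.stieltjes_self]; simp
  · rw [uIcc_of_le hab]
    exact (SpectralMeasure.continuousOn_stieltjes hac hvc hv').norm.pow 2
  · intro t ht
    rw [min_eq_left hab, max_eq_right hab] at ht
    have ht' := Ioo_subset_Icc_self ht
    rw [hasDerivWithinAt_iff_isLittleO]
    have h1 : (fun r => ‖E.stieltjes v v' t r‖ ^ 2 - ‖E.proj (Ico t r) (v t)‖ ^ 2) =o[𝓝[>] t]
        fun r => r - t := by
      have hp : Tendsto (fun r => 2 * M * (2 * ‖E.proj (Ico t r) (v t)‖ + 2 * M * (r - t)))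
          (𝓝[>] t) (𝓝 0) := by
        have h3 : Tendsto (fun r => r - t) (𝓝[>] t) (𝓝 0) := by
          have : Tendsto (fun r => r - t) (𝓝 t) (𝓝 (t - t)) := by
            exact (continuous_id.sub continuous_const).tendsto t
          rw [sub_self] at this
          exact this.mono_left nhdsWithin_le_nhds
        simpa using ((((SpectralMeasure.tendsto_norm_proj_Ico hac (v t) t).const_mul 2).add
          (h3.const_mul (2 * M))).const_mul (2 * M))
      refine SpectralMeasure.isLittleO_of_le_mul hp ?_
      filter_upwards [Ioo_mem_nhdsGT ht.2] with r hr
      have hr' : r ∈ Icc a b := ⟨ht.1.le.trans hr.1.le, hr.2.le⟩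
      have h4 := SpectralMeasure.norm_stieltjes_sub_le (E := E) ordConnected_Icc hv hM ht' hr'
        (left_mem_Icc.2 hr.1.le)
      have h5 := abs_norm_sub_norm_le (E.stieltjes v v' t r) (E.proj (Ico t r) (v t))
      have h6 := (abs_le.1 (h5.trans h4)).2
      have h7 := norm_nonneg (E.stieltjes v v' t r)
      have h8 := norm_nonneg (E.proj (Ico t r) (v t))
      have h9 : 0 ≤ 2 * M * (r - t) := (norm_nonneg _).trans h4
      rw [sq_sub_sq, Real.norm_eq_abs, abs_mul, abs_of_nonneg (by positivity)]
      calc _ ≤ (2 * ‖E.proj (Ico t r) (v t)‖ + 2 * M * (r - t)) * (2 * M * (r - t)) := by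
            refine mul_le_mul (by linarith) (h5.trans h4) (abs_nonneg _) (by positivity)
        _ = _ := by ring
    have h2 := hasDerivWithinAt_iff_isLittleO.1
      ((Complex.reCLM.hasFDerivAt.comp_hasDerivAt t
        (hasDerivAt_inner_spectralK (hk t ht') (u t) (u t))).hasDerivWithinAt (s := Ioi t))
    refine (h1.add h2).congr' ?_ EventuallyEq.rfl
    filter_upwards [Ioo_mem_nhdsGT ht.2] with r hr
    have hr' : r ∈ Icc a b := ⟨ht.1.le.trans hr.1.le, hr.2.le⟩
    have e1 : ‖E.stieltjes v v' a r‖ ^ 2 =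
        ‖E.stieltjes v v' a t‖ ^ 2 + ‖E.stieltjes v v' t r‖ ^ 2 := by
      rw [← SpectralMeasure.stieltjes_add hac ordConnected_Icc hv hv' (left_mem_Icc.2 hab) hr'
        ht.1.le hr.1.le]
      have horth : inner ℂ (E.stieltjes v v' a t) (E.stieltjes v v' t r) = 0 := by
        rw [← SpectralMeasure.proj_stieltjes hac ordConnected_Icc hv' (left_mem_Icc.2 hab) ht'
          ht.1.le, ← SpectralMeasure.proj_stieltjes hac ordConnected_Icc hv' ht' hr' hr.1.le]
        exact E.inner_proj_proj_of_disjoint measurableSet_Ico measurableSet_Ico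
          (Set.disjoint_left.2 fun x h1 h2 => not_le.2 h1.2 h2.1) _ _
      have := norm_add_sq_eq_norm_sq_add_norm_sq_of_inner_eq_zero _ _ horth
      rw [sq, sq, sq, this]
    have e2 : (inner ℂ (u t) (spectralK E B r (u t))).re -
        (inner ℂ (u t) (spectralK E B t (u t))).re = ‖E.proj (Ico t r) (v t)‖ ^ 2 := by
      rw [← Complex.sub_re, inner_spectralK_sub hr.1.le, E.inner_proj_self measurableSet_Ico,
        Complex.ofReal_re]
    simp only [Function.comp_apply, Complex.reCLM_apply]
    rw [e2, e1]
    ring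

end

/-- Multiplication by the independent variable under the integral sign corresponds to the
application of the operator. -/
theorem inner_apply_stieltjes {A : H →ₗ.[ℂ] H} (hE : IsSpectralMeasureOf E A)
    (hA : IsSelfAdjoint A) (hac : ∀ x : H, E.scalar x ≪ volume) (hab : a ≤ b)
    {v v' w w' : ℝ → H} (hv : ∀ t ∈ Icc a b, HasDerivAt v (v' t) t)
    (hv' : ContinuousOn v' (Icc a b)) (hw : ∀ t ∈ Icc a b, HasDerivAt w (w' t) t)
    (hw' : ContinuousOn w' (Icc a b)) {c : H} (hwv : ∀ t ∈ Icc a b, w t = (t : ℂ) • v t + c)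
    {x : H} (hx : x ∈ A.domain) :
    inner ℂ (A ⟨x, hx⟩) (E.stieltjes v v' a b) =
      inner ℂ x (E.stieltjes w w' a b - E.proj (Ico a b) c) := by
  have hvc : ContinuousOn v (Icc a b) := fun t ht => (hv t ht).continuousAt.continuousWithinAt
  have hwc : ContinuousOn w (Icc a b) := fun t ht => (hw t ht).continuousAt.continuousWithinAt
  have hcc : ContinuousOn (fun r => E.proj (Ico a r) c) (Icc a b) :=
    (SpectralMeasure.continuousOn_proj_Ico hac (continuousOn_const (s := Icc a b)) a).mono
      fun m hm => ⟨hm, hm.1⟩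
  have := intervalIntegral.integral_eq_sub_of_hasDeriv_right
    (f := fun r => inner ℂ (A ⟨x, hx⟩) (E.stieltjes v v' a r) -
      inner ℂ x (E.stieltjes w w' a r - E.proj (Ico a r) c))
    (f' := fun _ => 0) (a := a) (b := b) ?_ ?_ (by simp)
  · rw [intervalIntegral.integral_zero] at this
    simpa [E.empty, sub_eq_zero] using this.symm
  · rw [uIcc_of_le hab]
    exact (continuousOn_const.inner (SpectralMeasure.continuousOn_stieltjes hac hvc hv')).sub
      (continuousOn_const.inner ((SpectralMeasure.continuousOn_stieltjes hac hwc hw').sub hcc))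
  · intro t ht
    rw [min_eq_left hab, max_eq_right hab] at ht
    have ht' := Ioo_subset_Icc_self ht
    rw [hasDerivWithinAt_iff_isLittleO]
    have h1 := SpectralMeasure.isLittleO_inner_stieltjes hac hv hv' (A ⟨x, hx⟩) ht
    have h2 := SpectralMeasure.isLittleO_inner_stieltjes hac hw hw' x ht
    -- On the range of E([t, r)) the operator `A` equals `t` up to r - t, and both vectors
    -- contribute a vanishing norm. With w(t) - c = t v(t) the difference of the two sides has right
    -- derivative zero.
    have h3 : (fun r => inner ℂ (A ⟨x, hx⟩) (E.proj (Ico t r) (v t)) -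
        t * inner ℂ x (E.proj (Ico t r) (v t))) =o[𝓝[>] t] fun r => r - t := by
      have hp : Tendsto (fun r => ‖E.proj (Ico t r) x‖ * ‖E.proj (Ico t r) (v t)‖)
          (𝓝[>] t) (𝓝 0) := by
        simpa using (SpectralMeasure.tendsto_norm_proj_Ico hac x t).mul
          (SpectralMeasure.tendsto_norm_proj_Ico hac (v t) t)
      refine SpectralMeasure.isLittleO_of_le_mul hp ?_
      filter_upwards [self_mem_nhdsWithin] with r hr
      have hsub : ∀ s ∈ Ico t r, |s - t| ≤ r - t := fun s hs => by
        rw [abs_of_nonneg (sub_nonneg.2 hs.1)]; linarith [hs.2]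
      exact (hE.norm_inner_proj_sub_le hA measurableSet_Ico hsub hx (v t)).trans_eq (mul_comm _ _)
    refine ((h1.sub h2).add h3).congr' ?_ EventuallyEq.rfl
    filter_upwards [Ioo_mem_nhdsGT ht.2] with r hr
    have hr' : r ∈ Icc a b := ⟨ht.1.le.trans hr.1.le, hr.2.le⟩
    rw [← SpectralMeasure.stieltjes_add hac ordConnected_Icc hv hv' (left_mem_Icc.2 hab) hr'
      ht.1.le hr.1.le, ← SpectralMeasure.stieltjes_add hac ordConnected_Icc hw hw'
      (left_mem_Icc.2 hab) hr' ht.1.le hr.1.le, ← E.proj_Ico_add ht.1.le hr.1.le, hwv t ht']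
    simp only [map_add, map_smul, inner_add_right, inner_sub_right, inner_smul_right, smul_zero]
    ring

end StieltjesForms
end BlockRiccati

namespace BlockRiccati

/-! ## The resolvent -/

section Resolvent

variable {H₁ : Type*} [NormedAddCommGroup H₁] [InnerProductSpace ℂ H₁] [CompleteSpace H₁]
  {Z : H₁ →L[ℂ] H₁} {z : ℂ}

omit [CompleteSpace H₁] in
theorem isUnit_sub_smul_one_iff : IsUnit (Z - z • (1 : H₁ →L[ℂ] H₁)) ↔ z ∉ spectrum ℂ Z := by
  rw [spectrum.notMem_iff, Algebra.algebraMap_eq_smul_one, ← IsUnit.neg_iff, neg_sub]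

-- This trades the factor `z` for an application of `Z`, both when the weights of the energy are
-- lowered and in the Sylvester equation.
omit [CompleteSpace H₁] in
theorem resolventAt_mul_cancel (hz : IsUnit (Z - z • (1 : H₁ →L[ℂ] H₁))) (x : H₁) :
    resolventAt Z z (Z x) = x + z • resolventAt Z z x := by
  have h := Ring.inverse_mul_cancel _ hz
  have h2 := congrArg (fun T : H₁ →L[ℂ] H₁ => T x) h
  simp only [mul_apply_eq_comp, sub_apply,
    smul_apply, one_apply_eq_self, map_sub, map_smul] at h2
  rw [resolventAt, ← sub_eq_iff_eq_add]
  exact h2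

theorem norm_resolventAt_le_one (hz : IsUnit (Z - z • (1 : H₁ →L[ℂ] H₁))) (hn : ‖Z‖ + 1 ≤ ‖z‖) :
    ‖resolventAt Z z‖ ≤ 1 := by
  have h : z • resolventAt Z z = resolventAt Z z * Z - 1 := by
    ext x
    simp [resolventAt_mul_cancel hz]
  have h1 : ‖z‖ * ‖resolventAt Z z‖ ≤ ‖resolventAt Z z‖ * ‖Z‖ + 1 := by
    rw [← norm_smul, h]
    exact (norm_sub_le _ _).trans (add_le_add (norm_mul_le _ _) ContinuousLinearMap.norm_id_le)
  nlinarith [norm_nonneg (resolventAt Z z)]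

theorem analyticAt_resolventAt (hz : IsUnit (Z - z • (1 : H₁ →L[ℂ] H₁))) :
    AnalyticAt ℂ (resolventAt Z) z := by
  obtain ⟨w, hw⟩ := hz
  have h1 : AnalyticAt ℂ (fun ζ : ℂ => Z - ζ • (1 : H₁ →L[ℂ] H₁)) z := by fun_prop
  have h2 : AnalyticAt ℂ Ring.inverse (Z - z • (1 : H₁ →L[ℂ] H₁)) := by
    rw [← hw]; exact analyticAt_inverse w
  exact AnalyticAt.fun_comp (f := fun ζ : ℂ => Z - ζ • (1 : H₁ →L[ℂ] H₁)) h2 h1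

/-- The resolvent is bounded on a set at positive distance from the spectrum. -/
theorem exists_norm_resolventAt_le {S : Set ℂ} (hZ : 0 < setDist (spectrum ℂ Z) S) :
    (∀ z ∈ closure S, IsUnit (Z - z • (1 : H₁ →L[ℂ] H₁))) ∧
      ∃ C, ∀ z ∈ closure S, ‖resolventAt Z z‖ ≤ C := by
  have hu : ∀ z ∈ closure S, IsUnit (Z - z • (1 : H₁ →L[ℂ] H₁)) := by
    intro z hz
    rw [isUnit_sub_smul_one_iff]
    intro hsp
    have h1 : setDist (spectrum ℂ Z) S ≤ Metric.infEDist z S := iInf₂_le z hsp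
    rw [Metric.mem_closure_iff_infEDist_zero.1 hz] at h1
    exact absurd hZ (not_lt.2 h1)
  refine ⟨hu, ?_⟩
  have hc : IsCompact (closure S ∩ Metric.closedBall 0 (‖Z‖ + 1)) :=
    (isCompact_closedBall _ _).inter_left isClosed_closure
  obtain ⟨C, hC⟩ := hc.exists_bound_of_continuousOn (f := resolventAt Z) fun z hz =>
    (analyticAt_resolventAt (hu z hz.1)).continuousAt.continuousWithinAt
  refine ⟨max C 1, fun z hz => ?_⟩
  rcases le_total ‖z‖ (‖Z‖ + 1) with h | h
  · exact (hC z ⟨hz, by simpa using h⟩).trans (le_max_left _ _)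
  · exact (norm_resolventAt_le_one (hu z hz) h).trans (le_max_right _ _)

theorem hasDerivAt_resolventAt_apply {t : ℝ} (ht : IsUnit (Z - (t : ℂ) • (1 : H₁ →L[ℂ] H₁)))
    (x : H₁) : HasDerivAt (fun r : ℝ => resolventAt Z (r : ℂ) x)
      (deriv (resolventAt Z) (t : ℂ) x) t := by
  have h : HasDerivAt (fun r : ℝ => resolventAt Z (r : ℂ)) (deriv (resolventAt Z) (t : ℂ)) t := by
    have := (analyticAt_resolventAt ht).differentiableAt.hasDerivAt.scomp t
      Complex.ofRealCLM.hasDerivAt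
    simp only [Complex.ofRealCLM_apply, Complex.ofReal_one, one_smul] at this
    exact this
  exact hasDerivAt_comp_clm (ContinuousLinearMap.apply ℂ H₁ x) h

theorem continuousAt_deriv_resolventAt_apply {t : ℝ}
    (ht : IsUnit (Z - (t : ℂ) • (1 : H₁ →L[ℂ] H₁))) (x : H₁) :
    ContinuousAt (fun r : ℝ => deriv (resolventAt Z) (r : ℂ) x) t := by
  have h := (analyticAt_resolventAt ht).deriv.continuousAt.comp (f := Complex.ofReal)
    Complex.continuous_ofReal.continuousAt
  exact ((ContinuousLinearMap.apply ℂ H₁ x).continuous.continuousAt.comp h)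

end Resolvent

/-! ## Positive forms -/

section Forms

variable {H₁ : Type*} [NormedAddCommGroup H₁] [InnerProductSpace ℂ H₁] {T : H₁ →L[ℂ] H₁}

/-- Cauchy-Schwarz in arithmetic-mean form: the form is nonnegative at x + c y for the unimodular
`c` that turns the mixed term into minus its modulus. -/
theorem norm_inner_le_of_nonneg (hs : ∀ x y, inner ℂ (T x) y = inner ℂ x (T y))
    (hp : ∀ x, 0 ≤ (inner ℂ x (T x)).re) (x y : H₁) :
    ‖inner ℂ x (T y)‖ ≤ ((inner ℂ x (T x)).re + (inner ℂ y (T y)).re) / 2 := by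
  obtain ⟨c, hc, hcx⟩ : ∃ c : ℂ, ‖c‖ = 1 ∧ c * inner ℂ x (T y) = -(‖inner ℂ x (T y)‖ : ℂ) := by
    obtain ⟨c, hc, hcx⟩ := RCLike.exists_norm_eq_mul_self (inner ℂ x (T y))
    exact ⟨-c, by rwa [norm_neg], by rw [neg_mul, ← hcx]; rfl⟩
  have h := hp (x + c • y)
  have h1 : inner ℂ y (T x) = (starRingEnd ℂ) (inner ℂ x (T y)) := by
    rw [← hs, inner_conj_symm]
  have h2 : (starRingEnd ℂ) c * (starRingEnd ℂ) (inner ℂ x (T y)) =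
      -(‖inner ℂ x (T y)‖ : ℂ) := by
    rw [← map_mul, hcx, map_neg, Complex.conj_ofReal]
  have h3 : (starRingEnd ℂ) c * c = 1 := by
    rw [mul_comm, Complex.mul_conj, Complex.normSq_eq_norm_sq, hc]; simp
  have e : inner ℂ (x + c • y) (T (x + c • y)) = inner ℂ x (T x) + inner ℂ y (T y) +
      -(‖inner ℂ x (T y)‖ : ℂ) + -(‖inner ℂ x (T y)‖ : ℂ) := by
    simp only [map_add, map_smul, inner_add_left, inner_add_right, inner_smul_left,
      inner_smul_right, h1]
    linear_combination hcx + h2 + inner ℂ y (T y) * h3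
  rw [e] at h
  simp only [Complex.add_re, Complex.neg_re, Complex.ofReal_re] at h
  linarith

theorem re_inner_sub_le_of_nonneg (hp : ∀ x, 0 ≤ (inner ℂ x (T x)).re) (x y : H₁) :
    (inner ℂ (x - y) (T (x - y))).re ≤
      2 * (inner ℂ x (T x)).re + 2 * (inner ℂ y (T y)).re := by
  have h := hp (x + y)
  simp only [map_add, map_sub, inner_add_left, inner_add_right, inner_sub_left, inner_sub_right,
    Complex.add_re, Complex.sub_re] at h ⊢
  linarith

end Forms

/-! ## The derivative of `K_B` on the interval -/

section Derivative

variable {H₀ H₁ : Type*}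
  [NormedAddCommGroup H₀] [InnerProductSpace ℂ H₀] [CompleteSpace H₀]
  [NormedAddCommGroup H₁] [InnerProductSpace ℂ H₁] [CompleteSpace H₁]
  {E : SpectralMeasure H₀} {B : H₁ →L[ℂ] H₀} {k : H₁ →L[ℂ] H₁} {t : ℝ}

theorem inner_spectralK_self (r : ℝ) (y : H₁) :
    (inner ℂ y (spectralK E B r y)).re = ‖E.proj (Iio r) (B y)‖ ^ 2 := by
  rw [spectralK, ContinuousLinearMap.comp_apply, ContinuousLinearMap.comp_apply,
    ContinuousLinearMap.adjoint_inner_right, E.inner_proj_self measurableSet_Iio,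
    Complex.ofReal_re]

theorem re_inner_nonneg_of_hasDerivAt_spectralK (hk : HasDerivAt (spectralK E B) k t) (y : H₁) :
    0 ≤ (inner ℂ y (k y)).re := by
  have h := Complex.reCLM.hasFDerivAt.comp_hasDerivAt t (hasDerivAt_inner_spectralK hk y y)
  refine HasDerivAt.nonneg_of_monotone h fun r s hrs => ?_
  simp only [Function.comp_apply, Complex.reCLM_apply, inner_spectralK_self]
  gcongr
  exact E.norm_proj_mono measurableSet_Iio measurableSet_Iio (Iio_subset_Iio hrs) _

theorem inner_comm_of_hasDerivAt_spectralK (hk : HasDerivAt (spectralK E B) k t) (x y : H₁) :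
    inner ℂ (k x) y = inner ℂ x (k y) := by
  have h1 := hasDerivAt_inner_spectralK hk x y
  have h2 := Complex.conjCLE.toContinuousLinearMap.hasFDerivAt.comp_hasDerivAt t
    (hasDerivAt_inner_spectralK hk y x)
  have h3 : (fun r => inner ℂ x (spectralK E B r y)) =
      Complex.conjCLE.toContinuousLinearMap ∘ fun r => inner ℂ y (spectralK E B r x) := by
    funext r
    simp only [Function.comp_apply, ContinuousLinearEquiv.coe_coe, Complex.conjCLE_apply,
      inner_conj_symm, spectralK, ContinuousLinearMap.comp_apply,
      ContinuousLinearMap.adjoint_inner_right]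
    exact (E.inner_proj_left measurableSet_Iio _ _).symm
  rw [← h3] at h2
  have h4 := h1.unique h2
  rw [h4]
  simp

variable {μ₁ μ₂ : EReal} {D : Set ℂ} {K' : ℂ → H₁ →L[ℂ] H₁}

theorem IsContinuedDerivative.continuousOn (hK : IsContinuedDerivative E B μ₁ μ₂ D K') :
    ContinuousOn (fun t : ℝ => K' (t : ℂ)) (openInterval μ₁ μ₂) := fun t ht =>
  ((hK.analytic t (Or.inl ⟨t, ht, rfl⟩)).continuousAt.comp (f := Complex.ofReal)
    Complex.continuous_ofReal.continuousAt).continuousWithinAt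

theorem sheetDomain_neg_one (D : Set ℂ) : sheetDomain D (-1) = D := by simp [sheetDomain]

theorem ofReal_mem_closure_sheetDomain {t : ℝ} (ht : (t : ℂ) ∈ closure D) (l : ℤˣ) :
    (t : ℂ) ∈ closure (sheetDomain D l) := by
  unfold sheetDomain
  split_ifs
  · exact ht
  · have := map_mem_closure Complex.continuous_conj ht (t := {z | (starRingEnd ℂ) z ∈ D})
      fun z hz => by simpa using hz
    simpa using this

theorem IsContinuedDerivative.mem_closure (hK : IsContinuedDerivative E B μ₁ μ₂ D K') {t : ℝ}
    (ht : t ∈ openInterval μ₁ μ₂) (l : ℤˣ) : (t : ℂ) ∈ closure (sheetDomain D l) :=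
  ofReal_mem_closure_sheetDomain (frontier_subset_closure (hK.subset_frontier t ht)) l

/-- A continuous bound valid on an open part of the domain extends to the interval. -/
theorem IsContinuedDerivative.norm_le_of_bound (hK : IsContinuedDerivative E B μ₁ μ₂ D K') {t : ℝ}
    (ht : t ∈ openInterval μ₁ μ₂) {U : Set ℂ} (hU : U ∈ 𝓝 (t : ℂ)) {β : ℂ → ℝ}
    (hβ : ContinuousAt β t) (h : ∀ z ∈ D, z ∈ U → ‖K' z‖ ≤ β z) : ‖K' t‖ ≤ β t := by
  have h1 : (t : ℂ) ∈ closure D := frontier_subset_closure (hK.subset_frontier t ht)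
  have : (𝓝[D] (t : ℂ)).NeBot := mem_closure_iff_nhdsWithin_neBot.1 h1
  have h2 : Tendsto (fun z => ‖K' z‖) (𝓝[D] (t : ℂ)) (𝓝 ‖K' t‖) :=
    ((hK.analytic t (Or.inl ⟨t, ht, rfl⟩)).continuousAt.norm).tendsto.mono_left
      nhdsWithin_le_nhds
  refine le_of_tendsto_of_tendsto h2 (hβ.tendsto.mono_left nhdsWithin_le_nhds) ?_
  filter_upwards [self_mem_nhdsWithin, mem_nhdsWithin_of_mem_nhds hU] with z hz1 hz2
  exact h z hz1 hz2

/-- The power bound is given inside the domain and reaches the interval by continuity; cut off near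
`c`, it is integrable since γ > -1. The number `c` is quantified inside the conclusion so that an
infinite end point needs no separate treatment. -/
theorem IsContinuedDerivative.exists_endpoint_bound (hK : IsContinuedDerivative E B μ₁ μ₂ D K')
    {μ : EReal} (hμ : μ = μ₁ ∨ μ = μ₂) : ∃ h : ℝ → ℝ, Integrable h ∧ (∀ t, 0 ≤ h t) ∧ ∃ δ > 0,
      ∀ t ∈ openInterval μ₁ μ₂, ∀ c : ℝ, (c : EReal) = μ → |t - c| < δ →
        ‖K' (t : ℂ)‖ ≤ h t := by
  by_cases hc : ∃ c : ℝ, (c : EReal) = μ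
  swap
  · exact ⟨fun _ => 0, integrable_zero _ _ _, fun _ => le_rfl, 1, one_pos,
      fun t _ c h => (hc ⟨c, h⟩).elim⟩
  obtain ⟨c, hc⟩ := hc
  obtain ⟨C, hC, γ, hγ, δ, hδ, hb⟩ := hK.bound_endpoint c
    (hμ.imp (fun h => hc.trans h) fun h => hc.trans h)
  have hloc : LocallyIntegrable (fun t : ℝ => C * |t| ^ γ) := by
    refine locallyIntegrable_of_norm_le_rpow (C := C) (α := -γ) (by simp) (by
      simp only [Module.finrank_self, Nat.cast_one]; linarith [hγ.1]) ?_
      (Measurable.aestronglyMeasurable (by fun_prop))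
    refine Eventually.of_forall fun t => ?_
    rw [neg_neg, norm_mul, Real.norm_of_nonneg hC.le, Real.norm_of_nonneg (by positivity),
      Real.norm_eq_abs]
  have h0 : IntegrableOn (fun t : ℝ => C * |t| ^ γ) (Metric.ball 0 δ) :=
    (hloc.integrableOn_isCompact (isCompact_closedBall 0 δ)).mono_set Metric.ball_subset_closedBall
  have h1 : Integrable ((Metric.ball 0 δ).indicator fun t : ℝ => C * |t| ^ γ) :=
    h0.integrable_indicator Metric.isOpen_ball.measurableSet
  refine ⟨fun t => (Metric.ball 0 δ).indicator (fun t : ℝ => C * |t| ^ γ) (t - c),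
    h1.comp_sub_right c, fun t => indicator_nonneg (fun t _ => by positivity) _, δ, hδ, ?_⟩
  intro t ht c' hc' htc
  obtain rfl : c' = c := by rw [← hc, EReal.coe_eq_coe_iff] at hc'; exact hc'
  have hmem : t - c' ∈ Metric.ball (0 : ℝ) δ := by simpa using htc
  simp only [indicator_of_mem hmem]
  have hne : t ≠ c' := by
    rintro rfl
    rcases hμ with h | h
    · exact (lt_irrefl _ ((h ▸ hc) ▸ ht.1 : (t : EReal) < t))
    · exact (lt_irrefl _ ((h ▸ hc) ▸ ht.2 : (t : EReal) < t))
  have hU : Metric.ball (c' : ℂ) δ ∈ 𝓝 (t : ℂ) := Metric.isOpen_ball.mem_nhds (by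
    rw [Metric.mem_ball, Complex.dist_eq, ← Complex.ofReal_sub, Complex.norm_real]; exact htc)
  have := hK.norm_le_of_bound ht hU (β := fun z => C * ‖z - c'‖ ^ γ) ?_ ?_
  · rwa [← Complex.ofReal_sub, Complex.norm_real, Real.norm_eq_abs] at this
  · refine continuousAt_const.mul (ContinuousAt.rpow_const (by fun_prop) (Or.inl ?_))
    rw [← Complex.ofReal_sub, Complex.norm_real]
    exact norm_ne_zero_iff.2 (sub_ne_zero.2 hne)
  · intro z hz hzU
    exact hb (-1) z (by rwa [sheetDomain_neg_one]) (by simpa [dist_eq_norm] using hzU)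

theorem IsContinuedDerivative.exists_infinity_bound (hK : IsContinuedDerivative E B μ₁ μ₂ D K') :
    ∃ C ≥ (0 : ℝ), ∃ N : ℕ, ∃ R > (0 : ℝ), ∀ t ∈ openInterval μ₁ μ₂, R < |t| →
      ‖K' (t : ℂ)‖ ≤ C * |t| ^ N := by
  by_cases hinf : μ₁ = ⊥ ∨ μ₂ = ⊤
  · obtain ⟨C, hC, N, R, hR, hb⟩ := hK.bound_infinity hinf
    refine ⟨C, hC.le, N, R, hR, fun t ht htR => ?_⟩
    have hU : {z : ℂ | R < ‖z‖} ∈ 𝓝 (t : ℂ) :=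
      (isOpen_lt continuous_const continuous_norm).mem_nhds (by simpa using htR)
    have := hK.norm_le_of_bound ht hU (β := fun z => C * ‖z‖ ^ N) (by fun_prop)
      fun z hz hzU => hb (-1) z (by rwa [sheetDomain_neg_one]) hzU
    simpa using this
  · rw [not_or] at hinf
    -- For a bounded interval this radius exceeds every |t|, so the claim is void.
    refine ⟨0, le_rfl, 0, |μ₁.toReal| + |μ₂.toReal| + 1, by positivity, fun t ht htR => ?_⟩
    exfalso
    have h1 : μ₁ ≠ ⊤ := (ht.1.trans_le le_top).ne
    have h2 : μ₂ ≠ ⊥ := (bot_le.trans_lt ht.2).ne'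
    have h3 := ht.1
    have h4 := ht.2
    rw [← EReal.coe_toReal h1 hinf.1, EReal.coe_lt_coe_iff] at h3
    rw [← EReal.coe_toReal hinf.2 h2, EReal.coe_lt_coe_iff] at h4
    have h5 : |t| ≤ |μ₁.toReal| + |μ₂.toReal| :=
      abs_le.2 ⟨by linarith [neg_abs_le μ₁.toReal, abs_nonneg μ₂.toReal],
        by linarith [le_abs_self μ₂.toReal, abs_nonneg μ₁.toReal]⟩
    linarith

/-- Away from the finite end points and within radius R the interval is compact and `K'` is bounded;
near the end points it has integrable majorants, and beyond R the weight with exponent N + 1 absorbs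
the growth and leaves (1 + t²)⁻¹. -/
theorem IsContinuedDerivative.exists_integrableOn_weight
    (hK : IsContinuedDerivative E B μ₁ μ₂ D K') :
    ∃ m : ℕ, IntegrableOn (fun t : ℝ => ((1 + t ^ 2) ^ m)⁻¹ * ‖K' (t : ℂ)‖)
      (openInterval μ₁ μ₂) := by
  obtain ⟨g₁, hi₁, hn₁, δ₁, hδ₁, hb₁⟩ := hK.exists_endpoint_bound (Or.inl rfl)
  obtain ⟨g₂, hi₂, hn₂, δ₂, hδ₂, hb₂⟩ := hK.exists_endpoint_bound (Or.inr rfl)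
  obtain ⟨C, hC0, N, R, hR, hb⟩ := hK.exists_infinity_bound
  set S := {t : ℝ | μ₁ ≤ (t : EReal) ∧ (t : EReal) ≤ μ₂} ∩
    ({t : ℝ | ∀ c : ℝ, (c : EReal) = μ₁ → δ₁ ≤ |t - c|} ∩
    ({t : ℝ | ∀ c : ℝ, (c : EReal) = μ₂ → δ₂ ≤ |t - c|} ∩ Metric.closedBall 0 R)) with hS
  have hScl : IsCompact S := by
    refine ((isCompact_closedBall _ _).inter_left ?_).inter_left ?_ |>.inter_left ?_
    · simp only [ofPred_forall]
      exact isClosed_iInter fun c => isClosed_iInter fun _ =>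
        isClosed_le continuous_const (by fun_prop)
    · simp only [ofPred_forall]
      exact isClosed_iInter fun c => isClosed_iInter fun _ =>
        isClosed_le continuous_const (by fun_prop)
    · exact (isClosed_le continuous_const continuous_coe_real_ereal).inter
        (isClosed_le continuous_coe_real_ereal continuous_const)
  have hSsub : S ⊆ openInterval μ₁ μ₂ := by
    rintro t ⟨⟨h1, h2⟩, h3, h4, -⟩
    refine ⟨lt_of_le_of_ne h1 fun h => ?_, lt_of_le_of_ne h2 fun h => ?_⟩
    · have := h3 t h.symm
      simp only [sub_self, abs_zero] at this
      linarith
    · have := h4 t h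
      simp only [sub_self, abs_zero] at this
      linarith
  obtain ⟨M, hM⟩ := hScl.exists_bound_of_continuousOn (hK.continuousOn.mono hSsub)
  set M' := max M 0 * (1 + R ^ 2) + C with hM'
  refine ⟨N + 1, ?_⟩
  have hdom : Integrable fun t : ℝ => M' * (1 + t ^ 2)⁻¹ + g₁ t + g₂ t :=
    ((integrable_inv_one_add_sq.const_mul M').add hi₁).add hi₂
  refine hdom.integrableOn.mono' ?_ ?_
  · refine ContinuousOn.aestronglyMeasurable ?_ (measurableSet_openInterval _ _)
    refine ContinuousOn.mul (Continuous.continuousOn ?_) hK.continuousOn.norm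
    exact Continuous.inv₀ (by fun_prop) fun t => by positivity
  · refine (ae_restrict_iff' (measurableSet_openInterval _ _)).2 (Eventually.of_forall ?_)
    intro t ht
    have hw1 : ((1 + t ^ 2) ^ (N + 1))⁻¹ ≤ 1 := inv_le_one_of_one_le₀ (one_le_pow₀ (by
      linarith [sq_nonneg t]))
    have hM'0 : 0 ≤ M' * (1 + t ^ 2)⁻¹ := by positivity
    have hw0 : 0 ≤ ((1 + t ^ 2) ^ (N + 1))⁻¹ := by positivity
    rw [Real.norm_of_nonneg (by positivity)]
    have hn := norm_nonneg (K' (t : ℂ))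
    by_cases hS1 : ∃ c : ℝ, (c : EReal) = μ₁ ∧ |t - c| < δ₁
    · obtain ⟨c, hc, htc⟩ := hS1
      have h := hb₁ t ht c hc htc
      have := hn₂ t
      nlinarith
    by_cases hS2 : ∃ c : ℝ, (c : EReal) = μ₂ ∧ |t - c| < δ₂
    · obtain ⟨c, hc, htc⟩ := hS2
      have h := hb₂ t ht c hc htc
      have := hn₁ t
      nlinarith
    have hg1 := hn₁ t
    have hg2 := hn₂ t
    have hsq : (0 : ℝ) < 1 + t ^ 2 := by positivity
    suffices hmain : ((1 + t ^ 2) ^ (N + 1))⁻¹ * ‖K' (t : ℂ)‖ ≤ M' * (1 + t ^ 2)⁻¹ by linarith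
    rcases lt_or_ge R |t| with h | h
    · have h1 := hb t ht h
      have h2 : |t| ^ N ≤ (1 + t ^ 2) ^ N := by
        gcongr
        nlinarith [sq_abs t, sq_nonneg (|t| - 1), abs_nonneg t]
      calc ((1 + t ^ 2) ^ (N + 1))⁻¹ * ‖K' (t : ℂ)‖
          ≤ ((1 + t ^ 2) ^ (N + 1))⁻¹ * (C * (1 + t ^ 2) ^ N) := by
            gcongr
            exact h1.trans (by gcongr)
        _ = C * (1 + t ^ 2)⁻¹ := by rw [pow_succ]; field_simp
        _ ≤ M' * (1 + t ^ 2)⁻¹ := by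
            gcongr
            rw [hM']
            have : 0 ≤ max M 0 * (1 + R ^ 2) := by positivity
            linarith
    · have htS : t ∈ S := by
        refine ⟨⟨ht.1.le, ht.2.le⟩, fun c hc => ?_, fun c hc => ?_, by simpa using h⟩
        · by_contra hlt; exact hS1 ⟨c, hc, not_le.1 hlt⟩
        · by_contra hlt; exact hS2 ⟨c, hc, not_le.1 hlt⟩
      have h1 : ‖K' (t : ℂ)‖ ≤ max M 0 := (hM t htS).trans (le_max_left _ _)
      have h2 : t ^ 2 ≤ R ^ 2 := by rw [← sq_abs t]; gcongr
      calc ((1 + t ^ 2) ^ (N + 1))⁻¹ * ‖K' (t : ℂ)‖ ≤ 1 * max M 0 := by gcongr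
        _ ≤ M' * (1 + t ^ 2)⁻¹ := by
          rw [← div_eq_mul_inv, le_div_iff₀ hsq, hM']
          nlinarith [le_max_right M 0]

end Derivative
end BlockRiccati

namespace BlockRiccati

/-! ## Convergence of the improper integral -/

section Exhaustion

variable {μ₁ μ₂ : EReal}

theorem integrableOn_openInterval_of_nonneg (hμ : μ₁ < μ₂) {f : ℝ → ℝ} {C : ℝ}
    (hf : ContinuousOn f (openInterval μ₁ μ₂)) (h0 : ∀ t ∈ openInterval μ₁ μ₂, 0 ≤ f t)
    (hC : ∀ a ∈ openInterval μ₁ μ₂, ∀ b ∈ openInterval μ₁ μ₂, a ≤ b → ∫ t in a..b, f t ≤ C) :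
    IntegrableOn f (openInterval μ₁ μ₂) := by
  obtain ⟨a, b, ha, hb, hma, hmb, hab, hex⟩ := exists_exhaustion hμ
  have hsub : ∀ n, Icc (a n) (b n) ⊆ openInterval μ₁ μ₂ := fun n =>
    Icc_subset_openInterval (hma n) (hmb n)
  have hcov : AECover (volume.restrict (openInterval μ₁ μ₂)) atTop fun n => Icc (a n) (b n) := by
    refine ⟨(ae_restrict_iff' (measurableSet_openInterval _ _)).2 (Eventually.of_forall ?_),
      fun n => measurableSet_Icc⟩
    intro t ht
    obtain ⟨n, hn⟩ := hex t ht
    filter_upwards [eventually_ge_atTop n] with m hm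
    exact ⟨(ha hm).trans hn.1.le, hn.2.le.trans (hb hm)⟩
  have hr : ∀ n, (volume.restrict (openInterval μ₁ μ₂)).restrict (Icc (a n) (b n)) =
      volume.restrict (Icc (a n) (b n)) := fun n => by
    rw [Measure.restrict_restrict measurableSet_Icc, inter_eq_self_of_subset_left (hsub n)]
  refine hcov.integrable_of_integral_bounded_of_nonneg_ae C (fun n => ?_)
    ((ae_restrict_iff' (measurableSet_openInterval _ _)).2 (Eventually.of_forall h0))
    (Eventually.of_forall fun n => ?_)
  · rw [IntegrableOn, hr n]
    exact (hf.mono (hsub n)).integrableOn_Icc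
  · rw [hr n, integral_Icc_eq_integral_Ioc, ← intervalIntegral.integral_of_le (hab n)]
    exact hC _ (hma n) _ (hmb n) (hab n)

theorem setIntegral_le_of_disjoint {f : ℝ → ℝ} (hf : IntegrableOn f (openInterval μ₁ μ₂))
    (h0 : ∀ t ∈ openInterval μ₁ μ₂, 0 ≤ f t) {a b a₀ b₀ : ℝ} (ha : a ∈ openInterval μ₁ μ₂)
    (hb : b ∈ openInterval μ₁ μ₂) (hab : a ≤ b) (hd : b ≤ a₀ ∨ b₀ ≤ a) :
    ∫ t in a..b, f t ≤ ∫ t in openInterval μ₁ μ₂ \ Icc a₀ b₀, ‖f t‖ := by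
  have hsub : Ioo a b ⊆ openInterval μ₁ μ₂ \ Icc a₀ b₀ := fun t ht =>
    ⟨Icc_subset_openInterval ha hb (Ioo_subset_Icc_self ht), fun h => by
      rcases hd with hd | hd
      · linarith [ht.2, h.1]
      · linarith [ht.1, h.2]⟩
  rw [intervalIntegral.integral_of_le hab, integral_Ioc_eq_integral_Ioo]
  calc ∫ t in Ioo a b, f t = ∫ t in Ioo a b, ‖f t‖ := by
        refine setIntegral_congr_fun measurableSet_Ioo fun t ht => ?_
        exact (Real.norm_of_nonneg (h0 t (hsub ht).1)).symm
    _ ≤ _ := setIntegral_mono_set (IntegrableOn.mono_set (f := fun t => ‖f t‖) hf.norm sdiff_subset)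
        (Eventually.of_forall fun t => norm_nonneg _) hsub.eventuallyLE

end Exhaustion

/-! ### The energy bound and the strong integral of the resolvent. -/

section Improper

variable {H₀ H₁ : Type*}
  [NormedAddCommGroup H₀] [InnerProductSpace ℂ H₀] [CompleteSpace H₀]
  [NormedAddCommGroup H₁] [InnerProductSpace ℂ H₁] [CompleteSpace H₁]
  {E : SpectralMeasure H₀} {B : H₁ →L[ℂ] H₀} {μ₁ μ₂ : EReal} {D : Set ℂ} {K' : ℂ → H₁ →L[ℂ] H₁}
  {Z : H₁ →L[ℂ] H₁}

/-- The integral `∫_[a,b) E(dt) B (Z - t)⁻¹ x`. -/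
noncomputable def resolventIntegral (E : SpectralMeasure H₀) (B : H₁ →L[ℂ] H₀) (Z : H₁ →L[ℂ] H₁)
    (a b : ℝ) (x : H₁) : H₀ :=
  E.stieltjes (fun t => B (resolventAt Z (t : ℂ) x))
    (fun t => B (deriv (resolventAt Z) (t : ℂ) x)) a b

/-- The quadratic form of the derivative of `K_B`. -/
noncomputable def energy (K' : ℂ → H₁ →L[ℂ] H₁) (t : ℝ) (x : H₁) : ℝ :=
  (inner ℂ x (K' (t : ℂ) x)).re

variable (hK : IsContinuedDerivative E B μ₁ μ₂ D K')
  (hu : ∀ t ∈ openInterval μ₁ μ₂, IsUnit (Z - (t : ℂ) • (1 : H₁ →L[ℂ] H₁)))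

include hK in
theorem energy_nonneg {t : ℝ} (ht : t ∈ openInterval μ₁ μ₂) (x : H₁) : 0 ≤ energy K' t x :=
  re_inner_nonneg_of_hasDerivAt_spectralK (hK.hasDerivAt t ht) x

include hK in
theorem continuousOn_energy {u : ℝ → H₁} (hc : ContinuousOn u (openInterval μ₁ μ₂)) :
    ContinuousOn (fun t => energy K' t (u t)) (openInterval μ₁ μ₂) :=
  Complex.continuous_re.comp_continuousOn (hc.inner (hK.continuousOn.clm_apply hc))

-- For constant u = y the Stieltjes integral is E([a, b)) B y, so the norm formula turns the energy
-- into the squared norm of a projection of `B y`.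
include hK in
theorem integral_energy_le (hac : ∀ x : H₀, E.scalar x ≪ volume) {a b : ℝ}
    (ha : a ∈ openInterval μ₁ μ₂) (hb : b ∈ openInterval μ₁ μ₂) (hab : a ≤ b) (y : H₁) :
    ∫ t in a..b, energy K' t y ≤ ‖B y‖ ^ 2 := by
  have hsub := Icc_subset_openInterval ha hb
  have h := norm_stieltjes_sq_eq_integral (u := fun _ => y) (u' := fun _ => 0)
    (k := fun t => K' (t : ℂ)) hac hab
    (fun t _ => hasDerivAt_const t y) continuousOn_const
    (fun t ht => hK.hasDerivAt t (hsub ht)) (hK.continuousOn.mono hsub)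
  simp only [energy]
  rw [← h]
  simp only [SpectralMeasure.stieltjes, map_zero, intervalIntegral.integral_zero, sub_zero]
  gcongr
  exact E.norm_proj_le measurableSet_Ico _

include hu

theorem continuousOn_resolventAt_apply (x : H₁) :
    ContinuousOn (fun t : ℝ => resolventAt Z (t : ℂ) x) (openInterval μ₁ μ₂) := fun t ht =>
  (hasDerivAt_resolventAt_apply (hu t ht) x).continuousAt.continuousWithinAt

omit [CompleteSpace H₀] in
theorem hasDerivAt_resolvent_comp {t : ℝ} (ht : t ∈ openInterval μ₁ μ₂) (x : H₁) :
    HasDerivAt (fun t : ℝ => B (resolventAt Z (t : ℂ) x)) (B (deriv (resolventAt Z) (t : ℂ) x))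
      t :=
  hasDerivAt_comp_clm B (hasDerivAt_resolventAt_apply (hu t ht) x)

theorem continuousOn_deriv_resolventAt_apply (x : H₁) :
    ContinuousOn (fun t : ℝ => deriv (resolventAt Z) (t : ℂ) x) (openInterval μ₁ μ₂) :=
  fun t ht => (continuousAt_deriv_resolventAt_apply (hu t ht) x).continuousWithinAt

omit [CompleteSpace H₀] in
theorem continuousOn_deriv_resolvent_comp (x : H₁) :
    ContinuousOn (fun t : ℝ => B (deriv (resolventAt Z) (t : ℂ) x)) (openInterval μ₁ μ₂) :=
  B.continuous.comp_continuousOn (continuousOn_deriv_resolventAt_apply hu x)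

theorem resolventIntegral_add (hac : ∀ x : H₀, E.scalar x ≪ volume) {a b c : ℝ}
    (ha : a ∈ openInterval μ₁ μ₂) (hc : c ∈ openInterval μ₁ μ₂) (hab : a ≤ b) (hbc : b ≤ c)
    (x : H₁) : resolventIntegral E B Z a b x + resolventIntegral E B Z b c x =
      resolventIntegral E B Z a c x :=
  SpectralMeasure.stieltjes_add hac ⟨fun _ h _ h' => Icc_subset_openInterval h h'⟩
    (fun _ ht => hasDerivAt_resolvent_comp hu ht x) (continuousOn_deriv_resolvent_comp hu x)
    ha hc hab hbc

theorem resolventIntegral_map_add (hac : ∀ x : H₀, E.scalar x ≪ volume) {a b : ℝ}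
    (ha : a ∈ openInterval μ₁ μ₂) (hb : b ∈ openInterval μ₁ μ₂) (hab : a ≤ b) (x y : H₁) :
    resolventIntegral E B Z a b (x + y) =
      resolventIntegral E B Z a b x + resolventIntegral E B Z a b y := by
  have hi := fun x => SpectralMeasure.intervalIntegrable_proj_Ico hac le_rfl hab
    ((continuousOn_deriv_resolvent_comp (B := B) hu x).mono (Icc_subset_openInterval ha hb))
  simp only [resolventIntegral, SpectralMeasure.stieltjes, map_add]
  rw [intervalIntegral.integral_add (hi x) (hi y)]
  abel

omit [CompleteSpace H₁] hu in
theorem resolventIntegral_map_smul {a b : ℝ} (c : ℂ) (x : H₁) :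
    resolventIntegral E B Z a b (c • x) = c • resolventIntegral E B Z a b x := by
  simp only [resolventIntegral, SpectralMeasure.stieltjes, map_smul,
    intervalIntegral.integral_smul, smul_sub]

include hK

theorem norm_resolventIntegral_sq (hac : ∀ x : H₀, E.scalar x ≪ volume) {a b : ℝ}
    (ha : a ∈ openInterval μ₁ μ₂) (hb : b ∈ openInterval μ₁ μ₂) (hab : a ≤ b) (x : H₁) :
    ‖resolventIntegral E B Z a b x‖ ^ 2 =
      ∫ t in a..b, energy K' t (resolventAt Z (t : ℂ) x) := by
  have hsub := Icc_subset_openInterval ha hb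
  exact norm_stieltjes_sq_eq_integral (k := fun t => K' (t : ℂ)) hac hab
    (fun t ht => hasDerivAt_resolventAt_apply (hu t (hsub ht)) x)
    ((continuousOn_deriv_resolventAt_apply hu x).mono hsub)
    (fun t ht => hK.hasDerivAt t (hsub ht)) (hK.continuousOn.mono hsub)

/-- From t R(t)x = R(t)Zx - x and positivity, t² times the energy of R(t)x is at most twice the
energy of R(t)Zx plus twice the energy of `x`. Writing the weight of exponent `m` as (1 + t²) times
that of exponent m + 1 bounds the integral by the hypothesis for `x` and `Z x`, plus the integrable
energy of the fixed vector `x`. -/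
theorem weighted_energy_bound_step (hac : ∀ x : H₀, E.scalar x ≪ volume) {m : ℕ}
    (h : ∃ C ≥ (0 : ℝ), ∀ x : H₁, ∀ a ∈ openInterval μ₁ μ₂, ∀ b ∈ openInterval μ₁ μ₂, a ≤ b →
      ∫ t in a..b, ((1 + t ^ 2) ^ (m + 1))⁻¹ * energy K' t (resolventAt Z (t : ℂ) x) ≤
        C * ‖x‖ ^ 2) :
    ∃ C ≥ (0 : ℝ), ∀ x : H₁, ∀ a ∈ openInterval μ₁ μ₂, ∀ b ∈ openInterval μ₁ μ₂, a ≤ b →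
      ∫ t in a..b, ((1 + t ^ 2) ^ m)⁻¹ * energy K' t (resolventAt Z (t : ℂ) x) ≤
        C * ‖x‖ ^ 2 := by
  obtain ⟨C, hC0, hC⟩ := h
  -- The contributions are C for `x`, 2C‖Z‖² for `Z x`, and 2‖B‖² for the energy of the constant
  -- vector.
  refine ⟨C * (1 + 2 * ‖Z‖ ^ 2) + 2 * ‖B‖ ^ 2, by positivity, fun x a ha b hb hab => ?_⟩
  have hsub := Icc_subset_openInterval ha hb
  have hwc : ∀ n : ℕ, Continuous fun t : ℝ => ((1 + t ^ 2) ^ n)⁻¹ := fun n =>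
    Continuous.inv₀ (by fun_prop) fun t => by positivity
  have hint : ∀ (n : ℕ) (u : ℝ → H₁), ContinuousOn u (openInterval μ₁ μ₂) →
      IntervalIntegrable (fun t => ((1 + t ^ 2) ^ n)⁻¹ * energy K' t (u t)) volume a b := by
    intro n u huc
    refine ContinuousOn.intervalIntegrable ?_
    rw [uIcc_of_le hab]
    exact ((hwc n).continuousOn.mul (continuousOn_energy hK huc)).mono hsub
  have hx := continuousOn_resolventAt_apply hu x
  have hZx := continuousOn_resolventAt_apply hu (Z x)
  have i1 := hint (m + 1) _ hx
  have i2 := (hint (m + 1) _ hZx).const_mul 2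
  have i3 : IntervalIntegrable (fun t => 2 * energy K' t x) volume a b := by
    have := (hint 0 (fun _ => x) continuousOn_const).const_mul 2
    simpa using this
  have hle : ∫ t in a..b, ((1 + t ^ 2) ^ m)⁻¹ * energy K' t (resolventAt Z (t : ℂ) x) ≤
      ∫ t in a..b, (((1 + t ^ 2) ^ (m + 1))⁻¹ * energy K' t (resolventAt Z (t : ℂ) x) +
        2 * (((1 + t ^ 2) ^ (m + 1))⁻¹ * energy K' t (resolventAt Z (t : ℂ) (Z x))) +
        2 * energy K' t x) := by
    refine intervalIntegral.integral_mono_on hab (hint m _ hx) ((i1.add i2).add i3) fun t ht => ?_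
    have ht' := hsub ht
    have e1 : (t : ℂ) • resolventAt Z (t : ℂ) x = resolventAt Z (t : ℂ) (Z x) - x := by
      rw [resolventAt_mul_cancel (hu t ht'), add_sub_cancel_left]
    have e2 : energy K' t ((t : ℂ) • resolventAt Z (t : ℂ) x) =
        t ^ 2 * energy K' t (resolventAt Z (t : ℂ) x) := by
      simp only [energy, map_smul, inner_smul_left, inner_smul_right, Complex.conj_ofReal,
        ← mul_assoc, ← Complex.ofReal_mul, Complex.re_ofReal_mul]
      ring
    have e3 : t ^ 2 * energy K' t (resolventAt Z (t : ℂ) x) ≤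
        2 * energy K' t (resolventAt Z (t : ℂ) (Z x)) + 2 * energy K' t x := by
      rw [← e2, e1]
      exact re_inner_sub_le_of_nonneg (fun y => energy_nonneg hK ht' y) _ _
    have hw : (0 : ℝ) < ((1 + t ^ 2) ^ (m + 1))⁻¹ := by positivity
    have hw1 : ((1 + t ^ 2) ^ (m + 1))⁻¹ ≤ (1 : ℝ) := inv_le_one_of_one_le₀
      (one_le_pow₀ (by linarith [sq_nonneg t]))
    have hw2 : ((1 + t ^ 2) ^ m)⁻¹ = ((1 + t ^ 2) ^ (m + 1))⁻¹ * (1 + t ^ 2) := by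
      have : (1 + t ^ 2 : ℝ) ≠ 0 := by positivity
      field_simp
      ring
    have hx0 := energy_nonneg hK ht' x
    rw [hw2]
    nlinarith
  refine hle.trans ?_
  rw [intervalIntegral.integral_add (i1.add i2) i3, intervalIntegral.integral_add i1 i2,
    intervalIntegral.integral_const_mul, intervalIntegral.integral_const_mul]
  have b1 := hC x a ha b hb hab
  have b2 := hC (Z x) a ha b hb hab
  have b3 := integral_energy_le hK hac ha hb hab x
  have b4 : ‖Z x‖ ^ 2 ≤ ‖Z‖ ^ 2 * ‖x‖ ^ 2 := by
    rw [← mul_pow]; gcongr; exact Z.le_opNorm x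
  have b5 : ‖B x‖ ^ 2 ≤ ‖B‖ ^ 2 * ‖x‖ ^ 2 := by
    rw [← mul_pow]; gcongr; exact B.le_opNorm x
  nlinarith

/-- For large m the weighted norm of `K'` is integrable and the resolvent is bounded, which starts a
descending induction to weight 1. -/
theorem exists_energy_bound (hac : ∀ x : H₀, E.scalar x ≪ volume) {C : ℝ}
    (hC : ∀ t ∈ openInterval μ₁ μ₂, ‖resolventAt Z (t : ℂ)‖ ≤ C) :
    ∃ C ≥ (0 : ℝ), ∀ x : H₁, ∀ a ∈ openInterval μ₁ μ₂, ∀ b ∈ openInterval μ₁ μ₂, a ≤ b →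
      ∫ t in a..b, energy K' t (resolventAt Z (t : ℂ) x) ≤ C * ‖x‖ ^ 2 := by
  obtain ⟨m, hm⟩ := hK.exists_integrableOn_weight
  have hbase : ∃ C ≥ (0 : ℝ), ∀ x : H₁, ∀ a ∈ openInterval μ₁ μ₂, ∀ b ∈ openInterval μ₁ μ₂,
      a ≤ b → ∫ t in a..b, ((1 + t ^ 2) ^ m)⁻¹ * energy K' t (resolventAt Z (t : ℂ) x) ≤
        C * ‖x‖ ^ 2 := by
    set J := ∫ t in openInterval μ₁ μ₂, ((1 + t ^ 2) ^ m)⁻¹ * ‖K' (t : ℂ)‖ with hJ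
    have hnn : ∀ t : ℝ, 0 ≤ ((1 + t ^ 2) ^ m)⁻¹ * ‖K' (t : ℂ)‖ := fun t => by positivity
    have hJ0 : 0 ≤ J := integral_nonneg hnn
    refine ⟨J * C ^ 2, by positivity, fun x a ha b hb hab => ?_⟩
    have hsub := Icc_subset_openInterval ha hb
    have hwc : Continuous fun t : ℝ => ((1 + t ^ 2) ^ m)⁻¹ :=
      Continuous.inv₀ (by fun_prop) fun t => by positivity
    have i1 : IntervalIntegrable (fun t => ((1 + t ^ 2) ^ m)⁻¹ *
        energy K' t (resolventAt Z (t : ℂ) x)) volume a b := by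
      refine ContinuousOn.intervalIntegrable ?_
      rw [uIcc_of_le hab]
      exact (hwc.continuousOn.mul
        (continuousOn_energy hK (continuousOn_resolventAt_apply hu x))).mono hsub
    have i2 : IntervalIntegrable (fun t => ((1 + t ^ 2) ^ m)⁻¹ * ‖K' (t : ℂ)‖) volume a b := by
      refine ContinuousOn.intervalIntegrable ?_
      rw [uIcc_of_le hab]
      exact (hwc.continuousOn.mul hK.continuousOn.norm).mono hsub
    calc ∫ t in a..b, ((1 + t ^ 2) ^ m)⁻¹ * energy K' t (resolventAt Z (t : ℂ) x)
        ≤ ∫ t in a..b, (((1 + t ^ 2) ^ m)⁻¹ * ‖K' (t : ℂ)‖) * (C ^ 2 * ‖x‖ ^ 2) := by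
          refine intervalIntegral.integral_mono_on hab i1 (i2.mul_const _) fun t ht => ?_
          rw [mul_assoc]
          gcongr
          set y := resolventAt Z (t : ℂ) x
          have hy : ‖y‖ ≤ C * ‖x‖ := (ContinuousLinearMap.le_opNorm _ _).trans
            (by gcongr; exact hC t (hsub ht))
          calc energy K' t y ≤ ‖inner ℂ y (K' (t : ℂ) y)‖ := Complex.re_le_norm _
            _ ≤ ‖y‖ * (‖K' (t : ℂ)‖ * ‖y‖) := (norm_inner_le_norm _ _).trans
              (by gcongr; exact ContinuousLinearMap.le_opNorm _ _)
            _ = ‖K' (t : ℂ)‖ * ‖y‖ ^ 2 := by ring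
            _ ≤ ‖K' (t : ℂ)‖ * (C * ‖x‖) ^ 2 := by gcongr
            _ = _ := by ring
      _ = (∫ t in a..b, ((1 + t ^ 2) ^ m)⁻¹ * ‖K' (t : ℂ)‖) * (C ^ 2 * ‖x‖ ^ 2) :=
          intervalIntegral.integral_mul_const _ _
      _ ≤ J * (C ^ 2 * ‖x‖ ^ 2) := by
          gcongr
          rw [intervalIntegral.integral_of_le hab]
          exact setIntegral_mono_set hm (Eventually.of_forall hnn)
            (Ioc_subset_Icc_self.trans hsub).eventuallyLE
      _ = J * C ^ 2 * ‖x‖ ^ 2 := by ring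
  have hind : ∀ m : ℕ, (∃ C ≥ (0 : ℝ), ∀ x : H₁, ∀ a ∈ openInterval μ₁ μ₂,
      ∀ b ∈ openInterval μ₁ μ₂, a ≤ b →
        ∫ t in a..b, ((1 + t ^ 2) ^ m)⁻¹ * energy K' t (resolventAt Z (t : ℂ) x) ≤
        C * ‖x‖ ^ 2) → ∃ C ≥ (0 : ℝ), ∀ x : H₁, ∀ a ∈ openInterval μ₁ μ₂,
      ∀ b ∈ openInterval μ₁ μ₂, a ≤ b →
        ∫ t in a..b, energy K' t (resolventAt Z (t : ℂ) x) ≤ C * ‖x‖ ^ 2 := by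
    intro m
    induction m with
    | zero => intro h; simpa using h
    | succ m ih => exact fun h => ih (weighted_energy_bound_step hK hu hac h)
  exact hind m hbase

/-- Enlarging [a₀, b₀) adds two pieces whose squared norms are energy integrals over the tails, so
the truncated integrals are Cauchy. -/
theorem exists_tendsto_resolventIntegral (hμ : μ₁ < μ₂) (hac : ∀ x : H₀, E.scalar x ≪ volume)
    {x : H₁}
    (hi : IntegrableOn (fun t => energy K' t (resolventAt Z (t : ℂ) x)) (openInterval μ₁ μ₂)) :
    ∃ y : H₀, ∀ ε > (0 : ℝ), ∃ a₀ ∈ openInterval μ₁ μ₂, ∃ b₀ ∈ openInterval μ₁ μ₂, a₀ ≤ b₀ ∧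
      ∀ a ∈ openInterval μ₁ μ₂, a ≤ a₀ → ∀ b ∈ openInterval μ₁ μ₂, b₀ ≤ b →
        ‖resolventIntegral E B Z a b x - y‖ < ε := by
  have hnn : ∀ t ∈ openInterval μ₁ μ₂, 0 ≤ energy K' t (resolventAt Z (t : ℂ) x) :=
    fun t ht => energy_nonneg hK ht _
  have key : ∀ ε > (0 : ℝ), ∃ a₀ ∈ openInterval μ₁ μ₂, ∃ b₀ ∈ openInterval μ₁ μ₂, a₀ ≤ b₀ ∧
      ∀ a ∈ openInterval μ₁ μ₂, a ≤ a₀ → ∀ b ∈ openInterval μ₁ μ₂, b₀ ≤ b →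
        ‖resolventIntegral E B Z a b x - resolventIntegral E B Z a₀ b₀ x‖ < ε := by
    intro ε hε
    obtain ⟨a₀, ha₀, b₀, hb₀, hab₀, htail, -⟩ := exists_tail_lt hμ hi
      (ε := (ε / 2) ^ 2) (by positivity)
    refine ⟨a₀, ha₀, b₀, hb₀, hab₀, fun a ha haa b hb hbb => ?_⟩
    have e : resolventIntegral E B Z a b x - resolventIntegral E B Z a₀ b₀ x =
        resolventIntegral E B Z a a₀ x + resolventIntegral E B Z b₀ b x := by
      rw [← resolventIntegral_add hu hac ha hb (haa.trans hab₀) hbb,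
        ← resolventIntegral_add hu hac ha hb₀ haa hab₀]
      abel
    have h1 : ‖resolventIntegral E B Z a a₀ x‖ < ε / 2 := by
      refine lt_of_pow_lt_pow_left₀ 2 (by positivity) ?_
      rw [norm_resolventIntegral_sq hK hu hac ha ha₀ haa]
      exact (setIntegral_le_of_disjoint hi hnn ha ha₀ haa (Or.inl le_rfl)).trans_lt htail
    have h2 : ‖resolventIntegral E B Z b₀ b x‖ < ε / 2 := by
      refine lt_of_pow_lt_pow_left₀ 2 (by positivity) ?_
      rw [norm_resolventIntegral_sq hK hu hac hb₀ hb hbb]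
      exact (setIntegral_le_of_disjoint hi hnn hb₀ hb hbb (Or.inr le_rfl)).trans_lt htail
    rw [e]
    exact (norm_add_le _ _).trans_lt (by linarith)
  obtain ⟨a, b, ha, hb, hma, hmb, hab, hex⟩ := exists_exhaustion hμ
  have hev : ∀ a₀ ∈ openInterval μ₁ μ₂, ∀ b₀ ∈ openInterval μ₁ μ₂, ∃ n, ∀ m ≥ n,
      a m ≤ a₀ ∧ b₀ ≤ b m := by
    intro a₀ ha₀ b₀ hb₀
    obtain ⟨n₁, h1⟩ := hex a₀ ha₀
    obtain ⟨n₂, h2⟩ := hex b₀ hb₀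
    exact ⟨max n₁ n₂, fun m hm => ⟨(ha ((le_max_left _ _).trans hm)).trans h1.1.le,
      h2.2.le.trans (hb ((le_max_right _ _).trans hm))⟩⟩
  have hcau : CauchySeq fun n => resolventIntegral E B Z (a n) (b n) x := by
    refine Metric.cauchySeq_iff.2 fun ε hε => ?_
    obtain ⟨a₀, ha₀, b₀, hb₀, hab₀, h⟩ := key (ε / 2) (by positivity)
    obtain ⟨n, hn⟩ := hev a₀ ha₀ b₀ hb₀
    refine ⟨n, fun i hi j hj => ?_⟩
    have h1 := h _ (hma i) (hn i hi).1 _ (hmb i) (hn i hi).2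
    have h2 := h _ (hma j) (hn j hj).1 _ (hmb j) (hn j hj).2
    rw [← dist_eq_norm] at h1 h2
    exact (dist_triangle_right _ _ _).trans_lt (by linarith)
  obtain ⟨y, hy⟩ := cauchySeq_tendsto_of_complete hcau
  refine ⟨y, fun ε hε => ?_⟩
  obtain ⟨a₀, ha₀, b₀, hb₀, hab₀, h⟩ := key (ε / 3) (by positivity)
  refine ⟨a₀, ha₀, b₀, hb₀, hab₀, fun a' ha' haa b' hb' hbb => ?_⟩
  obtain ⟨n, hn⟩ := hev a₀ ha₀ b₀ hb₀
  have hlim : ‖y - resolventIntegral E B Z a₀ b₀ x‖ ≤ ε / 3 := by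
    refine le_of_tendsto (hy.sub_const _).norm ?_
    filter_upwards [eventually_ge_atTop n] with m hm
    exact (h _ (hma m) (hn m hm).1 _ (hmb m) (hn m hm).2).le
  have h1 := h a' ha' haa b' hb' hbb
  calc ‖resolventIntegral E B Z a' b' x - y‖ =
      ‖(resolventIntegral E B Z a' b' x - resolventIntegral E B Z a₀ b₀ x) -
        (y - resolventIntegral E B Z a₀ b₀ x)‖ := by rw [sub_sub_sub_cancel_right]
    _ ≤ _ := norm_sub_le _ _
    _ < ε := by linarith

/-- The strong integral of the resolvent exists and is a bounded operator, which is described by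
its matrix elements against the range of `B` and satisfies an operator equation of Sylvester
type. -/
theorem exists_hasStrongIntegral (hμ : μ₁ < μ₂) {A : H₀ →ₗ.[ℂ] H₀} (hA : IsSelfAdjoint A)
    (hE : IsSpectralMeasureOf E A) (hac : ∀ x : H₀, E.scalar x ≪ volume)
    (hfull : ∀ x : H₀, E.scalar x (openInterval μ₁ μ₂)ᶜ = 0) {C : ℝ}
    (hC : ∀ t ∈ openInterval μ₁ μ₂, ‖resolventAt Z (t : ℂ)‖ ≤ C) :
    ∃ Y : H₁ →L[ℂ] H₀,
      HasStrongIntegral E (fun t => B ∘L resolventAt Z (t : ℂ)) (openInterval μ₁ μ₂) Y ∧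
      (∀ x y : H₁, IntegrableOn (fun t : ℝ => inner ℂ y (K' (t : ℂ) (resolventAt Z (t : ℂ) x)))
        (openInterval μ₁ μ₂) ∧ inner ℂ (B y) (Y x) =
          ∫ t in openInterval μ₁ μ₂, inner ℂ y (K' (t : ℂ) (resolventAt Z (t : ℂ) x))) ∧
      ∀ (x : H₀) (hx : x ∈ A.domain) (y : H₁),
        inner ℂ (A ⟨x, hx⟩) (Y y) = inner ℂ x (Y (Z y) - B y) := by
  obtain ⟨Q, hQ0, hQ⟩ := exists_energy_bound hK hu hac hC
  have hi : ∀ x : H₁, IntegrableOn (fun t => energy K' t (resolventAt Z (t : ℂ) x))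
      (openInterval μ₁ μ₂) := fun x => integrableOn_openInterval_of_nonneg hμ
    (continuousOn_energy hK (continuousOn_resolventAt_apply hu x))
    (fun t ht => energy_nonneg hK ht _) (hQ x)
  have hi' : ∀ y : H₁, IntegrableOn (fun t => energy K' t y) (openInterval μ₁ μ₂) := fun y =>
    integrableOn_openInterval_of_nonneg hμ (continuousOn_energy hK continuousOn_const)
      (fun t ht => energy_nonneg hK ht _)
      fun a ha b hb hab => integral_energy_le hK hac ha hb hab y
  obtain ⟨a, b, ha, hb, hma, hmb, hab, hex⟩ := exists_exhaustion hμ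
  have hev : ∀ a₀ ∈ openInterval μ₁ μ₂, ∀ b₀ ∈ openInterval μ₁ μ₂, ∀ᶠ m in atTop,
      a m ≤ a₀ ∧ b₀ ≤ b m := by
    intro a₀ ha₀ b₀ hb₀
    obtain ⟨n₁, h1⟩ := hex a₀ ha₀
    obtain ⟨n₂, h2⟩ := hex b₀ hb₀
    filter_upwards [eventually_ge_atTop n₁, eventually_ge_atTop n₂] with m hm1 hm2
    exact ⟨(ha hm1).trans h1.1.le, h2.2.le.trans (hb hm2)⟩
  choose y hy using fun x => exists_tendsto_resolventIntegral hK hu hμ hac (hi x)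
  have hlim : ∀ x, Tendsto (fun n => resolventIntegral E B Z (a n) (b n) x) atTop (𝓝 (y x)) := by
    intro x
    refine Metric.tendsto_nhds.2 fun ε hε => ?_
    obtain ⟨a₀, ha₀, b₀, hb₀, -, h⟩ := hy x ε hε
    filter_upwards [hev a₀ ha₀ b₀ hb₀] with m hm
    rw [dist_eq_norm]
    exact h _ (hma m) hm.1 _ (hmb m) hm.2
  have hnorm : ∀ n x, ‖resolventIntegral E B Z (a n) (b n) x‖ ≤ Real.sqrt Q * ‖x‖ := by
    intro n x
    refine abs_le_of_sq_le_sq' ?_ (by positivity) |>.2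
    rw [norm_resolventIntegral_sq hK hu hac (hma n) (hmb n) (hab n), mul_pow, Real.sq_sqrt hQ0]
    exact hQ x _ (hma n) _ (hmb n) (hab n)
  let Y : H₁ →L[ℂ] H₀ := LinearMap.mkContinuous
    { toFun := y
      map_add' := fun x₁ x₂ => by
        refine tendsto_nhds_unique (hlim (x₁ + x₂)) (((hlim x₁).add (hlim x₂)).congr fun n => ?_)
        exact (resolventIntegral_map_add hu hac (hma n) (hmb n) (hab n) x₁ x₂).symm
      map_smul' := fun c x => by
        refine tendsto_nhds_unique (hlim (c • x)) (((hlim x).const_smul c).congr fun n => ?_)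
        exact (resolventIntegral_map_smul c x).symm } (Real.sqrt Q)
    fun x => le_of_tendsto (hlim x).norm (Eventually.of_forall fun n => hnorm n x)
  have hY : ∀ x, Y x = y x := fun x => rfl
  refine ⟨Y, fun x => ⟨fun a b => resolventIntegral E B Z a b x, ?_, fun ε hε => hy x ε hε⟩,
    ?_, ?_⟩
  · intro a ha b hb hab
    have hsub := Icc_subset_openInterval ha hb
    exact hasStieltjesIntegral_stieltjes hac hab
      (F := fun t => B ∘L resolventAt Z (t : ℂ))
      (fun t ht => hasDerivAt_resolvent_comp hu (hsub ht) x)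
      ((continuousOn_deriv_resolvent_comp hu x).mono hsub)
  · intro x w
    have hint : IntegrableOn
        (fun t : ℝ => inner ℂ w (K' (t : ℂ) (resolventAt Z (t : ℂ) x)))
        (openInterval μ₁ μ₂) := by
      -- Cauchy-Schwarz for the nonnegative form of K'(t) dominates the mixed term by the two
      -- integrable energies.
      refine (((hi' w).add (hi x)).div_const 2).mono' ?_ ?_
      · exact (continuousOn_const.inner (hK.continuousOn.clm_apply
          (continuousOn_resolventAt_apply hu x))).aestronglyMeasurable
            (measurableSet_openInterval _ _)
      · refine (ae_restrict_iff' (measurableSet_openInterval _ _)).2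
          (Eventually.of_forall fun t ht => ?_)
        exact norm_inner_le_of_nonneg
          (inner_comm_of_hasDerivAt_spectralK (hK.hasDerivAt t ht))
          (fun x => energy_nonneg hK ht x) _ _
    refine ⟨hint, ?_⟩
    have h1 : Tendsto (fun n => inner ℂ (B w) (resolventIntegral E B Z (a n) (b n) x)) atTop
        (𝓝 (inner ℂ (B w) (Y x))) := Tendsto.inner tendsto_const_nhds (hlim x)
    refine tendsto_nhds_unique h1 (Metric.tendsto_nhds.2 fun ε hε => ?_)
    obtain ⟨a₀, ha₀, b₀, hb₀, -, -, h⟩ := exists_tail_lt hμ hint hε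
    filter_upwards [hev a₀ ha₀ b₀ hb₀] with n hn
    have hsub := Icc_subset_openInterval (hma n) (hmb n)
    have e : inner ℂ (B w) (resolventIntegral E B Z (a n) (b n) x) =
        ∫ t in a n..b n, inner ℂ w (K' (t : ℂ) (resolventAt Z (t : ℂ) x)) :=
      inner_stieltjes_eq_integral (k := fun t => K' (t : ℂ)) hac (hab n)
        (fun t ht => hasDerivAt_resolventAt_apply (hu t (hsub ht)) x)
        ((continuousOn_deriv_resolventAt_apply hu x).mono hsub)
        (fun t ht => hK.hasDerivAt t (hsub ht)) (hK.continuousOn.mono hsub) w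
    rw [e, dist_comm, dist_eq_norm]
    exact h _ (hma n) hn.1 _ (hmb n) hn.2
  · intro x hx w
    have h1 : Tendsto (fun n => inner ℂ (A ⟨x, hx⟩) (resolventIntegral E B Z (a n) (b n) w))
        atTop (𝓝 (inner ℂ (A ⟨x, hx⟩) (Y w))) := Tendsto.inner tendsto_const_nhds (hlim w)
    have h2 : Tendsto (fun n => inner ℂ x (resolventIntegral E B Z (a n) (b n) (Z w) -
        E.proj (Ico (a n) (b n)) (B w))) atTop (𝓝 (inner ℂ x (Y (Z w) - B w))) :=
      Tendsto.inner tendsto_const_nhds ((hlim (Z w)).sub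
        (tendsto_proj_Ico (hfull (B w)) ha hb hex))
    refine tendsto_nhds_unique h1 (h2.congr fun n => ?_)
    have hsub := Icc_subset_openInterval (hma n) (hmb n)
    refine (inner_apply_stieltjes hE hA hac (hab n)
      (fun t ht => hasDerivAt_resolvent_comp hu (hsub ht) w)
      ((continuousOn_deriv_resolvent_comp hu w).mono hsub)
      (fun t ht => hasDerivAt_resolvent_comp hu (hsub ht) (Z w))
      ((continuousOn_deriv_resolvent_comp hu (Z w)).mono hsub) (fun t ht => ?_) hx).symm
    -- Here R(t)Zw = tR(t)w + w, so the constant vector is `B w`, and the projections of it exhaust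
    -- `B w` in the limit.
    rw [resolventAt_mul_cancel (hu t (hsub ht)), map_add, map_smul, add_comm]

end Improper
end BlockRiccati

/-! ### Transfer of the resolvent integral from the interval to the contour. -/

namespace BlockRiccati

section Contour

variable {H₀ H₁ : Type*}
  [NormedAddCommGroup H₀] [InnerProductSpace ℂ H₀] [CompleteSpace H₀]
  [NormedAddCommGroup H₁] [InnerProductSpace ℂ H₁] [CompleteSpace H₁]
  {E : SpectralMeasure H₀} {B : H₁ →L[ℂ] H₀} {μ₁ μ₂ : EReal} {D : Set ℂ} {K' : ℂ → H₁ →L[ℂ] H₁}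
  {Z : H₁ →L[ℂ] H₁} {l : ℤˣ} {g : ℝ → ℂ}

theorem IsContour.mapsTo {S : Set ℂ} (hg : IsContour μ₁ μ₂ S g) {t : ℝ}
    (ht : t ∈ openInterval μ₁ μ₂) : g t ∈ S := by
  obtain ⟨h, -, -, h1, hD, -⟩ := hg.deformation
  rw [← h1 t ht]
  exact hD 1 ⟨one_pos, le_rfl⟩ t ht

theorem integrableOn_contour (hK : IsContinuedDerivative E B μ₁ μ₂ D K')
    (hg : IsContour μ₁ μ₂ (sheetDomain D l) g) (hadm : contourVariation μ₁ μ₂ K' g < ⊤)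
    (hu : ∀ z ∈ sheetDomain D l, IsUnit (Z - z • (1 : H₁ →L[ℂ] H₁))) {C : ℝ}
    (hC : ∀ z ∈ sheetDomain D l, ‖resolventAt Z z‖ ≤ C) :
    IntegrableOn (fun t => deriv g t • (K' (g t) * resolventAt Z (g t)))
      (openInterval μ₁ μ₂) := by
  have hgc := hg.locallyLipschitzOn.continuousOn
  have hKc : ContinuousOn (fun t => K' (g t)) (openInterval μ₁ μ₂) := fun t ht =>
    (hK.analytic _ (Or.inr (mem_iUnion.2 ⟨l, hg.mapsTo ht⟩))).continuousAt.comp_continuousWithinAt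
      (hgc t ht)
  have hRc : ContinuousOn (fun t => resolventAt Z (g t)) (openInterval μ₁ μ₂) := fun t ht =>
    (analyticAt_resolventAt (hu _ (hg.mapsTo ht))).continuousAt.comp_continuousWithinAt (hgc t ht)
  refine ⟨(measurable_deriv g).aestronglyMeasurable.smul
    ((hKc.mul hRc).aestronglyMeasurable (measurableSet_openInterval _ _)), ?_⟩
  refine lt_of_le_of_lt (lintegral_mono_ae (g := fun t =>
    ENNReal.ofReal C * (‖deriv g t‖ₑ * ‖K' (g t)‖ₑ)) ?_) ?_
  · refine (ae_restrict_iff' (measurableSet_openInterval _ _)).2 (Eventually.of_forall ?_)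
    intro t ht
    rw [enorm_smul, mul_comm (ENNReal.ofReal C), mul_assoc]
    gcongr
    rw [← ofReal_norm, ← ofReal_norm, ← ENNReal.ofReal_mul (norm_nonneg _)]
    refine ENNReal.ofReal_le_ofReal ((norm_mul_le _ _).trans ?_)
    gcongr
    exact hC _ (hg.mapsTo ht)
  · rw [lintegral_const_mul' _ _ ENNReal.ofReal_ne_top]
    exact ENNReal.mul_lt_top ENNReal.ofReal_lt_top hadm

/-- The integral of the continued derivative of `K_B` and the resolvent along the contour is the
integral along the interval. -/
theorem integral_inner_eq_contour (hμ : μ₁ < μ₂) (hK : IsContinuedDerivative E B μ₁ μ₂ D K')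
    (hg : IsContour μ₁ μ₂ (sheetDomain D l) g) (hadm : contourVariation μ₁ μ₂ K' g < ⊤)
    (hu : ∀ z ∈ closure (sheetDomain D l), IsUnit (Z - z • (1 : H₁ →L[ℂ] H₁))) {C : ℝ}
    (hC : ∀ z ∈ closure (sheetDomain D l), ‖resolventAt Z z‖ ≤ C) (x y : H₁)
    (hi : IntegrableOn (fun t : ℝ => inner ℂ y (K' (t : ℂ) (resolventAt Z (t : ℂ) x)))
      (openInterval μ₁ μ₂)) :
    ∫ t in openInterval μ₁ μ₂, inner ℂ y (K' (t : ℂ) (resolventAt Z (t : ℂ) x)) =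
      -inner ℂ y (transformator μ₁ μ₂ K' g Z x) := by
  have hG := integrableOn_contour hK hg hadm (fun z hz => hu z (subset_closure hz))
    (fun z hz => hC z (subset_closure hz))
  -- A matrix element is a bounded functional, so operator integrability along the contour passes to
  -- the scalar integrand, to which Cauchy's theorem applies.
  let Λ : (H₁ →L[ℂ] H₁) →L[ℂ] ℂ := innerSL ℂ y ∘L ContinuousLinearMap.apply ℂ H₁ x
  have hΛ : ∀ t, Λ (deriv g t • (K' (g t) * resolventAt Z (g t))) =
      deriv g t * inner ℂ y (K' (g t) (resolventAt Z (g t) x)) := fun t => by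
    rw [map_smul]; rfl
  have e : -inner ℂ y (transformator μ₁ μ₂ K' g Z x) =
      ∫ t in openInterval μ₁ μ₂, deriv g t * inner ℂ y (K' (g t) (resolventAt Z (g t) x)) := by
    have h := Λ.integral_comp_comm hG
    simp only [hΛ] at h
    rw [h, ← inner_neg_right, transformator]
    simp [Λ]
  -- With a bounded resolvent, the scalar integrand inherits every growth bound of `K'` up to a
  -- constant.
  have hfb : ∀ z ∈ closure (sheetDomain D l), ∀ b, ‖K' z‖ ≤ b →
      ‖inner ℂ y (K' z (resolventAt Z z x))‖ ≤ (‖y‖ * (C * ‖x‖)) * b := by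
    intro z hz b hb
    have hb0 := (norm_nonneg _).trans hb
    have hC0 := (norm_nonneg _).trans (hC z hz)
    calc ‖inner ℂ y (K' z (resolventAt Z z x))‖ ≤ ‖y‖ * (‖K' z‖ * (‖resolventAt Z z‖ * ‖x‖)) :=
          (norm_inner_le_norm _ _).trans (by
            gcongr
            exact (ContinuousLinearMap.le_opNorm _ _).trans
              (by gcongr; exact ContinuousLinearMap.le_opNorm _ _))
      _ ≤ ‖y‖ * (b * (C * ‖x‖)) := by gcongr; exact hC z hz
      _ = _ := by ring
  rw [e]
  refine contour_integral_eq_sheet hμ hK.isOpen hK.isSimplyConnected hK.lower hg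
    (f := fun z => inner ℂ y (K' z (resolventAt Z z x))) ?_ ?_ ?_ hi ?_
  · intro z hz
    have hz1 : z ∈ closure (sheetDomain D l) := by
      rcases hz with ⟨t, ht, rfl⟩ | hz
      · exact hK.mem_closure ht l
      · exact subset_closure hz
    have hz2 := hK.analytic z (hz.imp id fun h => mem_iUnion.2 ⟨l, h⟩)
    have h1 : AnalyticAt ℂ (fun z => K' z * resolventAt Z z) z :=
      hz2.mul (analyticAt_resolventAt (hu z hz1))
    exact (Λ.analyticAt _).comp h1
  · intro c hc
    obtain ⟨C', -, γ, hγ, δ, hδ, hb⟩ := hK.bound_endpoint c hc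
    refine ⟨‖y‖ * (C * ‖x‖) * C', γ, hγ.1, δ, hδ, fun z hz hzδ => ?_⟩
    rw [mul_assoc _ C']
    exact hfb z (subset_closure hz) _ (hb l z hz hzδ)
  · intro hinf
    obtain ⟨C', -, N, R, -, hb⟩ := hK.bound_infinity hinf
    refine ⟨‖y‖ * (C * ‖x‖) * C', N, R, fun z hz hzR => ?_⟩
    rw [mul_assoc _ C']
    exact hfb z (subset_closure hz) _ (hb l z hz hzR)
  · have h := Λ.integrable_comp hG
    simp only [hΛ] at h
    exact h

end Contour

/-! ### The Riccati equations and the graph subspaces. -/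

section Graphs

variable {H₀ H₁ : Type*}
  [NormedAddCommGroup H₀] [InnerProductSpace ℂ H₀] [CompleteSpace H₀]
  [NormedAddCommGroup H₁] [InnerProductSpace ℂ H₁] [CompleteSpace H₁]
  {A₀ : H₀ →ₗ.[ℂ] H₀} {A₁ : H₁ →L[ℂ] H₁} {B Y : H₁ →L[ℂ] H₀} {Z : H₁ →L[ℂ] H₁}

/-- Tested against `y`, the dual Riccati equation is the weak equation A₀ Y = Y Z - B with Z = A₁ -
B* Y inserted and all operators moved to the other side. -/
theorem isStrongSolutionDualRiccati_adjoint (hA₁ : IsSelfAdjoint A₁)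
    (hZ : ∀ y, Z y = A₁ y - ContinuousLinearMap.adjoint B (Y y))
    (hY : ∀ (x : H₀) (hx : x ∈ A₀.domain) (y : H₁),
      inner ℂ (A₀ ⟨x, hx⟩) (Y y) = inner ℂ x (Y (Z y) - B y)) :
    IsStrongSolutionDualRiccati A₀ A₁ B (ContinuousLinearMap.adjoint Y) := by
  intro x
  refine ext_inner_right ℂ fun y => ?_
  have hs : ∀ u v, inner ℂ (A₁ u) v = inner ℂ u (A₁ v) :=
    ContinuousLinearMap.isSelfAdjoint_iff_isSymmetric.1 hA₁
  have hB : ∀ u v, inner ℂ (B u) v = inner ℂ u (ContinuousLinearMap.adjoint B v) := fun u v =>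
    (ContinuousLinearMap.adjoint_inner_right B u v).symm
  have h := hY x x.2 y
  rw [hZ, map_sub, inner_sub_right, inner_sub_right] at h
  rw [inner_add_left, inner_sub_left, inner_neg_left, hs]
  simp only [ContinuousLinearMap.adjoint_inner_left, hB]
  linear_combination h

theorem inner_involutionJ_graph {x y : WithLp 2 (H₀ × H₁)}
    (hx : x ∈ graphOverFst (ContinuousLinearMap.adjoint Y)) (hy : y ∈ graphOverSnd Y) :
    inner ℂ (involutionJ x) y = 0 := by
  have hx' : x.snd = ContinuousLinearMap.adjoint Y x.fst := hx
  have hy' : y.fst = Y y.snd := hy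
  rw [WithLp.prod_inner_apply]
  change inner ℂ x.fst y.fst + inner ℂ (-x.snd) y.snd = 0
  rw [hx', hy', inner_neg_left, ContinuousLinearMap.adjoint_inner_left, add_neg_cancel]

theorem isInvariantSubspace_graphOverFst {T : H₀ →L[ℂ] H₁}
    (hT : IsStrongSolutionDualRiccati A₀ A₁ B T) :
    IsInvariantSubspace (blockOperator A₀ A₁ B) (graphOverFst T) := by
  constructor
  · have h1 : Continuous fun x : WithLp 2 (H₀ × H₁) => x.fst :=
      (WithLp.fstL 2 ℂ H₀ H₁).continuous
    have h2 : Continuous fun x : WithLp 2 (H₀ × H₁) => x.snd :=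
      (WithLp.sndL 2 ℂ H₀ H₁).continuous
    exact isClosed_eq h2 (T.continuous.comp h1)
  · intro x hx
    have hx' : x.1.snd = T x.1.fst := hx
    have h := hT ⟨x.1.fst, x.2⟩
    change -(ContinuousLinearMap.adjoint B x.1.fst) + A₁ x.1.snd =
      T (A₀ ⟨x.1.fst, x.2⟩ + B x.1.snd)
    rw [hx', map_add, ← h]
    abel

/-- A vector of the graph in Dom L has Y x₁ in Dom A₀; there symmetry of A₀ and density of its
domain turn the weak equation into A₀ Y x₁ = Y Z x₁ - B x₁. It is not needed that `Y` maps all of H₁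
into Dom A₀. -/
theorem isInvariantSubspace_graphOverSnd (hA₀ : IsSelfAdjoint A₀)
    (hZ : ∀ y, Z y = A₁ y - ContinuousLinearMap.adjoint B (Y y))
    (hY : ∀ (x : H₀) (hx : x ∈ A₀.domain) (y : H₁),
      inner ℂ (A₀ ⟨x, hx⟩) (Y y) = inner ℂ x (Y (Z y) - B y)) :
    IsInvariantSubspace (blockOperator A₀ A₁ B) (graphOverSnd Y) := by
  constructor
  · have h1 : Continuous fun x : WithLp 2 (H₀ × H₁) => x.fst :=
      (WithLp.fstL 2 ℂ H₀ H₁).continuous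
    have h2 : Continuous fun x : WithLp 2 (H₀ × H₁) => x.snd :=
      (WithLp.sndL 2 ℂ H₀ H₁).continuous
    exact isClosed_eq h1 (Y.continuous.comp h2)
  · intro x hx
    have hx' : x.1.fst = Y x.1.snd := hx
    change A₀ ⟨x.1.fst, x.2⟩ + B x.1.snd =
      Y (-(ContinuousLinearMap.adjoint B x.1.fst) + A₁ x.1.snd)
    have e : -(ContinuousLinearMap.adjoint B x.1.fst) + A₁ x.1.snd = Z x.1.snd := by
      rw [hZ, hx']; abel
    rw [e, ← eq_sub_iff_add_eq, ← sub_eq_zero]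
    refine hA₀.dense_domain.eq_zero_of_inner_right ℂ fun w hw => ?_
    have hd : x.1.fst ∈ A₀.domain := x.2
    rw [inner_sub_right, ← hY w hw, ← inner_apply_comm_of_isSelfAdjoint hA₀ hw hd, hx', sub_self]

end Graphs
end BlockRiccati

/-! ### The dual Riccati equation and the J-orthogonal invariant graphs. -/

theorem corollary4p4 {H₀ H₁ : Type*}
    [NormedAddCommGroup H₀] [InnerProductSpace ℂ H₀] [CompleteSpace H₀]
    [NormedAddCommGroup H₁] [InnerProductSpace ℂ H₁] [CompleteSpace H₁]
    (A₀ : H₀ →ₗ.[ℂ] H₀) (hA₀ : IsSelfAdjoint A₀)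
    (E : BlockRiccati.SpectralMeasure H₀) (hE : BlockRiccati.IsSpectralMeasureOf E A₀)
    (A₁ : H₁ →L[ℂ] H₁) (hA₁ : IsSelfAdjoint A₁) (B : H₁ →L[ℂ] H₀)
    -- the spectrum of `A₀` is absolutely continuous and is the closure of the interval `Δ₀`
    (μ₁ μ₂ : EReal) (hμ : μ₁ < μ₂)
    (hac : ∀ x : H₀, E.scalar x ≪ volume)
    (hσ₀ : BlockRiccati.unboundedSpectrum A₀ =
      Complex.ofReal '' closure (BlockRiccati.openInterval μ₁ μ₂))
    (hσ₁ : spectrum ℂ A₁ ⊆ Complex.ofReal '' BlockRiccati.openInterval μ₁ μ₂)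
    -- the analytic continuation of the derivative of `K_B`
    (D : Set ℂ) (K' : ℂ → H₁ →L[ℂ] H₁)
    (hK : BlockRiccati.IsContinuedDerivative E B μ₁ μ₂ D K')
    -- an admissible contour `Γ = g(Δ₀)` in `D^l` with `V₀(B, Γ) < d(Γ)² / 4`
    (l : ℤˣ) (g : ℝ → ℂ)
    (hg : BlockRiccati.IsContour μ₁ μ₂ (BlockRiccati.sheetDomain D l) g)
    (hadm : BlockRiccati.contourVariation μ₁ μ₂ K' g < ⊤)
    (hbest : BlockRiccati.contourVariation μ₁ μ₂ K' g <
      BlockRiccati.setDist (spectrum ℂ A₁) (g '' BlockRiccati.openInterval μ₁ μ₂) ^ 2 / 4)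
    -- `X` is the solution of the basic equation in the balls of radius less than
    -- `r_max(Γ) = d(Γ) - V₀(B, Γ)^(1/2)`, and the spectrum of `Z = A₁ + X` is separated from `D^l`
    (X : H₁ →L[ℂ] H₁)
    (hX : BlockRiccati.IsBasicSolution μ₁ μ₂ K' g A₁ X)
    (hXr : ‖X‖ₑ <
      BlockRiccati.setDist (spectrum ℂ A₁) (g '' BlockRiccati.openInterval μ₁ μ₂) -
        BlockRiccati.contourVariation μ₁ μ₂ K' g ^ (1 / 2 : ℝ))
    (hZ : 0 < BlockRiccati.setDist (spectrum ℂ (A₁ + X)) (BlockRiccati.sheetDomain D l)) :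
    -- `Y = ∫_{Δ₀} E(dμ) B (Z - μ)⁻¹`
    ∃ Y : H₁ →L[ℂ] H₀,
      BlockRiccati.HasStrongIntegral E
        (fun μ => B ∘L BlockRiccati.resolventAt (A₁ + X) (μ : ℂ))
        (BlockRiccati.openInterval μ₁ μ₂) Y ∧
      BlockRiccati.IsStrongSolutionDualRiccati A₀ A₁ B (ContinuousLinearMap.adjoint Y) ∧
      (∀ x ∈ BlockRiccati.graphOverFst (ContinuousLinearMap.adjoint Y),
        ∀ y ∈ BlockRiccati.graphOverSnd Y, inner ℂ (BlockRiccati.involutionJ x) y = 0) ∧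
      BlockRiccati.IsInvariantSubspace (BlockRiccati.blockOperator A₀ A₁ B)
        (BlockRiccati.graphOverFst (ContinuousLinearMap.adjoint Y)) ∧
      BlockRiccati.IsInvariantSubspace (BlockRiccati.blockOperator A₀ A₁ B)
        (BlockRiccati.graphOverSnd Y) := by
  -- The separation of spec(Z) from D^l bounds the resolvent on the closure of D^l, which contains
  -- Δ₀.
  obtain ⟨hu, C, hC⟩ := BlockRiccati.exists_norm_resolventAt_le hZ
  obtain ⟨Y, hint, hBY, hAY⟩ := BlockRiccati.exists_hasStrongIntegral hK
    (fun t ht => hu t (hK.mem_closure ht l)) hμ hA₀ hE hac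
    (BlockRiccati.scalar_openInterval_compl hE hA₀ hac hσ₀)
    (fun t ht => hC t (hK.mem_closure ht l))
  have hZY : ∀ y, (A₁ + X) y = A₁ y - ContinuousLinearMap.adjoint B (Y y) := by
    intro x
    -- The matrix elements of B* Y are integrals over Δ₀; moved to Γ they become those of minus the
    -- transformator, which is -X by the basic equation.
    have h : ContinuousLinearMap.adjoint B (Y x) = -X x := by
      refine ext_inner_left ℂ fun y => ?_
      obtain ⟨h1, h2⟩ := hBY x y
      rw [ContinuousLinearMap.adjoint_inner_right, h2,
        BlockRiccati.integral_inner_eq_contour hμ hK hg hadm hu hC x y h1, ← hX.2, inner_neg_right]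
    rw [h, sub_neg_eq_add, add_apply]
  have hR := BlockRiccati.isStrongSolutionDualRiccati_adjoint hA₁ hZY hAY
  exact ⟨Y, hint, hR, fun x hx y hy => BlockRiccati.inner_involutionJ_graph hx hy,
    BlockRiccati.isInvariantSubspace_graphOverFst hR,
    BlockRiccati.isInvariantSubspace_graphOverSnd hA₀ hZY hAY⟩
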